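/- **Setting.** Let $K\in\mathbb C$ with $\operatorname{Re}K>0$, $\operatorname{Im}K>0$, and $\hat D(x,y)=x+x^{-1}+y+y^{-1}-4+K^2$. Let $x_{\rm in},y_{\rm in}\in\mathbb C\setminus\{0\}$ satisfy $\hat D(x_{\rm in},y_{\rm in})=0$ and $|x_{\rm in}|<1$. For $|x|=1$ let $\Xi(x)$ be the root $y$ of $\hat D(x,y)=0$ with $|y|<1$. Let $\eta_{2,1},\eta_{1,1}$ (resp. $\eta_{2,2},\eta_{1,2}$) be the roots of $x+x^{-1}=2-K^2$ (resp. $x+x^{-1}=6-K^2$), with $|\eta_{2,k}|<1<|\eta_{1,k}|$. Let $\hat f_2(x)=x\sqrt{1-\eta_{2,1}/x}\sqrt{1-\eta_{2,2}/x}$ for $|x|\ge1$ and $\hat f_3(x)=c\sqrt{1-x/\eta_{1,1}}\sqrt{1-x/\eta_{1,2}}$ for $|x|\le 1$ (principal roots), where the constant $c$ is fixed by $x(\Xi(x)-\Xi(x)^{-1})=\hat f_2(x)\hat f_3(x)$ on $|x|=1$. **The surface.** Let $\mathbf H_2$ be the compact Riemann surface on which $f_2=\sqrt{(x-\eta_{2,1})(x-\eta_{2,2})}$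 and $f_3=\sqrt{(x-\eta_{1,1})(x-\eta_{1,2})}$ are single-valued, i.e. the closure in $\mathbb P^3$ of $\{(x,f_2,f_3)\}$; put $f_1=f_2f_3$, and let $y$ be the function on $\mathbf H_2$ with $\hat D(x,y)=0$, $x(y-y^{-1})=f_1$. By $(x,y)$ it is an unbranched two-sheet covering of the dispersion surface $\mathbf H=\{\hat D=0\}$. It has eight infinity points (points with $x\in\{0,\infty\}$). Numbered cyclically by $i\in\mathbb Z/8$, they are: $i=1,2,5,6$ over $x=\infty$ with $(f_2/x,f_3/x)=(1,1),(1,-1),(-1,-1),(-1,1)$; $i=0,3,4,7$ over $x=0$ with $(f_2,f_3)=(c^{-1},c),(c^{-1},-c),(-c^{-1},-c),(-c^{-1},c)$. In this order they are $J_1,J_4,J_3,J_2,J_1',J_4',J_3',J_2'$ for $i=0,\dots,7$. Let $p_1,p_4\in\mathbf H_2$ be the points with $x=x_{\rm in}$, $f_2=-x_{\rm in}(y_{\rm in}-y_{\rm in}^{-1})/\hat f_3(x_{\rm in})$ and $f_3=-\hat f_3(x_{\rm in})$, resp. $f_3=\hat f_3(x_{\rm in})$; they lie over $(x_{\rm in},y_{\rm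 in})$ and $(x_{\rm in},y_{\rm in}^{-1})$. Let $w_{m,n}=x^my^n$, $$\Psi=\frac{dx}{x(y-y^{-1})}=-\frac{dy}{y(x-x^{-1})},\qquad A(p)=-\frac{f_1(p_1)+f_3(p_1)f_2(p)}{4\pi i\,(x-x_{\rm in})}.$$ For $j=1,\dots,8$ let $\Gamma_j$ denote any contour on $\mathbf H_2$ (a finite sum of closed $C^1$ curves, each lying in a coordinate disc; for instance one simple closed curve bounding a disc) which avoids the infinity points and $p_1,p_4$, encircles once in the positive direction the infinity points number $j,j+1,j+2,j+3$ (for $j=1$: $J_4,J_3,J_2,J_1'$), and encircles neither the other infinity points nor $p_1,p_4$. **The branched lattice.** $\mathbf S_2$ is the lattice of nodes $(m,n)=(r\cos\phi,r\sin\phi)\in\mathbb Z^2$ with $\phi$ taken modulo $4\pi$, with one common origin $O$; thus the nodes $n=0,m>0$ of either of the sheets $0\le\phi<2\pi$, $2\pi\le\phi<4\pi$ are linked with the nodes $n=-1,m>0$ of the other sheet. A node is described by $\Gamma_j$ if $(j-1)\pi/2\le\phi\le(j+1)\pi/2$ modulo $4\pi$; the origin is described by all $\Gamma_j$. **Theorem.**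 1. $A$ has no singularities on $\mathbf H_2$ except simple poles at $p_1$ and $p_4$, and $\operatorname{Res}[A\Psi,p_1]=-\operatorname{Res}[A\Psi,p_4]=-(2\pi i)^{-1}$. 2. Contours $\Gamma_j$ exist, and $\tilde u(m,n)=\int_{\Gamma_j}w_{m,n}A\Psi$ has the same value for all $j$ such that $\Gamma_j$ describes the node and for all choices of $\Gamma_j$; so this defines a function $\tilde u$ on $\mathbf S_2$. 3. $\tilde u$ solves the reflected diffraction problem: $\tilde u(m+1,n)+\tilde u(m-1,n)+\tilde u(m,n+1)+\tilde u(m,n-1)+(K^2-4)\tilde u(m,n)=0$ on $\mathbf S_2\setminus O$ (with the neighbours in $\mathbf S_2$); $\tilde u=0$ at $O$ and at all nodes with $n=0$, $m>0$ of both sheets; $\tilde u(r,4\pi-\phi)=-\tilde u(r,\phi)$; and $\tilde u-x_{\rm in}^my_{\rm in}^n$ for $0\le\phi\le2\pi$, $\tilde u+x_{\rm in}^my_{\rm in}^{-n}$ for $2\pi\le\phi\le4\pi$ decay exponentially as $r\to\infty$. 4. $\tilde u$ agrees with the Wiener–Hopf solution: with $$u^{\rm sc}_{m,n}=-\frac1{2\pi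 i}\oint_{|z|=1}\frac{z^m\,\Xi(z)^{|n|}\,\hat f_3(x_{\rm in})}{\hat f_3(z)\,(z-x_{\rm in})}\,dz$$ one has $\tilde u=x_{\rm in}^my_{\rm in}^n+u^{\rm sc}_{m,n}$ for $0\le\phi\le2\pi$ and $\tilde u=-(x_{\rm in}^my_{\rm in}^{-n}+u^{\rm sc}_{m,n})$ for $2\pi\le\phi\le4\pi$. 5. Let $R(\tau)=\prod_{j,k}\sqrt{1-\eta_{j,k}\tau}$ (principal roots), $Y(\tau)=\tfrac12\big((4-K^2)\tau-1-\tau^2-R(\tau)\big)$, $g_1=x_{\rm in}(y_{\rm in}-y_{\rm in}^{-1})$, and for $\varepsilon=\pm1$ $$b^\infty_{\varepsilon,n}(\tau)=-\frac{Y(\tau)^n\big(\tau g_1-\varepsilon \hat f_3(x_{\rm in})\sqrt{1-\eta_{2,1}\tau}\sqrt{1-\eta_{2,2}\tau}\big)}{2(1-x_{\rm in}\tau)R(\tau)},$$ $$b^0_{\varepsilon,n}(x)=\frac{Y(x)^n\big(g_1-\varepsilon c^{-1}\hat f_3(x_{\rm in})\sqrt{1-x/\eta_{2,1}}\sqrt{1-x/\eta_{2,2}}\big)}{2(x-x_{\rm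 in})R(x)},$$ and for $N\in\mathbb Z$ let $[g]_N=g^{(N-1)}(0)/(N-1)!$ if $N>0$ and $[g]_N=0$ otherwise. For $i=0,\dots,7$ put $\rho_i(m,n)=-[b^0_{1,-n}]_{-m-n}$, $-[b^\infty_{1,-n}]_{m-n}$, $[b^\infty_{1,n}]_{m+n}$, $[b^0_{1,n}]_{n-m}$, $-[b^0_{-1,-n}]_{-m-n}$, $-[b^\infty_{-1,-n}]_{m-n}$, $[b^\infty_{-1,n}]_{m+n}$, $[b^0_{-1,n}]_{n-m}$, respectively. Then the integral of $w_{m,n}A\Psi$ over any contour which encircles the infinity point number $i$ once and none of the other infinity points, $p_1$, $p_4$ equals $\rho_i(m,n)$, and $\tilde u(m,n)=\rho_j+\rho_{j+1}+\rho_{j+2}+\rho_{j+3}$ (indices modulo 8, arguments $(m,n)$) at each node described by $\Gamma_j$. In particular, on the sheet $0\le\phi<2\pi$, $$\tilde u(m,n)=[b^\infty_{1,n}]_{m+n}-[b^\infty_{1,-n}]_{m-n}\quad(m>n>0),\qquad \tilde u(m,n)=[b^\infty_{1,n}]_{m+n}+[b^0_{1,n}]_{n-m}\quad(n>|m|).$$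 6. Consequently $\tilde u$ at every node is an algebraic function of $(K,x_{\rm in})$: for each node there is a polynomial $Q\in\mathbb C[k,\xi][T]$ such that for all $(K,x_{\rm in},y_{\rm in})$ as above $Q(K,x_{\rm in},T)$ is a nonzero polynomial in $T$ and $Q(K,x_{\rm in},\tilde u)=0$. -/

import Mathlib

open Filter Topology Metric Set
open scoped LinearAlgebra.Projectivization

namespace HalfLine

noncomputable section

/-! ### Dispersion relation, branch points and branches of the square roots -/

/-- The dispersion function `x + x⁻¹ + y + y⁻¹ - 4 + K²`. -/
def Dhat (K x y : ℂ) : ℂ := x + x⁻¹ + y + y⁻¹ - 4 + K ^ 2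

/-- The root of `q² + d q + 1 = 0` lying in the unit disc (when no root has modulus one). -/
def innerRoot (d : ℂ) : ℂ :=
  if ‖(-d + Complex.sqrt (d ^ 2 - 4)) / 2‖ < 1 then (-d + Complex.sqrt (d ^ 2 - 4)) / 2
  else (-d - Complex.sqrt (d ^ 2 - 4)) / 2

/-- The other root of `q² + d q + 1 = 0`. -/
def outerRoot (d : ℂ) : ℂ := -d - innerRoot d

/-- `Ξ(x)`: the root `y` of `D̂(x, y) = 0` with `|y| < 1` (used for `|x| = 1`). -/
def Xi (K x : ℂ) : ℂ := innerRoot (K ^ 2 - 4 + x + x⁻¹)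

/-- The branch points: `Ξ = 1` at `η₁₁, η₂₁` and `Ξ = -1` at `η₁₂, η₂₂`;
`η₂₁, η₂₂` are inside the unit circle and `η₁₁, η₁₂` outside. -/
def eta11 (K : ℂ) : ℂ := outerRoot (K ^ 2 - 2)
def eta12 (K : ℂ) : ℂ := outerRoot (K ^ 2 - 6)
def eta21 (K : ℂ) : ℂ := innerRoot (K ^ 2 - 2)
def eta22 (K : ℂ) : ℂ := innerRoot (K ^ 2 - 6)

/-- The value at `x = 0` of the branch `f3In` below. The sign is the one for which
`x (Ξ(x) - Ξ(x)⁻¹) = f2Out(x) f3In(x)` on the unit circle, `f2Out(x) = x √(1-η₂₁/x) √(1-η₂₂/x)`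
being the branch of `√((x-η₂₁)(x-η₂₂))` that is analytic for `|x| ≥ 1` and equivalent to `x`
at infinity; evaluate that identity at `x = 1`. -/
def f3Zero (K : ℂ) : ℂ :=
  (Xi K 1 - (Xi K 1)⁻¹) / ((1 - eta21 K) * (1 - eta22 K))

/-- The branch of `√((x-η₁₁)(x-η₁₂))` that is analytic in `|x| ≤ 1`. -/
def f3In (K x : ℂ) : ℂ :=
  f3Zero K * Complex.sqrt (1 - x / eta11 K) * Complex.sqrt (1 - x / eta12 K)

/-! ### The two-sheet covering `H₂` of the dispersion surface -/

/-- Projective 3-space with homogeneous coordinates `[x : f₂ : f₃ : 1]`. -/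
abbrev P3 : Type := ℙ ℂ (Fin 4 → ℂ)

/-- `H₂`: the compact Riemann surface of the pair of functions
`f₂ = √((x-η₂₁)(x-η₂₂))`, `f₃ = √((x-η₁₁)(x-η₁₂))`, as an intersection of two quadrics.
It covers `H` twice by `(x, y)`, `y` as in `yc` below, without branching;
`(f₂, f₃) ↦ (-f₂, -f₃)` interchanges the two sheets. -/
def H2 (K : ℂ) : Set P3 :=
  {p | p.rep 1 ^ 2 = (p.rep 0 - eta21 K * p.rep 3) * (p.rep 0 - eta22 K * p.rep 3) ∧
       p.rep 2 ^ 2 = (p.rep 0 - eta11 K * p.rep 3) * (p.rep 0 - eta12 K * p.rep 3)}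

/-- The functions `x`, `f₂`, `f₃`, `f₁ = f₂ f₃` and `y` on `H₂`. On `H₂` one has
`f₁ = x (y - y⁻¹)` and `D̂(x, y) = 0`, which together give `y`. -/
def xc (p : P3) : ℂ := p.rep 0 / p.rep 3
def f2 (p : P3) : ℂ := p.rep 1 / p.rep 3
def f3 (p : P3) : ℂ := p.rep 2 / p.rep 3
def f1 (p : P3) : ℂ := f2 p * f3 p
def yc (K : ℂ) (p : P3) : ℂ :=
  (4 - K ^ 2 - xc p - (xc p)⁻¹ + f1 p / xc p) / 2

/-- The point of `P³` with affine coordinates `(x, f₂, f₃)`. -/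
def affPt (x u v : ℂ) : P3 :=
  Projectivization.mk ℂ ![x, u, v, 1] (fun h => one_ne_zero (congrFun h 3))

/-- The point over `x = ∞` at which `f₂ / x = u` and `f₃ / x = v`. -/
def infPt (u v : ℂ) : P3 :=
  Projectivization.mk ℂ ![1, u, v, 0] (fun h => one_ne_zero (congrFun h 0))

/-- The eight infinity points of `H₂`. The loops `|y| = 1` and `|x| = 1` cut `H₂` into eight annuli
`i π / 2 < α < (i + 1) π / 2`, `i = 0, …, 7`, following each other cyclically; in the order of `i`
modulo 4 they are given by `|x| < 1, |y| < 1`; `|x| > 1, |y| < 1`; `|x| > 1, |y| > 1`;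
`|x| < 1, |y| > 1`. The function `f₂` is equal to `f2Out` where `|x| > 1`, `0 < α < 2π`, and to
`-f2Out` where `|x| > 1`, `2π < α < 4π`; `f₃` is equal to `f3In` where `|x| < 1`, `-π < α < π`, and
to `-f3In` where `|x| < 1`, `π < α < 3π`. The annulus number `i` contains exactly one infinity
point, `Jpt K i`. In order they are `J₁, J₄, J₃, J₂, J₁', J₄', J₃', J₂'`. -/
def Jpt (K : ℂ) : Fin 8 → P3 :=
  ![affPt 0 (f3Zero K)⁻¹ (f3Zero K), infPt 1 1, infPt 1 (-1), affPt 0 (f3Zero K)⁻¹ (-f3Zero K),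
    affPt 0 (-(f3Zero K)⁻¹) (-f3Zero K), infPt (-1) (-1), infPt (-1) 1,
    affPt 0 (-(f3Zero K)⁻¹) (f3Zero K)]

/-- The incident wave: `(K, x_in, y_in)` with `Re K > 0`, `Im K > 0`, `(x_in, y_in)` on the
dispersion surface and `|x_in| < 1`. -/
structure Incident (K xin yin : ℂ) : Prop where
  re_pos : 0 < K.re
  im_pos : 0 < K.im
  x_ne : xin ≠ 0
  y_ne : yin ≠ 0
  disp : Dhat K xin yin = 0
  x_lt : ‖xin‖ < 1

/-- `p₁`: the point over `(x_in, y_in)` in the component `3π/2 < α < 5π/2` of `|x| < 1`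
(there `f₃ = -f3In`, and `f₂ f₃ = x (y - y⁻¹)`). -/
def p1 (K xin yin : ℂ) : P3 :=
  affPt xin (-(xin * (yin - yin⁻¹)) / f3In K xin) (-f3In K xin)

/-- `p₄`: the point over `(x_in, y_in⁻¹)` in the component `7π/2 < α < 9π/2` of `|x| < 1`
(there `f₃ = f3In`). -/
def p4 (K xin yin : ℂ) : P3 :=
  affPt xin (-(xin * (yin - yin⁻¹)) / f3In K xin) (f3In K xin)

/-- The Sommerfeld transformant. -/
def transformant (K xin yin : ℂ) (p : P3) : ℂ :=
  -(f1 (p1 K xin yin) + f3 (p1 K xin yin) * f2 p) /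
    (4 * Real.pi * Complex.I * (xc p - xin))

/-- The plane wave `x^m y^n`. -/
def wave (K : ℂ) (m n : ℤ) (p : P3) : ℂ := xc p ^ m * yc K p ^ n

/-- Pull-back of the form `Ψ = dx / (x (y - y⁻¹)) = - dy / (y (x - x⁻¹))` by a real or complex
curve in `H₂`; the second expression is used at the branch points, where `y² = 1`. -/
def psi {𝕜 : Type} [NontriviallyNormedField 𝕜] [NormedAlgebra 𝕜 ℂ] (K : ℂ) (c : 𝕜 → P3)
    (t : 𝕜) : ℂ :=
  open Classical in
  if yc K (c t) ^ 2 = 1 then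
    -deriv (fun s => yc K (c s)) t / (yc K (c t) * (xc (c t) - (xc (c t))⁻¹))
  else deriv (fun s => xc (c s)) t / (xc (c t) * (yc K (c t) - (yc K (c t))⁻¹))

/-! ### Contours on `H₂` -/

/-- A map to `P³` is holomorphic at `z` if near `z` it is given by holomorphic homogeneous
coordinates. -/
def HolAt (Φ : ℂ → P3) (z : ℂ) : Prop :=
  ∃ F : ℂ → Fin 4 → ℂ, AnalyticAt ℂ F z ∧
    ∀ᶠ w in 𝓝 z, ∃ h : F w ≠ 0, Φ w = Projectivization.mk ℂ (F w) h

/-- A coordinate disc in `H₂`: an injective holomorphic map of the open unit disc. -/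
structure CoordDisc (K : ℂ) where
  Φ : ℂ → P3
  hol : ∀ z ∈ ball (0 : ℂ) 1, HolAt Φ z
  mem : ∀ z ∈ ball (0 : ℂ) 1, Φ z ∈ H2 K
  inj : InjOn Φ (ball (0 : ℂ) 1)

/-- A closed `C¹` curve in a coordinate disc of `H₂`. -/
structure Loop (K : ℂ) extends CoordDisc K where
  γ : ℝ → ℂ
  smooth : ContDiff ℝ 1 γ
  closed : γ 0 = γ 1
  inside : ∀ t ∈ Icc (0 : ℝ) 1, γ t ∈ ball (0 : ℂ) 1

/-- The winding number of a loop about a point of `H₂`, computed in the coordinate disc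
(zero if the point is not in the disc). -/
def Loop.winding {K : ℂ} (L : Loop K) (p : P3) : ℂ :=
  ∑ᶠ z ∈ {z ∈ ball (0 : ℂ) 1 | L.Φ z = p},
    (2 * Real.pi * Complex.I)⁻¹ * ∫ t in (0 : ℝ)..1, deriv L.γ t / (L.γ t - z)

/-- The integral of `w_{m,n} A Ψ` along a loop. -/
def Loop.integral {K : ℂ} (L : Loop K) (xin yin : ℂ) (m n : ℤ) : ℂ :=
  ∫ t in (0 : ℝ)..1, wave K m n (L.Φ (L.γ t)) * transformant K xin yin (L.Φ (L.γ t)) *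
    psi K (fun s => L.Φ (L.γ s)) t

/-- A contour is a finite sum of loops. -/
abbrev Contour (K : ℂ) : Type := List (Loop K)

def Contour.winding {K : ℂ} (c : Contour K) (p : P3) : ℂ := (c.map fun L => L.winding p).sum

/-- The Sommerfeld integral `∫ w_{m,n} A Ψ` over a contour. -/
def Contour.integral {K : ℂ} (c : Contour K) (xin yin : ℂ) (m n : ℤ) : ℂ :=
  (c.map fun L => L.integral xin yin m n).sum

/-- All infinity points and the two points `p₁`, `p₄`. -/
def marked (K xin yin : ℂ) : Set P3 := range (Jpt K) ∪ {p1 K xin yin, p4 K xin yin}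

/-- The contour avoids all infinity points and `p₁`, `p₄`; it encircles every point of `S` once in
the positive direction (of the complex structure), and encircles none of the others. A simple
closed curve bounding a disc that contains, among these points, exactly those of `S` is the basic
example, with a single loop. -/
def Contour.Encircles {K : ℂ} (c : Contour K) (xin yin : ℂ) (S : Set P3) : Prop :=
  (∀ L ∈ c, ∀ t ∈ Icc (0 : ℝ) 1, L.Φ (L.γ t) ∉ marked K xin yin) ∧
  (∀ p ∈ marked K xin yin, p ∈ S → c.winding p = 1) ∧
  (∀ p ∈ marked K xin yin, p ∉ S → c.winding p = 0)

/-- `c` can serve as the contour `Γ + j π / 2`, `j = 0, …, 7`, where `Γ` encircles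
`J₄, J₃, J₂, J₁'`. -/
def Contour.IsGamma {K : ℂ} (c : Contour K) (xin yin : ℂ) (j : Fin 8) : Prop :=
  c.Encircles xin yin {Jpt K (j + 1), Jpt K (j + 2), Jpt K (j + 3), Jpt K (j + 4)}

/-! ### The branched lattice `S₂` -/

/-- Nodes of `S₂`: a common origin and, for every other node of `ℤ²`, one node on each of two
sheets. Sheet `0` is `0 ≤ φ < 2π`, sheet `1` is `2π ≤ φ < 4π`. -/
inductive S2 : Type
  | origin : S2
  | node (m n : ℤ) (k : ZMod 2) (h : ¬(m = 0 ∧ n = 0)) : S2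

/-- The node over `(m, n)` on the sheet `k`. -/
def S2.at (m n : ℤ) (k : ZMod 2) : S2 :=
  if h : m = 0 ∧ n = 0 then S2.origin else S2.node m n k h

def S2.m : S2 → ℤ
  | S2.origin => 0
  | S2.node m _ _ _ => m

def S2.n : S2 → ℤ
  | S2.origin => 0
  | S2.node _ n _ _ => n

/-- `(r, φ)` are polar coordinates of the node; `φ` is defined modulo `4π`. -/
def S2.Polar : S2 → ℝ → ℝ → Prop
  | S2.origin, r, _ => r = 0
  | S2.node m n k _, r, φ => 0 < r ∧ (m : ℝ) = r * Real.cos φ ∧ (n : ℝ) = r * Real.sin φ ∧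
      ∃ l : ℤ, 2 * Real.pi * (k.val + 2 * l) ≤ φ ∧ φ < 2 * Real.pi * (k.val + 2 * l + 1)

/-- The node is described by the contour `Γ + j π / 2`. The origin is described by all of them. -/
def S2.DescribedBy (P : S2) (j : Fin 8) : Prop :=
  ∃ r φ : ℝ, P.Polar r φ ∧ (j : ℝ) * Real.pi / 2 ≤ φ ∧ φ ≤ ((j : ℝ) + 2) * Real.pi / 2

/-- The homogeneous stencil equation on `S₂ ∖ O`: nodes `n = 0`, `m > 0` of one sheet are linked
with nodes `n = -1`, `m > 0` of the other. -/
def StencilS2 (K : ℂ) (u : S2 → ℂ) : Prop :=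
  ∀ (m n : ℤ) (k : ZMod 2), ¬(m = 0 ∧ n = 0) →
    u (S2.at (m + 1) n k) + u (S2.at (m - 1) n k)
      + u (S2.at m (n + 1) (if 0 < m ∧ n = -1 then k + 1 else k))
      + u (S2.at m (n - 1) (if 0 < m ∧ n = 0 then k + 1 else k))
      + (K ^ 2 - 4) * u (S2.at m n k) = 0

/-- The radiation condition: the difference with the incident wave and its mirror image decays
exponentially. -/
def RadiationS2 (xin yin : ℂ) (u : S2 → ℂ) : Prop :=
  ∃ C q : ℝ, 0 < q ∧ q < 1 ∧ ∀ (P : S2) (r φ : ℝ), P.Polar r φ →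
    (0 ≤ φ → φ ≤ 2 * Real.pi → ‖u P - xin ^ P.m * yin ^ P.n‖ ≤ C * q ^ r) ∧
    (2 * Real.pi ≤ φ → φ ≤ 4 * Real.pi → ‖u P + xin ^ P.m * yin⁻¹ ^ P.n‖ ≤ C * q ^ r)

/-- The scattered field given by the Wiener–Hopf method. -/
def whScattered (K xin : ℂ) (m n : ℤ) : ℂ :=
  -(2 * Real.pi * Complex.I)⁻¹ *
    ∮ z in C(0, 1), z ^ m * Xi K z ^ n.natAbs * f3In K xin / (f3In K z * (z - xin))

/-! ### Explicit residues at the infinity points -/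

/-- `R(τ) = √((1-η₁₁τ)(1-η₁₂τ)(1-η₂₁τ)(1-η₂₂τ))` near `τ = 0`, with `R(0) = 1`. -/
def Rfun (K τ : ℂ) : ℂ :=
  Complex.sqrt (1 - eta11 K * τ) * Complex.sqrt (1 - eta12 K * τ) *
    Complex.sqrt (1 - eta21 K * τ) * Complex.sqrt (1 - eta22 K * τ)

/-- `Y(τ) = τ y(τ)`, where `y(τ)` is the root of `D̂(τ, y) = 0` (equivalently `D̂(τ⁻¹, y) = 0`)
that tends to infinity as `τ → 0`; `y - y⁻¹ = - R(τ) / τ`. -/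
def Yfun (K τ : ℂ) : ℂ := ((4 - K ^ 2) * τ - 1 - τ ^ 2 - Rfun K τ) / 2

/-- The function
`τ^n y^n (f₁(p₁) + f₃(p₁) f₂(τ⁻¹)) / (2 (τ⁻¹ - x_in) (y - y⁻¹) τ)`, `y = Y(τ) / τ`,
`f₂(τ⁻¹) = ε τ⁻¹ √(1-η₂₁τ) √(1-η₂₂τ)`, cleared of the removable singularity at `τ = 0`. -/
def bracketInf (K xin yin ε : ℂ) (n : ℤ) (τ : ℂ) : ℂ :=
  -(Yfun K τ ^ n * (τ * (xin * (yin - yin⁻¹)) -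
      f3In K xin * ε * Complex.sqrt (1 - eta21 K * τ) * Complex.sqrt (1 - eta22 K * τ))) /
    (2 * (1 - xin * τ) * Rfun K τ)

/-- The function
`-x^n y^n (f₁(p₁) + f₃(p₁) f₂(x)) / (2 (x - x_in) (y - y⁻¹) x)`, `y = Y(x) / x`,
`f₂(x) = ε f₃(0)⁻¹ √(1-x/η₂₁) √(1-x/η₂₂)`, cleared of the removable singularity at `x = 0`. -/
def bracketZero (K xin yin ε : ℂ) (n : ℤ) (x : ℂ) : ℂ :=
  Yfun K x ^ n * (xin * (yin - yin⁻¹) -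
      f3In K xin * ε * (f3Zero K)⁻¹ * Complex.sqrt (1 - x / eta21 K) *
        Complex.sqrt (1 - x / eta22 K)) /
    (2 * (x - xin) * Rfun K x)

/-- The residue at `0` of `g(τ) τ^{-N} dτ`, `g` analytic at `0`. -/
def poleCoeff (g : ℂ → ℂ) (N : ℤ) : ℂ :=
  if 0 < N then iteratedDeriv (N - 1).toNat g 0 / ((N - 1).toNat.factorial : ℂ) else 0

/-- `2πi` times the residue of `w_{m,n} A Ψ` at the infinity point `Jpt K i`. -/
def resTerm (K xin yin : ℂ) (m n : ℤ) : Fin 8 → ℂ :=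
  ![-poleCoeff (bracketZero K xin yin 1 (-n)) (-m - n),
    -poleCoeff (bracketInf K xin yin 1 (-n)) (m - n),
    poleCoeff (bracketInf K xin yin 1 n) (m + n),
    poleCoeff (bracketZero K xin yin 1 n) (n - m),
    -poleCoeff (bracketZero K xin yin (-1) (-n)) (-m - n),
    -poleCoeff (bracketInf K xin yin (-1) (-n)) (m - n),
    poleCoeff (bracketInf K xin yin (-1) n) (m + n),
    poleCoeff (bracketZero K xin yin (-1) n) (n - m)]

end

end HalfLine

open HalfLine

namespace HalfLine

noncomputable section

/-! ### Algebra of the branch points -/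

/-! On `H2` the form w A Ψ has poles only at the eight infinity points and at p₁, p₄, so a
Sommerfeld integral is a sum of residues. Every loop lies in a coordinate disc, and there the
residue theorem is elementary: subtract the principal parts, each defined on the whole plane minus
one point, and integrate the rest by a primitive (`integral_eq_sum_residues`). Hence the integral
over a contour depends only on its winding numbers about the marked points
(`Contour.integral_eq_sum`), and the field can be taken to be the residue sum `fieldU`.

Consecutive contours exchange one infinity point for the one four places further on. Both have zero
residue on the overlap of the two sectors, because the plane wave cancels their poles there
(`resTerm_eq_zero`); this gives independence of the contour. Every single residue satisfies the
stencil equation for all (m, n), since the dispersion relation annihilates the integrand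
(`resTerm_stencil`), and a node other than the origin shares a contour with its four neighbours
(`exists_describes_neighbours`). For n = 0 the infinity points pair off, with equal f₂ and opposite
f₃, into opposite residues (`resTerm_axis`); this is the Dirichlet condition.

For the comparison with Wiener–Hopf, the unit circle has four lifts to `H2`, labelled by the signs
of f₂ and f₃. Inside the circle f₃ is single-valued, and so is the sum of the integrand over ±f₂;
outside the same holds with f₂ and f₃ exchanged. The plane residue theorem therefore expresses sums
of two lifts by residues (`circleForm_add_interior`, `circleForm_add_exterior`). In the four
residues of a contour one lift cancels, and the difference of two others is the Wiener–Hopf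
integral. Exponential decay follows by moving the circle inwards or outwards, and antisymmetry
follows from the evenness of the Wiener–Hopf integral in n.

For algebraicity, the residues are Taylor coefficients of functions built by ring operations,
inversion and square roots from constants that are integral over ℂ[K, x_in] after multiplication by
a power of x_in. Working in the ring of functions on all incident waves makes the resulting monic
equation the same for every wave. -/

theorem csqrt_sq (z : ℂ) : Complex.sqrt z ^ 2 = z := by
  rw [Complex.sqrt, ← Complex.cpow_mul_nat]
  simp

theorem csqrt_ne_zero {z : ℂ} (hz : z ≠ 0) : Complex.sqrt z ≠ 0 := fun h => hz <| by
  rw [← csqrt_sq z, h]; simp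

theorem mem_slitPlane_one_sub {w : ℂ} (hw : ‖w‖ < 1) : 1 - w ∈ Complex.slitPlane := by
  simpa [sub_eq_add_neg] using Complex.mem_slitPlane_of_norm_lt_one (z := -w) (by simpa using hw)

theorem analyticAt_csqrt {z : ℂ} (hz : z ∈ Complex.slitPlane) : AnalyticAt ℂ Complex.sqrt z := by
  have : (fun z : ℂ => z ^ (2⁻¹ : ℂ)) = Complex.sqrt := rfl
  rw [← this]
  exact analyticAt_id.cpow analyticAt_const hz

theorem analyticAt_csqrt_one_sub {g : ℂ → ℂ} {z : ℂ} (hg : AnalyticAt ℂ g z) (h : ‖g z‖ < 1) :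
    AnalyticAt ℂ (fun w => Complex.sqrt (1 - g w)) z :=
  AnalyticAt.fun_comp (analyticAt_csqrt (mem_slitPlane_one_sub h)) (analyticAt_const.sub hg)

theorem csqrt_one_sub_ne_zero {w : ℂ} (h : ‖w‖ < 1) : Complex.sqrt (1 - w) ≠ 0 :=
  csqrt_ne_zero (Complex.slitPlane_ne_zero (mem_slitPlane_one_sub h))

theorem innerRoot_add_outerRoot (d : ℂ) : innerRoot d + outerRoot d = -d := by
  simp [outerRoot]

theorem innerRoot_mul_outerRoot (d : ℂ) : innerRoot d * outerRoot d = 1 := by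
  have hs := csqrt_sq (d ^ 2 - 4)
  unfold outerRoot innerRoot
  split_ifs <;> linear_combination -(1 / 4) * hs

theorem innerRoot_ne_zero (d : ℂ) : innerRoot d ≠ 0 :=
  left_ne_zero_of_mul (b := outerRoot d) (by rw [innerRoot_mul_outerRoot]; exact one_ne_zero)

theorem outerRoot_eq_inv (d : ℂ) : outerRoot d = (innerRoot d)⁻¹ :=
  eq_inv_of_mul_eq_one_right (innerRoot_mul_outerRoot d)

/-- If `q + q⁻¹` is not real then `q` is not on the unit circle. -/
theorem norm_ne_one_of_add_inv_im_ne {q : ℂ} (h : (q + q⁻¹).im ≠ 0) : ‖q‖ ≠ 1 := by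
  intro hq
  apply h
  rw [Complex.inv_def, Complex.normSq_eq_norm_sq, hq]
  simp

/-- The two roots have product 1, so the selected one has modulus at most 1; modulus 1 would make
the sum -d of the roots real. -/
theorem norm_innerRoot_lt_one {d : ℂ} (hd : d.im ≠ 0) : ‖innerRoot d‖ < 1 := by
  have hsum := innerRoot_add_outerRoot d
  rw [outerRoot_eq_inv] at hsum
  have hne : ‖innerRoot d‖ ≠ 1 := norm_ne_one_of_add_inv_im_ne (by rw [hsum]; simpa using hd)
  refine lt_of_le_of_ne ?_ hne
  have hmul := innerRoot_mul_outerRoot d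
  by_cases hc : ‖(-d + Complex.sqrt (d ^ 2 - 4)) / 2‖ < 1
  · simp only [innerRoot, if_pos hc]; exact hc.le
  · have ho : outerRoot d = (-d + Complex.sqrt (d ^ 2 - 4)) / 2 := by
      simp only [outerRoot, innerRoot, if_neg hc]; ring
    have h1 : ‖innerRoot d‖ * ‖outerRoot d‖ = 1 := by rw [← norm_mul, hmul, norm_one]
    rw [ho] at h1
    rw [not_lt] at hc
    nlinarith [norm_nonneg (innerRoot d)]

/-- A root of `q + q⁻¹ = -d` inside the unit circle is the inner root. -/
theorem eq_innerRoot {d q : ℂ} (hd : d.im ≠ 0) (hq0 : q ≠ 0) (hq : q + q⁻¹ = -d) (h1 : ‖q‖ < 1) :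
    q = innerRoot d := by
  have hsum := innerRoot_add_outerRoot d
  rw [outerRoot_eq_inv] at hsum
  have h0 := innerRoot_ne_zero d
  -- The difference of q + q⁻¹ and r + r⁻¹ factors as (q - r)(1 - (q r)⁻¹). The second factor would
  -- put r = q⁻¹ outside the unit circle.
  have key : (q - innerRoot d) * (1 - (q * innerRoot d)⁻¹) = 0 := by
    have : q + q⁻¹ = innerRoot d + (innerRoot d)⁻¹ := by rw [hq, hsum]
    have e : (q - innerRoot d) * (1 - (q * innerRoot d)⁻¹) =
      q + q⁻¹ - (innerRoot d + (innerRoot d)⁻¹) := by field_simp; ring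
    rw [e, this, sub_self]
  rcases mul_eq_zero.mp key with h | h
  · exact sub_eq_zero.mp h
  · have h2 : q * innerRoot d = 1 := by
      rw [sub_eq_zero] at h
      rw [← inv_inv (q * innerRoot d), ← h, inv_one]
    have h3 : innerRoot d = q⁻¹ := eq_inv_of_mul_eq_one_right h2
    have := norm_innerRoot_lt_one hd
    rw [h3, norm_inv, inv_lt_one₀ (norm_pos_iff.mpr hq0)] at this
    linarith

section
variable {K xin yin : ℂ}

/-- The sign conditions on K enter only here: K² minus any real number is non-real, which keeps the
branch points and Ξ off the unit circle. -/
theorem Incident.im_sq_pos (h : Incident K xin yin) : 0 < (K ^ 2).im := by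
  have := mul_pos h.re_pos h.im_pos
  simp [sq, Complex.mul_im]; nlinarith

theorem Incident.im_sub_ne (h : Incident K xin yin) (r : ℂ) (hr : r.im = 0) :
    (K ^ 2 - r).im ≠ 0 := by
  have := h.im_sq_pos
  rw [Complex.sub_im, hr, sub_zero]; exact this.ne'

theorem Incident.norm_eta21 (h : Incident K xin yin) : ‖eta21 K‖ < 1 :=
  norm_innerRoot_lt_one (h.im_sub_ne 2 (by simp))

theorem Incident.norm_eta22 (h : Incident K xin yin) : ‖eta22 K‖ < 1 :=
  norm_innerRoot_lt_one (h.im_sub_ne 6 (by simp))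

theorem eta21_ne (K : ℂ) : eta21 K ≠ 0 := innerRoot_ne_zero _
theorem eta22_ne (K : ℂ) : eta22 K ≠ 0 := innerRoot_ne_zero _
theorem eta11_eq (K : ℂ) : eta11 K = (eta21 K)⁻¹ := outerRoot_eq_inv _
theorem eta12_eq (K : ℂ) : eta12 K = (eta22 K)⁻¹ := outerRoot_eq_inv _
theorem eta11_ne (K : ℂ) : eta11 K ≠ 0 := by rw [eta11_eq]; exact inv_ne_zero (eta21_ne K)
theorem eta12_ne (K : ℂ) : eta12 K ≠ 0 := by rw [eta12_eq]; exact inv_ne_zero (eta22_ne K)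
theorem eta21_mul (K : ℂ) : eta21 K * eta11 K = 1 := innerRoot_mul_outerRoot _
theorem eta22_mul (K : ℂ) : eta22 K * eta12 K = 1 := innerRoot_mul_outerRoot _
theorem eta21_add (K : ℂ) : eta21 K + eta11 K = 2 - K ^ 2 := by
  have := innerRoot_add_outerRoot (K ^ 2 - 2)
  simp only [eta21, eta11]; rw [this]; ring
theorem eta22_add (K : ℂ) : eta22 K + eta12 K = 6 - K ^ 2 := by
  have := innerRoot_add_outerRoot (K ^ 2 - 6)
  simp only [eta22, eta12]; rw [this]; ring

theorem Incident.one_lt_eta11 (h : Incident K xin yin) : 1 < ‖eta11 K‖ := by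
  rw [eta11_eq, norm_inv]
  exact (one_lt_inv₀ (norm_pos_iff.mpr (eta21_ne K))).mpr h.norm_eta21

theorem Incident.one_lt_eta12 (h : Incident K xin yin) : 1 < ‖eta12 K‖ := by
  rw [eta12_eq, norm_inv]
  exact (one_lt_inv₀ (norm_pos_iff.mpr (eta22_ne K))).mpr h.norm_eta22

/-- Equal inner roots would have equal sums with their inverses, that is 2 - K² = 6 - K². This makes
f₂ a local coordinate at its zeros. -/
theorem eta21_ne_eta22 (K : ℂ) : eta21 K ≠ eta22 K := by
  intro h
  have h1 := eta21_add K
  have h2 := eta22_add K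
  rw [eta11_eq, h, ← eta12_eq] at h1
  have : (2 : ℂ) = 6 := by linear_combination h2 - h1
  norm_num at this

theorem ne_of_norm_lt_norm {a b : ℂ} (h : ‖a‖ < ‖b‖) : a ≠ b := fun e => by simp [e] at h

theorem Xi_add_inv (K x : ℂ) : Xi K x + (Xi K x)⁻¹ = 4 - K ^ 2 - x - x⁻¹ := by
  have := innerRoot_add_outerRoot (K ^ 2 - 4 + x + x⁻¹)
  rw [outerRoot_eq_inv] at this
  rw [Xi, this]; ring

theorem Incident.norm_Xi (h : Incident K xin yin) {x : ℂ} (hx : ‖x‖ = 1) : ‖Xi K x‖ < 1 := by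
  apply norm_innerRoot_lt_one
  have : (x + x⁻¹).im = 0 := by
    rw [Complex.inv_def, Complex.normSq_eq_norm_sq, hx]; simp
  have := h.im_sub_ne (4 - (x + x⁻¹)) (by rw [Complex.sub_im, this]; simp)
  convert this using 2; ring

/-- At x = 1 the squared numerator is (Ξ + Ξ⁻¹)² - 4 = K² (K² - 4). Since η₁ₖ is inverse to η₂ₖ,
each product η₁ₖ (1 - η₂ₖ)² equals η₁ₖ + η₂ₖ - 2, that is -K² or 4 - K². -/
theorem f3Zero_sq (h : Incident K xin yin) : f3Zero K ^ 2 = eta11 K * eta12 K := by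
  have h1 : (1 : ℂ) - eta21 K ≠ 0 := sub_ne_zero.mpr (ne_of_norm_lt_norm (by
    simpa using h.norm_eta21)).symm
  have h2 : (1 : ℂ) - eta22 K ≠ 0 := sub_ne_zero.mpr (ne_of_norm_lt_norm (by
    simpa using h.norm_eta22)).symm
  have hX := Xi_add_inv K 1
  have hX0 : Xi K 1 * (Xi K 1)⁻¹ = 1 := mul_inv_cancel₀ (innerRoot_ne_zero _)
  have e1 := eta21_mul K
  have e2 := eta22_mul K
  have e3 := eta21_add K
  have e4 := eta22_add K
  rw [f3Zero, div_pow, div_eq_iff (pow_ne_zero 2 (mul_ne_zero h1 h2))]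
  have hL : (Xi K 1 - (Xi K 1)⁻¹) ^ 2 = K ^ 2 * (K ^ 2 - 4) := by
    have : (Xi K 1 - (Xi K 1)⁻¹) ^ 2 = (Xi K 1 + (Xi K 1)⁻¹) ^ 2 - 4 * (Xi K 1 * (Xi K 1)⁻¹) := by
      ring
    rw [this, hX, hX0]; norm_num; ring
  have hA : eta11 K * (1 - eta21 K) ^ 2 = -K ^ 2 := by
    linear_combination (eta21 K - 2) * e1 + e3
  have hB : eta12 K * (1 - eta22 K) ^ 2 = 4 - K ^ 2 := by
    linear_combination (eta22 K - 2) * e2 + e4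
  rw [hL]
  calc K ^ 2 * (K ^ 2 - 4) = (-K ^ 2) * (4 - K ^ 2) := by ring
    _ = _ := by rw [← hA, ← hB]; ring

theorem f3Zero_ne (h : Incident K xin yin) : f3Zero K ≠ 0 := by
  intro h0
  have := f3Zero_sq h
  rw [h0] at this
  exact mul_ne_zero (eta11_ne K) (eta12_ne K) (by simpa using this.symm)

theorem f3Zero_inv_sq (h : Incident K xin yin) : (f3Zero K)⁻¹ ^ 2 = eta21 K * eta22 K := by
  rw [inv_pow, f3Zero_sq h, mul_inv, eta11_eq, eta12_eq, inv_inv, inv_inv]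

theorem f3In_sq (h : Incident K xin yin) (x : ℂ) :
    f3In K x ^ 2 = (x - eta11 K) * (x - eta12 K) := by
  have h1 := eta11_ne K
  have h2 := eta12_ne K
  rw [f3In, mul_pow, mul_pow, csqrt_sq, csqrt_sq, f3Zero_sq h]
  field_simp
  ring

theorem f3In_ne (h : Incident K xin yin) {x : ℂ} (hx : ‖x‖ ≤ 1) : f3In K x ≠ 0 := by
  intro h0
  have := f3In_sq h x
  rw [h0] at this
  have h1 := h.one_lt_eta11
  have h2 := h.one_lt_eta12
  rw [zero_pow two_ne_zero] at this
  rcases mul_eq_zero.mp this.symm with e | e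
  · rw [sub_eq_zero.mp e] at hx; linarith
  · rw [sub_eq_zero.mp e] at hx; linarith

/-! ### Explicit branches near x = 0 and x = ∞ -/

/-- The branch of `f₂` near `x = ∞` in the coordinate `τ = x⁻¹`, multiplied by `τ`. -/
def gInf2 (K τ : ℂ) : ℂ := Complex.sqrt (1 - eta21 K * τ) * Complex.sqrt (1 - eta22 K * τ)

/-- The branch of `f₃` near `x = ∞` in the coordinate `τ = x⁻¹`, multiplied by `τ`. -/
def gInf3 (K τ : ℂ) : ℂ := Complex.sqrt (1 - eta11 K * τ) * Complex.sqrt (1 - eta12 K * τ)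

/-- The branch of `f₂` near `x = 0`. -/
def f2In (K x : ℂ) : ℂ := (f3Zero K)⁻¹ * gInf3 K x

/-- Because η₁ₖ⁻¹ = η₂ₖ, one product of principal roots serves both f₃ near x = 0 and f₂ near x = ∞.
This is the symmetry x ↦ x⁻¹ of the dispersion relation, and it lets the same radii work at both
places. -/
theorem f3In_eq (K x : ℂ) : f3In K x = f3Zero K * gInf2 K x := by
  simp only [f3In, gInf2, eta11_eq, eta12_eq, div_inv_eq_mul, mul_comm x, mul_assoc]

theorem Rfun_eq (K τ : ℂ) : Rfun K τ = gInf2 K τ * gInf3 K τ := by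
  simp only [Rfun, gInf2, gInf3]; ring

theorem gInf2_sq (K τ : ℂ) : gInf2 K τ ^ 2 = (1 - eta21 K * τ) * (1 - eta22 K * τ) := by
  rw [gInf2, mul_pow, csqrt_sq, csqrt_sq]

theorem gInf3_sq (K τ : ℂ) : gInf3 K τ ^ 2 = (1 - eta11 K * τ) * (1 - eta12 K * τ) := by
  rw [gInf3, mul_pow, csqrt_sq, csqrt_sq]

theorem f2In_sq (h : Incident K xin yin) (x : ℂ) :
    f2In K x ^ 2 = (x - eta21 K) * (x - eta22 K) := by
  rw [f2In, mul_pow, gInf3_sq, f3Zero_inv_sq h]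
  linear_combination (-eta22 K * x + eta22 K * x * eta12 K * x) * eta21_mul K +
    (-eta21 K * x + x ^ 2) * eta22_mul K

theorem f2In_mul_f3In (h : Incident K xin yin) (x : ℂ) : f2In K x * f3In K x = Rfun K x := by
  rw [f2In, f3In_eq, Rfun_eq]
  field_simp [f3Zero_ne h]

theorem gInf2_zero (K : ℂ) : gInf2 K 0 = 1 := by simp [gInf2]
theorem gInf3_zero (K : ℂ) : gInf3 K 0 = 1 := by simp [gInf3]
theorem Rfun_zero (K : ℂ) : Rfun K 0 = 1 := by simp [Rfun]
theorem f3In_zero (K : ℂ) : f3In K 0 = f3Zero K := by simp [f3In]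
theorem f2In_zero (K : ℂ) : f2In K 0 = (f3Zero K)⁻¹ := by simp [f2In, gInf3_zero]
theorem Yfun_zero (K : ℂ) : Yfun K 0 = -1 := by simp [Yfun, Rfun_zero]; norm_num

theorem analyticAt_gInf2 {τ : ℂ} (h1 : ‖eta21 K * τ‖ < 1) (h2 : ‖eta22 K * τ‖ < 1) :
    AnalyticAt ℂ (gInf2 K) τ :=
  (analyticAt_csqrt_one_sub (by fun_prop) h1).mul (analyticAt_csqrt_one_sub (by fun_prop) h2)

theorem analyticAt_gInf3 {τ : ℂ} (h1 : ‖eta11 K * τ‖ < 1) (h2 : ‖eta12 K * τ‖ < 1) :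
    AnalyticAt ℂ (gInf3 K) τ :=
  (analyticAt_csqrt_one_sub (by fun_prop) h1).mul (analyticAt_csqrt_one_sub (by fun_prop) h2)

theorem analyticAt_gInf2_zero (K : ℂ) : AnalyticAt ℂ (gInf2 K) 0 :=
  analyticAt_gInf2 (by simp) (by simp)

theorem analyticAt_gInf3_zero (K : ℂ) : AnalyticAt ℂ (gInf3 K) 0 :=
  analyticAt_gInf3 (by simp) (by simp)

theorem analyticAt_f2In_zero (K : ℂ) : AnalyticAt ℂ (f2In K) 0 :=
  analyticAt_const.mul (analyticAt_gInf3_zero K)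

theorem analyticAt_f3In {x : ℂ} (h1 : ‖eta21 K * x‖ < 1) (h2 : ‖eta22 K * x‖ < 1) :
    AnalyticAt ℂ (f3In K) x := by
  have : f3In K = fun x => f3Zero K * gInf2 K x := funext (f3In_eq K)
  rw [this]
  exact analyticAt_const.mul (analyticAt_gInf2 h1 h2)

theorem analyticAt_Rfun_zero (K : ℂ) : AnalyticAt ℂ (Rfun K) 0 := by
  rw [show Rfun K = fun τ => gInf2 K τ * gInf3 K τ from funext (Rfun_eq K)]
  exact (analyticAt_gInf2_zero K).mul (analyticAt_gInf3_zero K)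

theorem analyticAt_Yfun_zero (K : ℂ) : AnalyticAt ℂ (Yfun K) 0 := by
  have := analyticAt_Rfun_zero K
  unfold Yfun
  fun_prop

/-- `Y(τ) / τ` and its inverse are the roots `y` of the dispersion relation. -/
theorem Yfun_mul (K τ : ℂ) :
    Yfun K τ * (((4 - K ^ 2) * τ - 1 - τ ^ 2 + Rfun K τ) / 2) = τ ^ 2 := by
  have e1 := eta21_mul K
  have e2 := eta22_mul K
  have e3 := eta21_add K
  have e4 := eta22_add K
  have hA : (1 - eta21 K * τ) * (1 - eta11 K * τ) = 1 - (2 - K ^ 2) * τ + τ ^ 2 := by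
    linear_combination τ ^ 2 * e1 - τ * e3
  have hB : (1 - eta22 K * τ) * (1 - eta12 K * τ) = 1 - (6 - K ^ 2) * τ + τ ^ 2 := by
    linear_combination τ ^ 2 * e2 - τ * e4
  have hR : Rfun K τ ^ 2 = (1 - (2 - K ^ 2) * τ + τ ^ 2) * (1 - (6 - K ^ 2) * τ + τ ^ 2) := by
    rw [Rfun_eq, mul_pow, gInf2_sq, gInf3_sq, ← hA, ← hB]; ring
  rw [Yfun]
  linear_combination -(1 / 4) * hR

/-- The product of the quadrics is `x² (y - y⁻¹)²` expressed by `y + y⁻¹`. -/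
theorem quadrics_mul (K x : ℂ) :
    (x - eta21 K) * (x - eta22 K) * ((x - eta11 K) * (x - eta12 K)) =
      ((4 - K ^ 2) * x - 1 - x ^ 2) ^ 2 - 4 * x ^ 2 := by
  have e1 := eta21_mul K
  have e2 := eta22_mul K
  have e3 := eta21_add K
  have e4 := eta22_add K
  have hA : (x - eta21 K) * (x - eta11 K) = 1 - (2 - K ^ 2) * x + x ^ 2 := by
    linear_combination e1 - x * e3
  have hB : (x - eta22 K) * (x - eta12 K) = 1 - (6 - K ^ 2) * x + x ^ 2 := by
    linear_combination e2 - x * e4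
  calc _ = (x - eta21 K) * (x - eta11 K) * ((x - eta22 K) * (x - eta12 K)) := by ring
    _ = _ := by rw [hA, hB]; ring

end

end

end HalfLine

namespace HalfLine

noncomputable section

/-! ### Residues -/

/-- `h dz` has the residue `r` at `a`: up to `r / (z - a)`, the function `h` has near `a` a
meromorphic primitive. -/
def HasRes (h : ℂ → ℂ) (a r : ℂ) : Prop :=
  ∃ M : ℂ → ℂ, MeromorphicAt M a ∧ ∀ᶠ z in 𝓝[≠] a, HasDerivAt M (h z - r * (z - a)⁻¹) z

theorem HasRes.congr {h h' : ℂ → ℂ} {a r : ℂ} (H : HasRes h a r) (e : ∀ᶠ z in 𝓝[≠] a, h' z = h z) :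
    HasRes h' a r := by
  obtain ⟨M, hM, hd⟩ := H
  refine ⟨M, hM, ?_⟩
  filter_upwards [hd, e] with z h1 h2
  rwa [h2]

theorem HasRes.add {h h' : ℂ → ℂ} {a r r' : ℂ} (H : HasRes h a r) (H' : HasRes h' a r') :
    HasRes (fun z => h z + h' z) a (r + r') := by
  obtain ⟨M, hM, hd⟩ := H
  obtain ⟨M', hM', hd'⟩ := H'
  refine ⟨M + M', hM.add hM', ?_⟩
  filter_upwards [hd, hd'] with z h1 h2
  exact (h1.add h2).congr_deriv (by ring)

theorem HasRes.const_mul {h : ℂ → ℂ} {a r : ℂ} (c : ℂ) (H : HasRes h a r) :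
    HasRes (fun z => c * h z) a (c * r) := by
  obtain ⟨M, hM, hd⟩ := H
  refine ⟨fun z => c * M z, (MeromorphicAt.const c a).mul hM, ?_⟩
  filter_upwards [hd] with z h1
  exact (h1.const_mul c).congr_deriv (by ring)

theorem HasRes.sub {h h' : ℂ → ℂ} {a r r' : ℂ} (H : HasRes h a r) (H' : HasRes h' a r') :
    HasRes (fun z => h z - h' z) a (r - r') := by
  have := H.add (H'.const_mul (-1))
  simpa [sub_eq_add_neg] using this

theorem HasRes.sum {ι : Type*} {s : Finset ι} {h : ι → ℂ → ℂ} {a : ℂ} {r : ι → ℂ}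
    (H : ∀ i ∈ s, HasRes (h i) a (r i)) :
    HasRes (fun z => ∑ i ∈ s, h i z) a (∑ i ∈ s, r i) := by
  classical
  induction s using Finset.induction_on with
  | empty => exact ⟨0, analyticAt_const.meromorphicAt, 
      Eventually.of_forall fun z => (hasDerivAt_const z (0 : ℂ)).congr_deriv (by simp)⟩
  | insert i s hi ih =>
    have := (H i (Finset.mem_insert_self i s)).add
      (ih fun j hj => H j (Finset.mem_insert_of_mem hj))
    simpa [Finset.sum_insert hi] using this

theorem hasRes_zero_of_analyticAt {h : ℂ → ℂ} {a : ℂ} (H : AnalyticAt ℂ h a) : HasRes h a 0 := by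
  obtain ⟨R, hR, hb⟩ := Metric.eventually_nhds_iff_ball.mp H.eventually_analyticAt
  have hd : DifferentiableOn ℂ h (ball a R) := fun z hz =>
    (hb z hz).differentiableAt.differentiableWithinAt
  obtain ⟨M, hM⟩ := hd.isExactOn_ball
  have hMd : DifferentiableOn ℂ M (ball a R) := fun z hz =>
    (hM z hz).differentiableAt.differentiableWithinAt
  refine ⟨M, (hMd.analyticAt (ball_mem_nhds a hR)).meromorphicAt, ?_⟩
  filter_upwards [nhdsWithin_le_nhds (ball_mem_nhds a hR)] with z hz
  simpa using hM z hz

theorem hasRes_zpow {k : ℤ} (hk : k ≠ -1) (a : ℂ) : HasRes (fun z => (z - a) ^ k) a 0 := by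
  have hk' : ((k : ℂ) + 1) ≠ 0 := by
    intro h; apply hk
    have : ((k + 1 : ℤ) : ℂ) = 0 := by push_cast; exact h
    have := Int.cast_eq_zero.mp this
    omega
  refine ⟨fun z => ((k : ℂ) + 1)⁻¹ * (z - a) ^ (k + 1), by fun_prop, ?_⟩
  filter_upwards [self_mem_nhdsWithin] with z hz
  have hz' : z - a ≠ 0 := sub_ne_zero.mpr hz
  have h1 := (hasDerivAt_zpow (k + 1) (z - a) (Or.inl hz')).comp z ((hasDerivAt_id z).sub_const a)
  refine (h1.const_mul ((k : ℂ) + 1)⁻¹).congr_deriv ?_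
  push_cast
  rw [zero_mul, sub_zero, add_sub_cancel_right, mul_one, ← mul_assoc, inv_mul_cancel₀ hk', one_mul]

theorem hasDerivAt_sub_inv {z a : ℂ} (hz : z ≠ a) :
    HasDerivAt (fun z : ℂ => (z - a)⁻¹) (-((z - a) ^ 2)⁻¹) z := by
  have h := (hasDerivAt_inv (sub_ne_zero.mpr hz)).comp z ((hasDerivAt_id z).sub_const a)
  exact h.congr_deriv (by simp)

theorem analyticAt_dslope {f : ℂ → ℂ} {a : ℂ} (hf : AnalyticAt ℂ f a) :
    AnalyticAt ℂ (dslope f a) a := by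
  obtain ⟨p, hp⟩ := hf
  exact ⟨_, hp.has_fpower_series_dslope_fslope⟩

/-- What remains after subtracting κ(a)/(z - a) is the divided difference of κ, which is analytic.
-/
theorem hasRes_simple_pole {κ : ℂ → ℂ} {a : ℂ} (hκ : AnalyticAt ℂ κ a) :
    HasRes (fun z => κ z * (z - a)⁻¹) a (κ a) := by
  obtain ⟨M, hM, hd⟩ := hasRes_zero_of_analyticAt (analyticAt_dslope hκ)
  refine ⟨M, hM, ?_⟩
  filter_upwards [hd, self_mem_nhdsWithin] with z h1 hz
  convert h1 using 1
  have : z - a ≠ 0 := sub_ne_zero.mpr hz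
  rw [dslope_of_ne _ hz, slope_def_field]
  field_simp
  ring

/-- In the Taylor expansion of b up to order N only the term of degree N - 1 yields z⁻¹; every other
power has a power as primitive. For N ≤ 0 there is no pole. -/
theorem hasRes_poleCoeff {b : ℂ → ℂ} (hb : AnalyticAt ℂ b 0) (N : ℤ) :
    HasRes (fun z => b z * z ^ (-N)) 0 (poleCoeff b N) := by
  by_cases hN : 0 < N
  · obtain ⟨n, hn⟩ : ∃ n : ℕ, N = n + 1 := ⟨(N - 1).toNat, by omega⟩
    obtain ⟨F, hF, hexp⟩ := hb.exists_eq_sum_add_pow_mul (n + 1)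
    have h1 : ∀ i ∈ Finset.range (n + 1), HasRes (fun z => (iteratedDeriv i b 0 / i.factorial) *
        (z - 0) ^ ((i : ℤ) - N)) 0 (if i = n then iteratedDeriv n b 0 / n.factorial else 0) := by
      intro i hi
      split_ifs with hin
      · subst hin
        have := (hasRes_simple_pole (a := 0) (analyticAt_const (v := (1 : ℂ)))).const_mul
          (iteratedDeriv i b 0 / i.factorial)
        rw [mul_one] at this
        refine this.congr (Eventually.of_forall fun z => ?_)
        rw [hn, show ((i : ℤ) - (i + 1)) = -1 by ring, zpow_neg_one, one_mul]
      · have := (hasRes_zpow (k := (i : ℤ) - N) (by omega) 0).const_mul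
          (iteratedDeriv i b 0 / i.factorial)
        rwa [mul_zero] at this
    have h2 := (HasRes.sum h1).add (hasRes_zero_of_analyticAt hF)
    rw [Finset.sum_ite_eq' (Finset.range (n + 1)) n] at h2
    have e : poleCoeff b N = iteratedDeriv n b 0 / n.factorial := by
      rw [poleCoeff, if_pos hN, hn]; simp
    rw [if_pos (Finset.self_mem_range_succ n), add_zero, ← e] at h2
    refine h2.congr ?_
    filter_upwards [self_mem_nhdsWithin] with z hz
    have hz : z ≠ 0 := hz
    rw [hexp z, add_mul, Finset.sum_mul]
    congr 1
    · refine Finset.sum_congr rfl fun i _ => ?_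
      rw [sub_zero, sub_eq_add_neg, zpow_add₀ hz, zpow_natCast, smul_eq_mul]
      ring
    · rw [hn, smul_eq_mul, mul_right_comm, ← zpow_natCast, ← zpow_add₀ hz]
      push_cast
      rw [add_neg_cancel, zpow_zero, one_mul]
  · rw [poleCoeff, if_neg hN]
    obtain ⟨n, hn⟩ : ∃ n : ℕ, -N = n := ⟨(-N).toNat, by omega⟩
    rw [hn]
    apply hasRes_zero_of_analyticAt
    simp only [zpow_natCast]
    fun_prop

/-- The logarithmic derivative at a simple zero. -/
theorem exists_logDeriv_eq {ξ : ℂ → ℂ} {a : ℂ} (hξ : AnalyticAt ℂ ξ a) (hd : deriv ξ a ≠ 0) :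
    ∃ κ : ℂ → ℂ, AnalyticAt ℂ κ a ∧ κ a = 1 ∧
      ∀ᶠ z in 𝓝[≠] a, deriv ξ z * (ξ z - ξ a)⁻¹ = κ z * (z - a)⁻¹ := by
  have hs := analyticAt_dslope hξ
  have h0 : dslope ξ a a ≠ 0 := by rwa [dslope_same]
  refine ⟨fun z => deriv ξ z / dslope ξ a z, hξ.deriv.div hs h0, by
    simp only [dslope_same]; exact div_self hd, ?_⟩
  filter_upwards [self_mem_nhdsWithin] with z hz
  rw [dslope_of_ne _ hz, slope_def_field]
  have : z - a ≠ 0 := sub_ne_zero.mpr hz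
  by_cases h : ξ z - ξ a = 0
  · simp [h]
  · field_simp

/-- Residues of differential forms do not depend on the coordinate: the primitive pulls back by the
chain rule, and the polar term becomes the logarithmic derivative of a simple zero, which has
residue 1. -/
theorem HasRes.comp {G ξ : ℂ → ℂ} {a r : ℂ} (H : HasRes G (ξ a) r) (hξ : AnalyticAt ℂ ξ a)
    (hd : deriv ξ a ≠ 0) : HasRes (fun z => G (ξ z) * deriv ξ z) a r := by
  obtain ⟨κ, hκ, hκa, hκe⟩ := exists_logDeriv_eq hξ hd
  have h1 := (hasRes_simple_pole hκ).const_mul r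
  rw [hκa, mul_one] at h1
  obtain ⟨M, hM, hMd⟩ := H
  have h2 : HasRes (fun z => (G (ξ z) - r * (ξ z - ξ a)⁻¹) * deriv ξ z) a 0 := by
    refine ⟨M ∘ ξ, hM.comp_analyticAt hξ, ?_⟩
    have ht := hξ.differentiableAt.hasDerivAt.tendsto_nhdsNE hd
    filter_upwards [ht.eventually hMd, nhdsWithin_le_nhds hξ.eventually_analyticAt] with z h3 h4
    simpa using h3.comp z h4.differentiableAt.hasDerivAt
  have h3 := h2.add h1
  rw [zero_add] at h3
  refine h3.congr ?_
  filter_upwards [hκe] with z hz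
  rw [← hz]; ring

/-- Multiplying by a power of z - a clears the pole, and a Taylor expansion is divided back. The
singular part is a polynomial in (z - a)⁻¹, so it makes sense far from a and can be subtracted on a
whole disc. -/
theorem exists_principal_part {M : ℂ → ℂ} {a : ℂ} (hM : MeromorphicAt M a) :
    ∃ (P : Polynomial ℂ) (g : ℂ → ℂ), AnalyticAt ℂ g a ∧
      ∀ᶠ z in 𝓝[≠] a, M z = P.eval ((z - a)⁻¹) + g z := by
  obtain ⟨n, hn⟩ := hM
  have hf : AnalyticAt ℂ (fun z => z ^ n * M (z + a)) 0 := by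
    have h1 : AnalyticAt ℂ (fun z : ℂ => z + a) 0 := by fun_prop
    have h2 : AnalyticAt ℂ (fun z => (z - a) ^ n • M z) ((fun z : ℂ => z + a) 0) := by simpa using hn
    have := AnalyticAt.fun_comp_of_eq h2 h1 rfl
    simpa using this
  obtain ⟨F, hF, hexp⟩ := hf.exists_eq_sum_add_pow_mul n
  refine ⟨∑ i ∈ Finset.range n, Polynomial.C (iteratedDeriv i (fun z => z ^ n * M (z + a)) 0 /
    i.factorial) * Polynomial.X ^ (n - i), fun z => F (z - a), ?_, ?_⟩
  · have h1 : AnalyticAt ℂ (fun z : ℂ => z - a) a := by fun_prop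
    have h2 : AnalyticAt ℂ F ((fun z : ℂ => z - a) a) := by simpa using hF
    exact AnalyticAt.fun_comp h2 h1
  · filter_upwards [self_mem_nhdsWithin] with z hz
    have hz : z - a ≠ 0 := sub_ne_zero.mpr hz
    have := hexp (z - a)
    rw [sub_add_cancel] at this
    have hM : M z = ((z - a) ^ n)⁻¹ * ((z - a) ^ n * M z) := by field_simp
    rw [hM, this, mul_add, Finset.mul_sum, Polynomial.eval_finsetSum]
    congr 1
    · refine Finset.sum_congr rfl fun i hi => ?_
      have hi : i < n := Finset.mem_range.mp hi
      simp only [smul_eq_mul, Polynomial.eval_mul, Polynomial.eval_C, Polynomial.eval_pow,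
        Polynomial.eval_X, inv_pow]
      rw [show ((z - a) ^ n) = (z - a) ^ (n - i) * (z - a) ^ i by rw [← pow_add]; congr 1; omega]
      field_simp
    · rw [smul_eq_mul, inv_mul_cancel_left₀ (pow_ne_zero n hz)]

/-- Upgrades an identity on a punctured neighbourhood to one that may be differentiated at its
points. -/
theorem eventually_nhdsNE_nhds {p : ℂ → Prop} {a : ℂ} (h : ∀ᶠ z in 𝓝[≠] a, p z) :
    ∀ᶠ z in 𝓝[≠] a, ∀ᶠ w in 𝓝 z, p w := by
  filter_upwards [eventually_eventually_nhdsWithin.mpr h, self_mem_nhdsWithin] with z hz hza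
  rwa [isOpen_compl_singleton.nhdsWithin_eq hza] at hz

/-- The form of a function with a residue. -/
theorem HasRes.exists_eq {h : ℂ → ℂ} {a r : ℂ} (H : HasRes h a r) :
    ∃ (P : Polynomial ℂ) (g : ℂ → ℂ), AnalyticAt ℂ g a ∧ ∀ᶠ z in 𝓝[≠] a,
      h z = r * (z - a)⁻¹ + P.derivative.eval ((z - a)⁻¹) * (-((z - a) ^ 2)⁻¹) + g z := by
  obtain ⟨M, hM, hd⟩ := H
  obtain ⟨P, g, hg, he⟩ := exists_principal_part hM
  refine ⟨P, deriv g, hg.deriv, ?_⟩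
  filter_upwards [hd, eventually_nhdsNE_nhds he, self_mem_nhdsWithin,
    nhdsWithin_le_nhds hg.eventually_analyticAt] with z h1 h2 hz h4
  have hz' : z - a ≠ 0 := sub_ne_zero.mpr hz
  have h3 : HasDerivAt (fun z => P.eval ((z - a)⁻¹) + g z)
      (P.derivative.eval ((z - a)⁻¹) * (-((z - a) ^ 2)⁻¹) + deriv g z) z := by
    refine HasDerivAt.add ?_ h4.differentiableAt.hasDerivAt
    have hi : HasDerivAt (fun z : ℂ => (z - a)⁻¹) (-((z - a) ^ 2)⁻¹) z := by
      exact hasDerivAt_sub_inv hz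
    exact (P.hasDerivAt ((z - a)⁻¹)).comp z hi
  have h5 := h1.unique (h3.congr_of_eventuallyEq h2)
  linear_combination h5

/-! ### The residue theorem for closed curves in a disc -/

theorem integral_comp_eq_zero_of_hasDerivAt {M H : ℂ → ℂ} {γ : ℝ → ℂ} (hγ : ContDiff ℝ 1 γ)
    (hc : γ 0 = γ 1) (hM : ∀ t ∈ Icc (0 : ℝ) 1, HasDerivAt M (H (γ t)) (γ t))
    (hH : ∀ t ∈ Icc (0 : ℝ) 1, ContinuousAt H (γ t)) :
    ∫ t in (0 : ℝ)..1, H (γ t) * deriv γ t = 0 := by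
  have hI : uIcc (0 : ℝ) 1 = Icc 0 1 := uIcc_of_le zero_le_one
  have hcont : ContinuousOn (fun t => H (γ t) * deriv γ t) (uIcc (0 : ℝ) 1) := by
    rw [hI]
    intro t ht
    exact ((ContinuousAt.comp (hH t ht) hγ.continuous.continuousAt).mul
      (hγ.continuous_deriv le_rfl).continuousAt).continuousWithinAt
  rw [intervalIntegral.integral_eq_sub_of_hasDerivAt (f := fun t => M (γ t))
    (fun t ht => ?_) hcont.intervalIntegrable]
  · simp [hc]
  · rw [hI] at ht
    exact (hM t ht).comp_of_eq t (hγ.differentiable one_ne_zero t).hasDerivAt rfl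

/-- Induction on the number of poles. Removing one pole subtracts r/(z - a), which produces the
winding integral, and the derivative of a polynomial in (z - a)⁻¹, which integrates to zero along a
closed curve. Without poles the function has a primitive on the disc, so no homotopy theory is
needed. -/
theorem integral_eq_sum_residues {R : ℝ} {γ : ℝ → ℂ} (hγ : ContDiff ℝ 1 γ) (hc : γ 0 = γ 1)
    (hin : ∀ t ∈ Icc (0 : ℝ) 1, γ t ∈ ball (0 : ℂ) R) (r : ℂ → ℂ) (S : Finset ℂ) :
    ∀ h : ℂ → ℂ, (∀ z ∈ ball (0 : ℂ) R, z ∉ S → AnalyticAt ℂ h z) →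
    (∀ a ∈ S, HasRes h a (r a)) → (∀ t ∈ Icc (0 : ℝ) 1, γ t ∉ S) →
    ∫ t in (0 : ℝ)..1, h (γ t) * deriv γ t =
      ∑ a ∈ S, r a * ∫ t in (0 : ℝ)..1, deriv γ t / (γ t - a) := by
  classical
  induction S using Finset.induction_on with
  | empty =>
    intro h hd _ _
    obtain ⟨M, hM⟩ : Complex.IsExactOn h (ball (0 : ℂ) R) :=
      DifferentiableOn.isExactOn_ball fun z hz =>
        (hd z hz (Finset.notMem_empty z)).differentiableAt.differentiableWithinAt
    rw [integral_comp_eq_zero_of_hasDerivAt hγ hc (fun t ht => hM _ (hin t ht))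
      (fun t ht => (hd _ (hin t ht) (Finset.notMem_empty _)).continuousAt), Finset.sum_empty]
  | insert a S ha ih =>
    intro h hd hr hS
    obtain ⟨P, g, hg, he⟩ := (hr a (Finset.mem_insert_self a S)).exists_eq
    set D : ℂ → ℂ := fun z => P.derivative.eval ((z - a)⁻¹) * (-((z - a) ^ 2)⁻¹) with hD
    have hDan : ∀ z, z ≠ a → AnalyticAt ℂ D z := fun z hz => by
      have hz' : z - a ≠ 0 := sub_ne_zero.mpr hz
      have h1 : AnalyticAt ℂ (fun z => (z - a)⁻¹) z := by fun_prop (disch := exact hz')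
      have h2 : AnalyticAt ℂ (fun z => ((z - a) ^ 2)⁻¹) z := by
        fun_prop (disch := exact pow_ne_zero 2 hz')
      have h3 : AnalyticAt ℂ (fun w => P.derivative.eval w) ((z - a)⁻¹) :=
        (P.derivative.differentiable.analyticAt _)
      exact (h3.comp_of_eq h1 rfl).mul h2.neg
    have hIan : ∀ z, z ≠ a → AnalyticAt ℂ (fun z => r a * (z - a)⁻¹) z := fun z hz => by
      have hz' : z - a ≠ 0 := sub_ne_zero.mpr hz
      fun_prop (disch := exact hz')
    -- The value at a must be filled in by the regular part, as h itself is arbitrary there.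
    set h₁ : ℂ → ℂ := fun z => if z = a then g a else h z - (r a * (z - a)⁻¹ + D z) with hh₁
    have hne : ∀ z, z ≠ a → ∀ᶠ w in 𝓝 z, h₁ w = h w - (r a * (w - a)⁻¹ + D w) := fun z hz => by
      filter_upwards [isOpen_ne.mem_nhds hz] with w hw
      rw [hh₁]; simp only [if_neg hw]
    have hta : ∀ t ∈ Icc (0 : ℝ) 1, γ t ≠ a := fun t ht e =>
      hS t ht (by rw [e]; exact Finset.mem_insert_self a S)
    have key := ih h₁ ?_ ?_ (fun t ht hm => hS t ht (Finset.mem_insert_of_mem hm))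
    · have hcont : ∀ F : ℂ → ℂ, (∀ t ∈ Icc (0 : ℝ) 1, ContinuousAt F (γ t)) →
          IntervalIntegrable (fun t => F (γ t) * deriv γ t) MeasureTheory.volume 0 1 := by
        intro F hF
        apply ContinuousOn.intervalIntegrable
        rw [uIcc_of_le zero_le_one]
        intro t ht
        exact ((ContinuousAt.comp (hF t ht) hγ.continuous.continuousAt).mul
          (hγ.continuous_deriv le_rfl).continuousAt).continuousWithinAt
      have i1 := hcont (fun z => r a * (z - a)⁻¹) fun t ht => (hIan _ (hta t ht)).continuousAt
      have i2 := hcont D fun t ht => (hDan _ (hta t ht)).continuousAt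
      have i3 := hcont h fun t ht => (hd _ (hin t ht) (hS t ht)).continuousAt
      -- D is an exact derivative away from a, and the curve avoids a.
      have e0 : ∫ t in (0 : ℝ)..1, D (γ t) * deriv γ t = 0 := by
        refine integral_comp_eq_zero_of_hasDerivAt (M := fun z => P.eval ((z - a)⁻¹)) hγ hc
          (fun t ht => ?_) fun t ht => (hDan _ (hta t ht)).continuousAt
        have hi : HasDerivAt (fun z : ℂ => (z - a)⁻¹) (-((γ t - a) ^ 2)⁻¹) (γ t) := by
          exact hasDerivAt_sub_inv (hta t ht)
        exact (P.hasDerivAt ((γ t - a)⁻¹)).comp (γ t) hi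
      have e1 : ∫ t in (0 : ℝ)..1, h₁ (γ t) * deriv γ t =
          (∫ t in (0 : ℝ)..1, h (γ t) * deriv γ t) -
            ((∫ t in (0 : ℝ)..1, r a * (γ t - a)⁻¹ * deriv γ t) +
              ∫ t in (0 : ℝ)..1, D (γ t) * deriv γ t) := by
        rw [← intervalIntegral.integral_add i1 i2, ← intervalIntegral.integral_sub i3 (i1.add i2)]
        refine intervalIntegral.integral_congr fun t ht => ?_
        rw [uIcc_of_le zero_le_one] at ht
        simp only [(hne _ (hta t ht)).self_of_nhds]
        ring
      have e2 : ∫ t in (0 : ℝ)..1, r a * (γ t - a)⁻¹ * deriv γ t =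
          r a * ∫ t in (0 : ℝ)..1, deriv γ t / (γ t - a) := by
        rw [← intervalIntegral.integral_const_mul]
        refine intervalIntegral.integral_congr fun t _ => ?_
        simp only [div_eq_mul_inv]; ring
      rw [Finset.sum_insert ha, ← key, e1, e0, e2]; ring
    · intro z hz hzS
      by_cases hza : z = a
      · subst hza
        refine hg.congr ?_
        have := (eventually_nhdsWithin_iff.mp he)
        filter_upwards [this] with w hw
        by_cases hwz : w = z
        · rw [hh₁]; simp [hwz]
        · rw [hh₁]; simp only [if_neg hwz, hw hwz, hD]; ring
      · have h1 := hd z hz (by simp [hza, hzS])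
        exact (h1.sub ((hIan z hza).add (hDan z hza))).congr
          ((hne z hza).mono fun w hw => hw.symm)
    · intro b hb
      have hba : b ≠ a := fun e => ha (e ▸ hb)
      have h1 := (hr b (Finset.mem_insert_of_mem hb)).sub
        (hasRes_zero_of_analyticAt ((hIan b hba).add (hDan b hba)))
      rw [sub_zero] at h1
      exact h1.congr (nhdsWithin_le_nhds (hne b hba))

/-! ### Circles as closed curves and uniqueness of residues -/

/-- The parametrization by `[0, 1]` of a circle. -/
def circ (c : ℂ) (ρ : ℝ) (t : ℝ) : ℂ := circleMap c ρ (2 * Real.pi * t)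

theorem circ_contDiff (c : ℂ) (ρ : ℝ) : ContDiff ℝ 1 (circ c ρ) :=
  (contDiff_circleMap c ρ).comp (contDiff_const.mul contDiff_id)

theorem circ_closed (c : ℂ) (ρ : ℝ) : circ c ρ 0 = circ c ρ 1 := by
  simp [circ, circleMap]

theorem deriv_circ (c : ℂ) (ρ : ℝ) (t : ℝ) :
    deriv (circ c ρ) t = (2 * Real.pi : ℝ) * deriv (circleMap c ρ) (2 * Real.pi * t) := by
  have h1 : HasDerivAt (fun t : ℝ => 2 * Real.pi * t) (2 * Real.pi) t := by
    simpa using (hasDerivAt_id t).const_mul (2 * Real.pi)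
  have h2 := (differentiable_circleMap c ρ (2 * Real.pi * t)).hasDerivAt
  have := (h2.scomp t h1).deriv
  rw [show circ c ρ = circleMap c ρ ∘ fun t => 2 * Real.pi * t from rfl, this]
  simp

theorem integral_circ (c : ℂ) (ρ : ℝ) (f : ℂ → ℂ) :
    ∫ t in (0 : ℝ)..1, f (circ c ρ t) * deriv (circ c ρ) t = ∮ z in C(c, ρ), f z := by
  have := intervalIntegral.smul_integral_comp_mul_left (a := 0) (b := 1)
    (fun θ => deriv (circleMap c ρ) θ • f (circleMap c ρ θ)) (2 * Real.pi)
  rw [mul_zero, mul_one] at this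
  rw [circleIntegral, ← this, Complex.real_smul, ← intervalIntegral.integral_const_mul]
  refine intervalIntegral.integral_congr fun t _ => ?_
  simp only [deriv_circ, circ, smul_eq_mul]
  ring

theorem winding_circ {c a : ℂ} {ρ : ℝ} (h : a ∈ ball c ρ) :
    ∫ t in (0 : ℝ)..1, deriv (circ c ρ) t / (circ c ρ t - a) = 2 * Real.pi * Complex.I := by
  rw [← circleIntegral.integral_sub_inv_of_mem_ball h, ← integral_circ]
  refine intervalIntegral.integral_congr fun t _ => ?_
  simp only [div_eq_mul_inv]; ring

theorem circ_mem_sphere (c : ℂ) {ρ : ℝ} (hρ : 0 ≤ ρ) (t : ℝ) : circ c ρ t ∈ sphere c ρ :=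
  circleMap_mem_sphere c hρ _

theorem circleIntegral_eq_sum_residues {R ρ : ℝ} (hρ : 0 ≤ ρ) (hR : ρ < R) (r : ℂ → ℂ)
    (S : Finset ℂ) (hS : ∀ a ∈ S, a ∈ ball (0 : ℂ) ρ) (h : ℂ → ℂ)
    (hd : ∀ z ∈ ball (0 : ℂ) R, z ∉ S → AnalyticAt ℂ h z) (hr : ∀ a ∈ S, HasRes h a (r a)) :
    ∮ z in C(0, ρ), h z = 2 * Real.pi * Complex.I * ∑ a ∈ S, r a := by
  rw [← integral_circ, integral_eq_sum_residues (circ_contDiff 0 ρ) (circ_closed 0 ρ)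
    (fun t _ => ?_) r S h hd hr (fun t _ hm => ?_), Finset.mul_sum]
  · exact Finset.sum_congr rfl fun a ha => by rw [winding_circ (hS a ha), mul_comm]
  · have := circ_mem_sphere 0 hρ t
    rw [mem_sphere] at this
    rw [mem_ball, this]; exact hR
  · have h1 := circ_mem_sphere 0 hρ t
    have h2 := hS _ hm
    rw [mem_sphere] at h1
    rw [mem_ball, h1] at h2
    exact lt_irrefl _ h2

/-- The difference of two residues would be a residue of the zero function; integration over the
unit circle shows that it vanishes. -/
theorem HasRes.unique {h : ℂ → ℂ} {r r' : ℂ} (H : HasRes h 0 r) (H' : HasRes h 0 r') : r = r' := by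
  have h0 : HasRes (fun _ => (0 : ℂ)) 0 (r - r') := by simpa using H.sub H'
  have := circleIntegral_eq_sum_residues (R := 2) zero_le_one one_lt_two (fun _ => r - r') {0}
    (by simp) (fun _ => 0) (fun _ _ _ => analyticAt_const) (by simpa using h0)
  rw [Finset.sum_singleton] at this
  have h2 : (2 * Real.pi * Complex.I : ℂ) ≠ 0 := Complex.two_pi_I_ne_zero
  have h3 : (0 : ℂ) = 2 * Real.pi * Complex.I * (r - r') := by
    rw [← this]; simp [circleIntegral]
  exact sub_eq_zero.mp ((mul_eq_zero.mp h3.symm).resolve_left h2)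

/-- An analytic function that is injective near a point has a nonzero derivative there. -/
theorem deriv_ne_zero_of_injOn {f : ℂ → ℂ} {a : ℂ} (hf : AnalyticAt ℂ f a) {U : Set ℂ}
    (hU : U ∈ 𝓝 a) (hinj : InjOn f U) : deriv f a ≠ 0 := by
  intro hd
  have hfa : AnalyticAt ℂ (fun z => f z - f a) a := by fun_prop
  by_cases htop : analyticOrderAt (fun z => f z - f a) a = ⊤
  -- Infinite order means f is locally constant, against injectivity.
  · rw [analyticOrderAt_eq_top] at htop
    have h1 : ∀ᶠ z in 𝓝[≠] a, z ∈ U ∧ f z - f a = 0 ∧ z ≠ a := by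
      filter_upwards [nhdsWithin_le_nhds hU, nhdsWithin_le_nhds htop, self_mem_nhdsWithin]
        with z h1 h2 h3 using ⟨h1, h2, h3⟩
    obtain ⟨z, hzU, hz, hza⟩ := h1.exists
    exact hza (hinj hzU (mem_of_mem_nhds hU) (sub_eq_zero.mp hz))
  · obtain ⟨n, hn⟩ := ENat.ne_top_iff_exists.mp htop
    obtain ⟨g, hg, hga, hfg⟩ := hfa.analyticOrderAt_eq_natCast.mp hn.symm
    have hn2 : 2 ≤ n := by
      by_contra hlt
      interval_cases n
      · have := hfg.self_of_nhds
        simp at this; exact hga this.symm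
      · have h1 : HasDerivAt (fun z => f z - f a) (g a) a := by
          have h2 : HasDerivAt (fun z => (z - a) ^ 1 • g z) (g a) a := by
            have := ((hasDerivAt_id a).sub_const a).mul hg.differentiableAt.hasDerivAt
            simpa [Pi.mul_def] using this
          exact h2.congr_of_eventuallyEq hfg
        have h3 := (hf.differentiableAt.hasDerivAt.sub_const (f a)).unique h1
        exact hga (by rw [← h3, hd])
    have hn0 : (n : ℂ) ≠ 0 := by simp; omega
    -- An n-th root of g/g(a). With φ = (z - a) k, which is a local homeomorphism, f - f(a) = g(a)
    -- φⁿ, where n ≥ 2.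
    set k : ℂ → ℂ := fun z => Complex.exp (Complex.log (g z / g a) / n) with hk
    have hslit : g a / g a ∈ Complex.slitPlane := by rw [div_self hga]; simp
    have hkan : AnalyticAt ℂ k a := by
      have h1 : AnalyticAt ℂ (fun z => g z / g a) a := hg.div analyticAt_const hga
      exact ((h1.clog hslit).div analyticAt_const hn0).cexp
    have hkn : ∀ᶠ z in 𝓝 a, g z = g a * k z ^ n := by
      filter_upwards [hg.continuousAt.eventually_ne hga] with z hz
      rw [hk]
      simp only
      rw [← Complex.exp_nat_mul, mul_div_cancel₀ _ hn0, Complex.exp_log (div_ne_zero hz hga)]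
      field_simp
    set φ : ℂ → ℂ := fun z => (z - a) * k z with hφ
    have hφan : AnalyticAt ℂ φ a := by rw [hφ]; fun_prop
    have hφd : HasStrictDerivAt φ (k a) a := by
      have h1 : HasDerivAt φ (k a) a := by
        have := ((hasDerivAt_id a).sub_const a).mul hkan.differentiableAt.hasDerivAt
        simpa [Pi.mul_def] using this
      have h2 := hφan.hasStrictDerivAt
      rwa [h1.deriv] at h2
    have hka : k a ≠ 0 := Complex.exp_ne_zero _
    have hmap := hφd.map_nhds_eq hka
    have hφa : φ a = 0 := by simp [hφ]
    rw [hφa] at hmap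
    set V := U ∩ {z | f z - f a = (z - a) ^ n • g z} ∩ {z | g z = g a * k z ^ n} with hV
    have hVn : V ∈ 𝓝 a := inter_mem (inter_mem hU hfg) hkn
    have hVim : φ '' V ∈ 𝓝 (0 : ℂ) := by rw [← hmap]; exact image_mem_map hVn
    -- Points with φ-values w and ζ w have the same image under f but are distinct when w ≠ 0,
    -- because ζ ≠ 1.
    set ζ : ℂ := Complex.exp (2 * Real.pi * Complex.I / n) with hζ
    have hprim := Complex.isPrimitiveRoot_exp n (by omega)
    have hζ1 : ζ ≠ 1 := hprim.ne_one (by omega)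
    have hζn : ζ ^ n = 1 := hprim.pow_eq_one
    have hVim2 : (fun w => ζ * w) ⁻¹' (φ '' V) ∈ 𝓝 (0 : ℂ) := by
      apply ContinuousAt.preimage_mem_nhds (by fun_prop)
      simpa using hVim
    have hex : ∀ᶠ w in 𝓝[≠] (0 : ℂ), w ∈ φ '' V ∧ ζ * w ∈ φ '' V ∧ w ≠ 0 := by
      filter_upwards [nhdsWithin_le_nhds hVim, nhdsWithin_le_nhds hVim2, self_mem_nhdsWithin]
        with z h1 h2 h3 using ⟨h1, h2, h3⟩
    obtain ⟨w, ⟨z₁, hz₁, h1⟩, ⟨z₂, hz₂, h2⟩, hw⟩ := hex.exists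
    have hfV : ∀ z ∈ V, f z - f a = g a * φ z ^ n := by
      rintro z ⟨⟨_, h3⟩, h4⟩
      have h3 : f z - f a = (z - a) ^ n • g z := h3
      have h4 : g z = g a * k z ^ n := h4
      rw [h3, h4, hφ, smul_eq_mul, mul_pow]; ring
    have heq : f z₁ = f z₂ := by
      have e1 := hfV z₁ hz₁
      have e2 := hfV z₂ hz₂
      rw [h1] at e1
      rw [h2, mul_pow, hζn, one_mul] at e2
      linear_combination e1 - e2
    have hz := hinj hz₁.1.1 hz₂.1.1 heq
    rw [hz, h2] at h1
    exact hζ1 (mul_right_cancel₀ hw (by rw [h1, one_mul]))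

end

end HalfLine

namespace HalfLine

noncomputable section

/-! ### Coordinates on `H₂` -/

/-- `rep` is an arbitrary representative, so only ratios of its entries are meaningful; they may be
computed in any homogeneous coordinates. -/
theorem ratio_mk {V : Fin 4 → ℂ} (hV : V ≠ 0) (i j : Fin 4) :
    (Projectivization.mk ℂ V hV).rep j / (Projectivization.mk ℂ V hV).rep i = V j / V i := by
  obtain ⟨a, ha⟩ := Projectivization.exists_smul_eq_mk_rep ℂ V hV
  rw [← ha]
  simp only [Units.smul_def, Pi.smul_apply, smul_eq_mul]
  exact mul_div_mul_left _ _ a.ne_zero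

theorem rep_mk_ne_zero_iff {V : Fin 4 → ℂ} (hV : V ≠ 0) (i : Fin 4) :
    (Projectivization.mk ℂ V hV).rep i ≠ 0 ↔ V i ≠ 0 := by
  obtain ⟨a, ha⟩ := Projectivization.exists_smul_eq_mk_rep ℂ V hV
  rw [← ha]
  simp [Units.smul_def]

theorem mk_mem_H2 {K : ℂ} {V : Fin 4 → ℂ} (hV : V ≠ 0)
    (h2 : V 1 ^ 2 = (V 0 - eta21 K * V 3) * (V 0 - eta22 K * V 3))
    (h3 : V 2 ^ 2 = (V 0 - eta11 K * V 3) * (V 0 - eta12 K * V 3)) :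
    Projectivization.mk ℂ V hV ∈ H2 K := by
  obtain ⟨a, ha⟩ := Projectivization.exists_smul_eq_mk_rep ℂ V hV
  rw [H2, mem_ofPred_eq, ← ha]
  simp only [Units.smul_def, Pi.smul_apply, smul_eq_mul]
  exact ⟨by linear_combination (a : ℂ) ^ 2 * h2, by linear_combination (a : ℂ) ^ 2 * h3⟩

theorem eq_of_ratio_eq {p q : P3} (i : Fin 4) (hp : p.rep i ≠ 0) (hq : q.rep i ≠ 0)
    (h : ∀ j, p.rep j / p.rep i = q.rep j / q.rep i) : p = q := by
  rw [← p.mk_rep, ← q.mk_rep, Projectivization.mk_eq_mk_iff']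
  refine ⟨p.rep i / q.rep i, funext fun j => ?_⟩
  have := h j
  rw [Pi.smul_apply, smul_eq_mul]
  field_simp at this ⊢
  linear_combination -this

theorem eq_of_finite_coords {p q : P3} (hp : p.rep 3 ≠ 0) (hq : q.rep 3 ≠ 0) (h1 : xc p = xc q)
    (h2 : f2 p = f2 q) (h3 : f3 p = f3 q) : p = q := by
  refine eq_of_ratio_eq 3 hp hq fun j => ?_
  fin_cases j
  · exact h1
  · exact h2
  · exact h3
  · change p.rep 3 / p.rep 3 = q.rep 3 / q.rep 3
    rw [div_self hp, div_self hq]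

@[simp] theorem xc_affPt (x u v : ℂ) : xc (affPt x u v) = x := by simp [xc, affPt, ratio_mk]
@[simp] theorem f2_affPt (x u v : ℂ) : f2 (affPt x u v) = u := by simp [f2, affPt, ratio_mk]
@[simp] theorem f3_affPt (x u v : ℂ) : f3 (affPt x u v) = v := by simp [f3, affPt, ratio_mk]
theorem affPt_rep (x u v : ℂ) : (affPt x u v).rep 3 ≠ 0 := by
  rw [affPt, rep_mk_ne_zero_iff]; simp
theorem infPt_rep (u v : ℂ) : (infPt u v).rep 3 = 0 := by
  by_contra h
  rw [infPt, ← ne_eq, rep_mk_ne_zero_iff] at h; simp at h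
theorem infPt_rep_zero (u v : ℂ) : (infPt u v).rep 0 ≠ 0 := by
  rw [infPt, rep_mk_ne_zero_iff]; simp

section
variable {K xin yin : ℂ} {p : P3}

theorem f2_sq (hp : p ∈ H2 K) (h3 : p.rep 3 ≠ 0) :
    f2 p ^ 2 = (xc p - eta21 K) * (xc p - eta22 K) := by
  rw [f2, xc, div_pow, hp.1]; field_simp

theorem f3_sq (hp : p ∈ H2 K) (h3 : p.rep 3 ≠ 0) :
    f3 p ^ 2 = (xc p - eta11 K) * (xc p - eta12 K) := by
  rw [f3, xc, div_pow, hp.2]; field_simp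

/-- Changing the sign of f₁ turns y into the other root of the dispersion relation; the product is 1
because f₁² is the discriminant given by `quadrics_mul`. -/
theorem yc_mul (hp : p ∈ H2 K) (h3 : p.rep 3 ≠ 0) (hx : xc p ≠ 0) :
    yc K p * ((4 - K ^ 2 - xc p - (xc p)⁻¹ - f1 p / xc p) / 2) = 1 := by
  have h1 : f1 p ^ 2 = ((4 - K ^ 2) * xc p - 1 - xc p ^ 2) ^ 2 - 4 * xc p ^ 2 := by
    rw [← quadrics_mul, f1, mul_pow, f2_sq hp h3, f3_sq hp h3]
  rw [yc]
  field_simp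
  linear_combination -h1

theorem yc_ne_zero (hp : p ∈ H2 K) (h3 : p.rep 3 ≠ 0) (hx : xc p ≠ 0) : yc K p ≠ 0 :=
  left_ne_zero_of_mul_eq_one (yc_mul hp h3 hx)

theorem yc_inv (hp : p ∈ H2 K) (h3 : p.rep 3 ≠ 0) (hx : xc p ≠ 0) :
    (yc K p)⁻¹ = (4 - K ^ 2 - xc p - (xc p)⁻¹ - f1 p / xc p) / 2 :=
  (eq_inv_of_mul_eq_one_right (yc_mul hp h3 hx)).symm

theorem xc_mul_yc_sub_inv (hp : p ∈ H2 K) (h3 : p.rep 3 ≠ 0) (hx : xc p ≠ 0) :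
    xc p * (yc K p - (yc K p)⁻¹) = f1 p := by
  rw [yc_inv hp h3 hx, yc]; field_simp; ring

theorem yc_add_inv (hp : p ∈ H2 K) (h3 : p.rep 3 ≠ 0) (hx : xc p ≠ 0) :
    yc K p + (yc K p)⁻¹ = 4 - K ^ 2 - xc p - (xc p)⁻¹ := by
  rw [yc_inv hp h3 hx, yc]; ring

/-- Identifies the case distinction in `psi` with the zeros of f₁. -/
theorem yc_sq_eq_one_iff (hp : p ∈ H2 K) (h3 : p.rep 3 ≠ 0) (hx : xc p ≠ 0) :
    yc K p ^ 2 = 1 ↔ f1 p = 0 := by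
  have hy := yc_ne_zero hp h3 hx
  rw [← xc_mul_yc_sub_inv hp h3 hx, mul_eq_zero, or_iff_right hx, sub_eq_zero]
  rw [← mul_eq_one_iff_eq_inv₀ hy, sq]

theorem f3_ne_zero (h : Incident K xin yin) (hp : p ∈ H2 K) (h3 : p.rep 3 ≠ 0) (hx : ‖xc p‖ ≤ 1) :
    f3 p ≠ 0 := by
  intro h0
  have := f3_sq hp h3
  rw [h0, zero_pow two_ne_zero] at this
  have h1 := h.one_lt_eta11
  have h2 := h.one_lt_eta12
  rcases mul_eq_zero.mp this.symm with e | e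
  · rw [sub_eq_zero.mp e] at hx; linarith
  · rw [sub_eq_zero.mp e] at hx; linarith

theorem f1_ne_zero_of_norm_eq (h : Incident K xin yin) (hp : p ∈ H2 K) (h3 : p.rep 3 ≠ 0)
    (hx : ‖xc p‖ = 1) : f1 p ≠ 0 := by
  refine mul_ne_zero (fun h0 => ?_) (f3_ne_zero h hp h3 hx.le)
  have := f2_sq hp h3
  rw [h0, zero_pow two_ne_zero] at this
  have h1 := h.norm_eta21
  have h2 := h.norm_eta22
  rcases mul_eq_zero.mp this.symm with e | e
  · rw [sub_eq_zero.mp e] at hx; linarith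
  · rw [sub_eq_zero.mp e] at hx; linarith

end

/-! ### Functions on a coordinate disc -/

/-- Ratios of the chosen representatives equal ratios of the holomorphic homogeneous coordinates
supplied by `HolAt`, so the coordinate functions are analytic although `rep` is not even continuous
by construction. -/
theorem CoordDisc.analyticAt_ratio {K : ℂ} (D : CoordDisc K) {z : ℂ} (hz : z ∈ ball (0 : ℂ) 1)
    {i : Fin 4} (hi : (D.Φ z).rep i ≠ 0) :
    (∀ j, AnalyticAt ℂ (fun w => (D.Φ w).rep j / (D.Φ w).rep i) z) ∧
      ∀ᶠ w in 𝓝 z, (D.Φ w).rep i ≠ 0 := by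
  obtain ⟨F, hF, hΦ⟩ := D.hol z hz
  have hFj : ∀ j, AnalyticAt ℂ (fun w => F w j) z := fun j =>
    (ContinuousLinearMap.analyticAt (ContinuousLinearMap.proj j : (Fin 4 → ℂ) →L[ℂ] ℂ) _).comp hF
  have hFi : F z i ≠ 0 := by
    obtain ⟨h, e⟩ := hΦ.self_of_nhds
    rwa [e, rep_mk_ne_zero_iff] at hi
  constructor
  · intro j
    refine ((hFj j).div (hFj i) hFi).congr ?_
    filter_upwards [hΦ] with w ⟨h, e⟩
    rw [e, ratio_mk]
    rfl
  · filter_upwards [hΦ, (hFj i).continuousAt.eventually_ne hFi] with w ⟨h, e⟩ hne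
    rw [e, rep_mk_ne_zero_iff]; exact hne

/-- Near z the values of g stay in a disc about g(z) that does not meet its own negative, so a value
is determined by its square. This recovers f₂ and f₃ from x locally. -/
theorem exists_nhds_sq_eq {g : ℂ → ℂ} {z : ℂ} (hg : ContinuousAt g z) (h0 : g z ≠ 0) :
    ∃ U ∈ 𝓝 z, ∀ w ∈ U, ∀ w' ∈ U, g w ^ 2 = g w' ^ 2 → g w = g w' := by
  refine ⟨{w | ‖g w - g z‖ < ‖g z‖}, ?_, fun w hw w' hw' h => ?_⟩
  · have := hg.eventually (ball_mem_nhds (g z) (norm_pos_iff.mpr h0))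
    filter_upwards [this] with w hw
    rwa [dist_eq_norm] at hw
  · rcases sq_eq_sq_iff_eq_or_eq_neg.mp h with e | e
    · exact e
    · exfalso
      have h1 : ‖g w - g z‖ < ‖g z‖ := hw
      have h2 : ‖g w' - g z‖ < ‖g z‖ := hw'
      have h3 : (g w - g z) + (g w' - g z) = -(2 * g z) := by rw [e]; ring
      have h4 := norm_add_le (g w - g z) (g w' - g z)
      rw [h3, norm_neg, norm_mul, Complex.norm_ofNat] at h4
      linarith

section
variable {K xin yin : ℂ} (D : CoordDisc K) {z : ℂ}

/-- The point `D.Φ z` is not an infinity point. -/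
def CoordDisc.Regular (z : ℂ) : Prop :=
  z ∈ ball (0 : ℂ) 1 ∧ (D.Φ z).rep 3 ≠ 0 ∧ xc (D.Φ z) ≠ 0

variable {D}

theorem CoordDisc.analyticAt_xc (hz : z ∈ ball (0 : ℂ) 1) (h3 : (D.Φ z).rep 3 ≠ 0) :
    AnalyticAt ℂ (fun w => xc (D.Φ w)) z := (D.analyticAt_ratio hz h3).1 0

theorem CoordDisc.analyticAt_f2 (hz : z ∈ ball (0 : ℂ) 1) (h3 : (D.Φ z).rep 3 ≠ 0) :
    AnalyticAt ℂ (fun w => f2 (D.Φ w)) z := (D.analyticAt_ratio hz h3).1 1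

theorem CoordDisc.analyticAt_f3 (hz : z ∈ ball (0 : ℂ) 1) (h3 : (D.Φ z).rep 3 ≠ 0) :
    AnalyticAt ℂ (fun w => f3 (D.Φ w)) z := (D.analyticAt_ratio hz h3).1 2

theorem CoordDisc.analyticAt_f1 (hz : z ∈ ball (0 : ℂ) 1) (h3 : (D.Φ z).rep 3 ≠ 0) :
    AnalyticAt ℂ (fun w => f1 (D.Φ w)) z :=
  (CoordDisc.analyticAt_f2 hz h3).mul (CoordDisc.analyticAt_f3 hz h3)

theorem CoordDisc.eventually_mem (hz : z ∈ ball (0 : ℂ) 1) : ∀ᶠ w in 𝓝 z, w ∈ ball (0 : ℂ) 1 :=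
  isOpen_ball.mem_nhds hz

theorem CoordDisc.Regular.eventually (hz : D.Regular z) : ∀ᶠ w in 𝓝 z, D.Regular w := by
  filter_upwards [CoordDisc.eventually_mem hz.1, (D.analyticAt_ratio hz.1 hz.2.1).2,
    (CoordDisc.analyticAt_xc hz.1 hz.2.1).continuousAt.eventually_ne hz.2.2] with w h1 h2 h3
  exact ⟨h1, h2, h3⟩

theorem CoordDisc.Regular.mem (hz : D.Regular z) : D.Φ z ∈ H2 K := D.mem z hz.1

theorem CoordDisc.Regular.analyticAt_yc (hz : D.Regular z) :
    AnalyticAt ℂ (fun w => yc K (D.Φ w)) z := by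
  have h1 := CoordDisc.analyticAt_xc hz.1 hz.2.1
  have h2 := CoordDisc.analyticAt_f1 hz.1 hz.2.1
  have h3 := hz.2.2
  unfold yc
  have h4 := h1.inv h3
  have h5 := h2.div h1 h3
  exact (((analyticAt_const.sub h1).sub h4).add h5).div analyticAt_const two_ne_zero

theorem CoordDisc.Regular.yc_ne_zero (hz : D.Regular z) : yc K (D.Φ z) ≠ 0 :=
  HalfLine.yc_ne_zero hz.mem hz.2.1 hz.2.2

theorem CoordDisc.Regular.analyticAt_wave (hz : D.Regular z) (m n : ℤ) :
    AnalyticAt ℂ (fun w => wave K m n (D.Φ w)) z :=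
  ((CoordDisc.analyticAt_xc hz.1 hz.2.1).fun_zpow hz.2.2).mul
    (hz.analyticAt_yc.fun_zpow hz.yc_ne_zero)

theorem psi_eq_of_f1_ne {𝕜 : Type} [NontriviallyNormedField 𝕜] [NormedAlgebra 𝕜 ℂ] {c : 𝕜 → P3}
    {t : 𝕜} (hp : c t ∈ H2 K) (h3 : (c t).rep 3 ≠ 0) (hx : xc (c t) ≠ 0) (hf : f1 (c t) ≠ 0) :
    psi K c t = deriv (fun s => xc (c s)) t / f1 (c t) := by
  rw [psi, if_neg (by rwa [yc_sq_eq_one_iff hp h3 hx]), xc_mul_yc_sub_inv hp h3 hx]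

/-- The derivative of the dispersion relation along a coordinate disc. -/
theorem CoordDisc.Regular.deriv_relation (hz : D.Regular z) :
    deriv (fun w => xc (D.Φ w)) z * (1 - (xc (D.Φ z) ^ 2)⁻¹) +
      deriv (fun w => yc K (D.Φ w)) z * (1 - (yc K (D.Φ z) ^ 2)⁻¹) = 0 := by
  have hx := (CoordDisc.analyticAt_xc hz.1 hz.2.1).differentiableAt.hasDerivAt
  have hy := hz.analyticAt_yc.differentiableAt.hasDerivAt
  have hxi := (hasDerivAt_inv hz.2.2).comp_of_eq z hx rfl
  have hyi := (hasDerivAt_inv hz.yc_ne_zero).comp_of_eq z hy rfl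
  have h1 := (hx.add hxi).add (hy.add hyi)
  have h2 : HasDerivAt (fun _ : ℂ => 4 - K ^ 2) 0 z := hasDerivAt_const _ _
  have h3 := h1.unique (h2.congr_of_eventuallyEq ?_)
  · linear_combination h3
  · filter_upwards [hz.eventually] with w hw
    have := yc_add_inv hw.mem hw.2.1 hw.2.2
    simp only [Pi.add_apply, Function.comp_apply]
    linear_combination this

/-- Differentiating the dispersion relation shows that both expressions for Ψ agree where both
denominators are nonzero. -/
theorem CoordDisc.Regular.psi_eq (hz : D.Regular z) (hx : xc (D.Φ z) ^ 2 ≠ 1) :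
    psi K D.Φ z = -deriv (fun w => yc K (D.Φ w)) z /
      (yc K (D.Φ z) * (xc (D.Φ z) - (xc (D.Φ z))⁻¹)) := by
  rw [psi]
  split_ifs with hy
  · rfl
  · have h := hz.deriv_relation
    have hx0 := hz.2.2
    have hy0 := hz.yc_ne_zero
    have hx1 : xc (D.Φ z) ^ 2 - 1 ≠ 0 := sub_ne_zero.mpr hx
    have hy1 : yc K (D.Φ z) ^ 2 - 1 ≠ 0 := sub_ne_zero.mpr hy
    have e1 : xc (D.Φ z) - (xc (D.Φ z))⁻¹ = (xc (D.Φ z) ^ 2 - 1) / xc (D.Φ z) := by field_simp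
    have e2 : yc K (D.Φ z) - (yc K (D.Φ z))⁻¹ = (yc K (D.Φ z) ^ 2 - 1) / yc K (D.Φ z) := by
      field_simp
    rw [e1, e2]
    field_simp at h ⊢
    linear_combination h

/-- The two expressions for Ψ fail at x² = 1 and at f₁ = 0 respectively. This never happens at the
same point, since f₁ has no zero over the unit circle. -/
theorem CoordDisc.Regular.analyticAt_psi (h : Incident K xin yin) (hz : D.Regular z) :
    AnalyticAt ℂ (psi K D.Φ) z := by
  have hx := CoordDisc.analyticAt_xc hz.1 hz.2.1
  have hy := hz.analyticAt_yc
  by_cases hx1 : xc (D.Φ z) ^ 2 = 1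
  · have hn : ‖xc (D.Φ z)‖ = 1 := by
      have := congrArg norm hx1
      rw [norm_pow, norm_one] at this
      exact (pow_eq_one_iff_of_nonneg (norm_nonneg _) two_ne_zero).mp this
    have hf := f1_ne_zero_of_norm_eq h hz.mem hz.2.1 hn
    have hfa := CoordDisc.analyticAt_f1 hz.1 hz.2.1
    refine (hx.deriv.div hfa hf).congr ?_
    filter_upwards [hz.eventually, hfa.continuousAt.eventually_ne hf] with w h1 h2
    rw [psi_eq_of_f1_ne h1.mem h1.2.1 h1.2.2 h2]
    rfl
  · have hne : xc (D.Φ z) - (xc (D.Φ z))⁻¹ ≠ 0 := by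
      intro h0
      apply hx1
      rw [sub_eq_zero, ← mul_eq_one_iff_eq_inv₀ hz.2.2] at h0
      rw [sq, h0]
    refine (hy.deriv.neg.div (hy.mul (hx.sub (hx.inv hz.2.2)))
      (mul_ne_zero hz.yc_ne_zero hne)).congr ?_
    filter_upwards [hz.eventually, (hx.pow 2).continuousAt.eventually_ne hx1] with w h1 h2
    rw [h1.psi_eq h2]
    rfl

/-- The form `Ψ` along a curve in a coordinate disc. -/
theorem CoordDisc.Regular.psi_comp {γ : ℝ → ℂ} {t : ℝ} (hγ : DifferentiableAt ℝ γ t)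
    (hz : D.Regular (γ t)) :
    psi K (fun s => D.Φ (γ s)) t = psi K D.Φ (γ t) * deriv γ t := by
  have hx := (CoordDisc.analyticAt_xc hz.1 hz.2.1).differentiableAt.hasDerivAt
  have hy := hz.analyticAt_yc.differentiableAt.hasDerivAt
  have h1 := (hx.comp_of_eq t hγ.hasDerivAt rfl).deriv
  have h2 := (hy.comp_of_eq t hγ.hasDerivAt rfl).deriv
  simp only [Function.comp_def] at h1 h2
  rw [psi, psi, h1, h2]
  split_ifs <;> ring

/-- `x` is a local coordinate away from the branch points. -/
theorem CoordDisc.deriv_xc_ne_zero (hz : z ∈ ball (0 : ℂ) 1) (h3 : (D.Φ z).rep 3 ≠ 0)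
    (hf2 : f2 (D.Φ z) ≠ 0) (hf3 : f3 (D.Φ z) ≠ 0) : deriv (fun w => xc (D.Φ w)) z ≠ 0 := by
  obtain ⟨U, hU, hU'⟩ := exists_nhds_sq_eq (CoordDisc.analyticAt_f2 hz h3).continuousAt hf2
  obtain ⟨V, hV, hV'⟩ := exists_nhds_sq_eq (CoordDisc.analyticAt_f3 hz h3).continuousAt hf3
  have hW := inter_mem (inter_mem hU hV)
    (inter_mem (CoordDisc.eventually_mem hz) (D.analyticAt_ratio hz h3).2)
  -- x determines the squares of f₂ and f₃, hence locally f₂ and f₃ themselves and the point; so x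
  -- is injective near z.
  refine deriv_ne_zero_of_injOn (CoordDisc.analyticAt_xc hz h3) hW ?_
  rintro w ⟨⟨hwU, hwV⟩, hwb, hw3⟩ w' ⟨⟨hwU', hwV'⟩, hwb', hw3'⟩ e
  have e : xc (D.Φ w) = xc (D.Φ w') := e
  refine D.inj hwb hwb' (eq_of_finite_coords hw3 hw3' e (hU' w hwU w' hwU' ?_)
    (hV' w hwV w' hwV' ?_))
  · rw [f2_sq (D.mem w hwb) hw3, f2_sq (D.mem w' hwb') hw3', e]
  · rw [f3_sq (D.mem w hwb) hw3, f3_sq (D.mem w' hwb') hw3', e]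

/-- `f₂` is a local coordinate where `2 x ≠ η₂₁ + η₂₂`, away from the branch points of `f₃`. -/
theorem CoordDisc.deriv_f2_ne_zero (hz : z ∈ ball (0 : ℂ) 1) (h3 : (D.Φ z).rep 3 ≠ 0)
    (hx : 2 * xc (D.Φ z) - (eta21 K + eta22 K) ≠ 0) (hf3 : f3 (D.Φ z) ≠ 0) :
    deriv (fun w => f2 (D.Φ w)) z ≠ 0 := by
  have hxa := CoordDisc.analyticAt_xc hz h3
  have hga : ContinuousAt (fun w => 2 * xc (D.Φ w) - (eta21 K + eta22 K)) z :=
    (continuousAt_const.mul hxa.continuousAt).sub continuousAt_const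
  obtain ⟨U, hU, hU'⟩ := exists_nhds_sq_eq hga hx
  obtain ⟨V, hV, hV'⟩ := exists_nhds_sq_eq (CoordDisc.analyticAt_f3 hz h3).continuousAt hf3
  have hW := inter_mem (inter_mem hU hV)
    (inter_mem (CoordDisc.eventually_mem hz) (D.analyticAt_ratio hz h3).2)
  refine deriv_ne_zero_of_injOn (CoordDisc.analyticAt_f2 hz h3) hW ?_
  rintro w ⟨⟨hwU, hwV⟩, hwb, hw3⟩ w' ⟨⟨hwU', hwV'⟩, hwb', hw3'⟩ e
  have e : f2 (D.Φ w) = f2 (D.Φ w') := e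
  have h1 := f2_sq (D.mem w hwb) hw3
  have h2 := f2_sq (D.mem w' hwb') hw3'
  rw [e] at h1
  have ex : xc (D.Φ w) = xc (D.Φ w') := by
    -- (2x - η₂₁ - η₂₂)² = 4 f₂² + (η₂₁ - η₂₂)², so f₂ determines this square, and locally x.
    have := hU' w hwU w' hwU' (by linear_combination 4 * h2 - 4 * h1)
    linear_combination this / 2
  refine D.inj hwb hwb' (eq_of_finite_coords hw3 hw3' ex e (hV' w hwV w' hwV' ?_))
  rw [f3_sq (D.mem w hwb) hw3, f3_sq (D.mem w' hwb') hw3', ex]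

/-- `x⁻¹` is a local coordinate at infinity. -/
theorem CoordDisc.deriv_inv_xc_ne_zero (hz : z ∈ ball (0 : ℂ) 1) (h0 : (D.Φ z).rep 0 ≠ 0)
    (hf2 : (D.Φ z).rep 1 ≠ 0) (hf3 : (D.Φ z).rep 2 ≠ 0) :
    deriv (fun w => (D.Φ w).rep 3 / (D.Φ w).rep 0) z ≠ 0 := by
  have hr := D.analyticAt_ratio hz h0
  obtain ⟨U, hU, hU'⟩ := exists_nhds_sq_eq (hr.1 1).continuousAt (div_ne_zero hf2 h0)
  obtain ⟨V, hV, hV'⟩ := exists_nhds_sq_eq (hr.1 2).continuousAt (div_ne_zero hf3 h0)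
  have hW := inter_mem (inter_mem hU hV) (inter_mem (CoordDisc.eventually_mem hz) hr.2)
  refine deriv_ne_zero_of_injOn (hr.1 3) hW ?_
  rintro w ⟨⟨hwU, hwV⟩, hwb, hw0⟩ w' ⟨⟨hwU', hwV'⟩, hwb', hw0'⟩ e
  have e : (D.Φ w).rep 3 / (D.Φ w).rep 0 = (D.Φ w').rep 3 / (D.Φ w').rep 0 := e
  have hw0 : (D.Φ w).rep 0 ≠ 0 := hw0
  have hw0' : (D.Φ w').rep 0 ≠ 0 := hw0'
  have hq : ∀ p : P3, p ∈ H2 K → p.rep 0 ≠ 0 →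
      (p.rep 1 / p.rep 0) ^ 2 = (1 - eta21 K * (p.rep 3 / p.rep 0)) *
        (1 - eta22 K * (p.rep 3 / p.rep 0)) ∧
      (p.rep 2 / p.rep 0) ^ 2 = (1 - eta11 K * (p.rep 3 / p.rep 0)) *
        (1 - eta12 K * (p.rep 3 / p.rep 0)) := by
    intro p hp h0
    rw [div_pow, div_pow, hp.1, hp.2]
    constructor <;> field_simp
  have q1 := hq _ (D.mem w hwb) hw0
  have q2 := hq _ (D.mem w' hwb') hw0'
  refine D.inj hwb hwb' (eq_of_ratio_eq 0 hw0 hw0' fun j => ?_)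
  fin_cases j
  · change (D.Φ w).rep 0 / (D.Φ w).rep 0 = (D.Φ w').rep 0 / (D.Φ w').rep 0
    rw [div_self hw0, div_self hw0']
  · exact hU' w hwU w' hwU' (by rw [q1.1, q2.1, e])
  · exact hV' w hwV w' hwV' (by rw [q1.2, q2.2, e])
  · exact e

end

end

end HalfLine

namespace HalfLine

noncomputable section

/-! ### The integrand in the coordinates `(x, f₂, f₃)` -/

/-- The coefficient of `dx` in the form `w_{m,n} A Ψ`, in terms of `x`, `u = f₂`, `v = f₃`. -/
def formCoeff (K xin yin : ℂ) (m n : ℤ) (x u v : ℂ) : ℂ :=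
  x ^ m * ((4 - K ^ 2 - x - x⁻¹ + u * v / x) / 2) ^ n *
    (-(xin * (yin - yin⁻¹) - f3In K xin * u) / (4 * Real.pi * Complex.I * (x - xin))) / (u * v)

section
variable {K xin yin : ℂ}

theorem Incident.add_inv (h : Incident K xin yin) : yin + yin⁻¹ = 4 - K ^ 2 - xin - xin⁻¹ := by
  have := h.disp
  rw [Dhat] at this
  linear_combination this

theorem Incident.sq_eq (h : Incident K xin yin) : (xin * (yin - yin⁻¹)) ^ 2 =
    (xin - eta21 K) * (xin - eta22 K) * ((xin - eta11 K) * (xin - eta12 K)) := by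
  have h1 := h.add_inv
  have hx := h.x_ne
  have hy := h.y_ne
  have h2 : (xin * (yin - yin⁻¹)) ^ 2 = (xin * (yin + yin⁻¹)) ^ 2 - 4 * xin ^ 2 := by
    field_simp; ring
  rw [h2, h1, quadrics_mul]
  field_simp
  ring

theorem f1_p1 (h : Incident K xin yin) : f1 (p1 K xin yin) = xin * (yin - yin⁻¹) := by
  have := f3In_ne h h.x_lt.le
  rw [f1, p1, f2_affPt, f3_affPt]; field_simp

theorem f3_p1 : f3 (p1 K xin yin) = -f3In K xin := f3_affPt _ _ _

theorem transformant_eq (h : Incident K xin yin) (p : P3) :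
    transformant K xin yin p = -(xin * (yin - yin⁻¹) - f3In K xin * f2 p) /
      (4 * Real.pi * Complex.I * (xc p - xin)) := by
  rw [transformant, f1_p1 h, f3_p1]; ring

theorem wave_mul_transformant_div (h : Incident K xin yin) (m n : ℤ) (p : P3) :
    wave K m n p * transformant K xin yin p / f1 p =
      formCoeff K xin yin m n (xc p) (f2 p) (f3 p) := by
  rw [transformant_eq h, formCoeff, wave, yc, f1]

/-- The relative sign of f₂ and f₃ decides the growth of y: f₁ = -R is the branch on which y tends
to infinity as x → 0, and f₁ = R is its inverse. -/
theorem yc_zero_neg {x : ℂ} (hx : x ≠ 0) {w : ℂ} (hw : w = -Rfun K x) :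
    (4 - K ^ 2 - x - x⁻¹ + w / x) / 2 = Yfun K x / x := by
  rw [hw, Yfun]; field_simp; ring

theorem yc_zero_pos {x : ℂ} (hx : x ≠ 0) {w : ℂ} (hw : w = Rfun K x) :
    (4 - K ^ 2 - x - x⁻¹ + w / x) / 2 = (Yfun K x / x)⁻¹ := by
  apply eq_inv_of_mul_eq_one_right
  have := Yfun_mul K x
  rw [hw]
  field_simp
  linear_combination 2 * this

theorem bracketZero_eq (K xin yin ε : ℂ) (n : ℤ) (x : ℂ) : bracketZero K xin yin ε n x =
    Yfun K x ^ n * (xin * (yin - yin⁻¹) - f3In K xin * (ε * f2In K x)) /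
      (2 * (x - xin) * Rfun K x) := by
  have e1 : x / eta21 K = eta11 K * x := by rw [eta11_eq, div_eq_mul_inv, mul_comm]
  have e2 : x / eta22 K = eta12 K * x := by rw [eta12_eq, div_eq_mul_inv, mul_comm]
  rw [bracketZero, f2In, gInf3, e1, e2]; ring

theorem bracketInf_eq (K xin yin ε : ℂ) (n : ℤ) (τ : ℂ) : bracketInf K xin yin ε n τ =
    -(Yfun K τ ^ n * (τ * (xin * (yin - yin⁻¹)) - f3In K xin * (ε * gInf2 K τ))) /
      (2 * (1 - xin * τ) * Rfun K τ) := by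
  rw [bracketInf, gInf2]; ring

/-- Here, and in the three companion lemmas, the integrand is split into a factor analytic at the
infinity point and a pure power. The bracket is analytic because Y(0) = -1 and R(0) = 1 are nonzero;
the exponent collects x^m and the power of x in y^n. -/
theorem formCoeff_zero_neg (h : Incident K xin yin) (m n : ℤ) {ε x : ℂ} (hε : ε ^ 2 = 1)
    (hx : x ≠ 0) :
    formCoeff K xin yin m n x (ε * f2In K x) (-ε * f3In K x) =
      (2 * Real.pi * Complex.I)⁻¹ * (bracketZero K xin yin ε n x * x ^ (-(n - m))) := by
  have huv : ε * f2In K x * (-ε * f3In K x) = -Rfun K x := by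
    rw [← f2In_mul_f3In h]; linear_combination (-f2In K x * f3In K x) * hε
  rw [formCoeff, yc_zero_neg hx huv, huv, bracketZero_eq, show -(n - m) = m + -n by ring,
    zpow_add₀ hx, zpow_neg, div_zpow]
  simp only [div_eq_mul_inv, mul_inv, inv_neg]
  ring

theorem formCoeff_zero_pos (h : Incident K xin yin) (m n : ℤ) {ε x : ℂ} (hε : ε ^ 2 = 1)
    (hx : x ≠ 0) :
    formCoeff K xin yin m n x (ε * f2In K x) (ε * f3In K x) =
      -(2 * Real.pi * Complex.I)⁻¹ * (bracketZero K xin yin ε (-n) x * x ^ (-(-m - n))) := by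
  have huv : ε * f2In K x * (ε * f3In K x) = Rfun K x := by
    rw [← f2In_mul_f3In h]; linear_combination (f2In K x * f3In K x) * hε
  rw [formCoeff, yc_zero_pos hx huv, huv, bracketZero_eq, show -(-m - n) = m + n by ring,
    zpow_add₀ hx, inv_zpow', div_zpow, zpow_neg x n]
  simp only [div_eq_mul_inv, mul_inv, inv_inv]
  ring

theorem one_sub_mul_inv {τ a : ℂ} (hτ : τ ≠ 0) : (τ⁻¹ - a)⁻¹ = τ * (1 - a * τ)⁻¹ := by
  rw [show τ⁻¹ - a = τ⁻¹ * (1 - a * τ) by field_simp, mul_inv, inv_inv]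

/-- The extra factor -τ⁻² is dx/dτ for x = τ⁻¹. -/
theorem formCoeff_inf_neg (m n : ℤ) {ε τ : ℂ} (hε : ε ^ 2 = 1) (hτ : τ ≠ 0) :
    formCoeff K xin yin m n τ⁻¹ (ε * gInf2 K τ / τ) (-ε * gInf3 K τ / τ) * -(τ ^ 2)⁻¹ =
      (2 * Real.pi * Complex.I)⁻¹ * (bracketInf K xin yin ε n τ * τ ^ (-(m + n))) := by
  have huv : ε * gInf2 K τ / τ * (-ε * gInf3 K τ / τ) = -Rfun K τ / τ ^ 2 := by
    rw [Rfun_eq]; field_simp; linear_combination (-gInf2 K τ * gInf3 K τ) * hε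
  have hy : (4 - K ^ 2 - τ⁻¹ - τ⁻¹⁻¹ + ε * gInf2 K τ / τ * (-ε * gInf3 K τ / τ) / τ⁻¹) / 2 =
      Yfun K τ / τ := by
    rw [huv, ← yc_zero_neg hτ rfl, inv_inv]; field_simp; ring
  rw [formCoeff, hy, huv, bracketInf_eq, neg_add, zpow_add₀ hτ, zpow_neg, zpow_neg, inv_zpow,
    div_zpow]
  simp only [div_eq_mul_inv, mul_inv, inv_neg, inv_inv, one_sub_mul_inv hτ]
  field_simp
  ring

theorem formCoeff_inf_pos (m n : ℤ) {ε τ : ℂ} (hε : ε ^ 2 = 1) (hτ : τ ≠ 0) :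
    formCoeff K xin yin m n τ⁻¹ (ε * gInf2 K τ / τ) (ε * gInf3 K τ / τ) * -(τ ^ 2)⁻¹ =
      -(2 * Real.pi * Complex.I)⁻¹ * (bracketInf K xin yin ε (-n) τ * τ ^ (-(m - n))) := by
  have huv : ε * gInf2 K τ / τ * (ε * gInf3 K τ / τ) = Rfun K τ / τ ^ 2 := by
    rw [Rfun_eq]; field_simp; linear_combination (gInf2 K τ * gInf3 K τ) * hε
  have hy : (4 - K ^ 2 - τ⁻¹ - τ⁻¹⁻¹ + ε * gInf2 K τ / τ * (ε * gInf3 K τ / τ) / τ⁻¹) / 2 =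
      (Yfun K τ / τ)⁻¹ := by
    rw [huv, ← yc_zero_pos hτ rfl, inv_inv]; field_simp; ring
  rw [formCoeff, hy, huv, bracketInf_eq, show -(m - n) = -m + n by ring, zpow_add₀ hτ, zpow_neg τ,
    inv_zpow', inv_zpow, div_zpow, zpow_neg (Yfun K τ) n, zpow_neg τ m]
  simp only [div_eq_mul_inv, mul_inv, inv_inv, one_sub_mul_inv hτ]
  field_simp
  ring

/-! ### Residues at the infinity points -/

theorem analyticAt_bracketZero (h : Incident K xin yin) (ε : ℂ) (n : ℤ) :
    AnalyticAt ℂ (bracketZero K xin yin ε n) 0 := by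
  rw [show bracketZero K xin yin ε n = _ from funext (bracketZero_eq K xin yin ε n)]
  have h1 := analyticAt_Yfun_zero K
  have h2 := analyticAt_f2In_zero K
  have h3 := analyticAt_Rfun_zero K
  have h4 : AnalyticAt ℂ (fun x => Yfun K x ^ n) 0 := h1.fun_zpow (by rw [Yfun_zero]; simp)
  refine AnalyticAt.div (by fun_prop) (by fun_prop) ?_
  rw [Rfun_zero]; simpa using h.x_ne

theorem analyticAt_bracketInf (K xin yin ε : ℂ) (n : ℤ) :
    AnalyticAt ℂ (bracketInf K xin yin ε n) 0 := by
  rw [show bracketInf K xin yin ε n = _ from funext (bracketInf_eq K xin yin ε n)]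
  have h1 := analyticAt_Yfun_zero K
  have h2 := analyticAt_gInf2_zero K
  have h3 := analyticAt_Rfun_zero K
  have h4 : AnalyticAt ℂ (fun x => Yfun K x ^ n) 0 := h1.fun_zpow (by rw [Yfun_zero]; simp)
  refine AnalyticAt.div (by fun_prop) (by fun_prop) ?_
  rw [Rfun_zero]; simp

/-- Whether the infinity point lies over `x = 0`. -/
def overZero : Fin 8 → Bool := ![true, false, false, true, true, false, false, true]

/-- The sign of `f₂` at the infinity point. -/
def sgn2 : Fin 8 → ℤ := ![1, 1, 1, 1, -1, -1, -1, -1]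

/-- The sign of `f₃` at the infinity point. -/
def sgn3 : Fin 8 → ℤ := ![1, 1, -1, -1, -1, -1, 1, 1]

theorem sgn_cases (i : Fin 8) : (sgn2 i = 1 ∨ sgn2 i = -1) ∧ (sgn3 i = sgn2 i ∨ sgn3 i = -sgn2 i) := by
  revert i; decide

theorem sgn2_sq (i : Fin 8) : (sgn2 i : ℂ) ^ 2 = 1 := by
  rcases (sgn_cases i).1 with h | h <;> simp [h]

theorem sgn3_sq (i : Fin 8) : (sgn3 i : ℂ) ^ 2 = 1 := by
  rcases (sgn_cases i).2 with h | h <;> simp [h, sgn2_sq i]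

theorem Jpt_eq (K : ℂ) (i : Fin 8) : Jpt K i =
    if overZero i then affPt 0 (sgn2 i * (f3Zero K)⁻¹) (sgn3 i * f3Zero K)
    else infPt (sgn2 i) (sgn3 i) := by
  fin_cases i <;> simp [Jpt, overZero, sgn2, sgn3]

theorem resTerm_eq (m n : ℤ) (i : Fin 8) : resTerm K xin yin m n i =
    if overZero i then
      if sgn3 i = -sgn2 i then poleCoeff (bracketZero K xin yin (sgn2 i) n) (n - m)
      else -poleCoeff (bracketZero K xin yin (sgn2 i) (-n)) (-m - n)
    else
      if sgn3 i = -sgn2 i then poleCoeff (bracketInf K xin yin (sgn2 i) n) (m + n)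
      else -poleCoeff (bracketInf K xin yin (sgn2 i) (-n)) (m - n) := by
  fin_cases i <;> simp [resTerm, overZero, sgn2, sgn3]

/-- The residue at an infinity point over `x = 0`, in the coordinate `x`. -/
theorem hasRes_formCoeff_zero (h : Incident K xin yin) (m n : ℤ) {i : Fin 8} (hi : overZero i) :
    HasRes (fun x => formCoeff K xin yin m n x (sgn2 i * f2In K x) (sgn3 i * f3In K x)) 0
      ((2 * Real.pi * Complex.I)⁻¹ * resTerm K xin yin m n i) := by
  rw [resTerm_eq, if_pos hi]
  split_ifs with hs
  · refine ((hasRes_poleCoeff (analyticAt_bracketZero h (sgn2 i) n) (n - m)).const_mul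
      (2 * Real.pi * Complex.I)⁻¹).congr ?_
    filter_upwards [self_mem_nhdsWithin] with x hx
    rw [hs, Int.cast_neg, formCoeff_zero_neg h m n (sgn2_sq i) hx]
  · have hs' := (sgn_cases i).2.resolve_right hs
    rw [mul_neg, ← neg_mul]
    refine ((hasRes_poleCoeff (analyticAt_bracketZero h (sgn2 i) (-n)) (-m - n)).const_mul
      (-(2 * Real.pi * Complex.I)⁻¹)).congr ?_
    filter_upwards [self_mem_nhdsWithin] with x hx
    rw [hs', formCoeff_zero_pos h m n (sgn2_sq i) hx]

/-- The residue at an infinity point over `x = ∞`, in the coordinate `τ = x⁻¹`. -/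
theorem hasRes_formCoeff_inf (m n : ℤ) {i : Fin 8} (hi : ¬overZero i) :
    HasRes (fun τ => formCoeff K xin yin m n τ⁻¹ (sgn2 i * gInf2 K τ / τ) (sgn3 i * gInf3 K τ / τ) *
      -(τ ^ 2)⁻¹) 0 ((2 * Real.pi * Complex.I)⁻¹ * resTerm K xin yin m n i) := by
  rw [resTerm_eq, if_neg hi]
  split_ifs with hs
  · refine ((hasRes_poleCoeff (analyticAt_bracketInf K xin yin (sgn2 i) n) (m + n)).const_mul
      (2 * Real.pi * Complex.I)⁻¹).congr ?_
    filter_upwards [self_mem_nhdsWithin] with x hx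
    rw [hs, Int.cast_neg, formCoeff_inf_neg m n (sgn2_sq i) hx]
  · have hs' := (sgn_cases i).2.resolve_right hs
    rw [mul_neg, ← neg_mul]
    refine ((hasRes_poleCoeff (analyticAt_bracketInf K xin yin (sgn2 i) (-n)) (m - n)).const_mul
      (-(2 * Real.pi * Complex.I)⁻¹)).congr ?_
    filter_upwards [self_mem_nhdsWithin] with x hx
    rw [hs', formCoeff_inf_pos m n (sgn2_sq i) hx]

/-- Two continuous square roots of one function that agree at a nonzero value cannot be opposite
nearby. It identifies f₂ and f₃ near an infinity point with the signed explicit branches. -/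
theorem eventually_eq_of_sq_eq {g k : ℂ → ℂ} {a : ℂ} (hg : ContinuousAt g a)
    (hk : ContinuousAt k a) (h0 : g a = k a) (hne : g a ≠ 0) (hsq : ∀ᶠ z in 𝓝 a, g z ^ 2 = k z ^ 2) :
    ∀ᶠ z in 𝓝 a, g z = k z := by
  have h1 : ContinuousAt (fun z => g z + k z) a := hg.add hk
  have h2 : g a + k a ≠ 0 := by rw [← h0, ← two_mul]; exact mul_ne_zero two_ne_zero hne
  filter_upwards [hsq, h1.eventually_ne h2] with z h3 h4
  rcases sq_eq_sq_iff_eq_or_eq_neg.mp h3 with e | e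
  · exact e
  · exact absurd (by rw [e]; ring) h4

variable {D : CoordDisc K} {a : ℂ}

theorem H2_inf_coords {p : P3} (hp : p ∈ H2 K) (h0 : p.rep 0 ≠ 0) :
    (p.rep 1 / p.rep 0) ^ 2 = (1 - eta21 K * (p.rep 3 / p.rep 0)) *
        (1 - eta22 K * (p.rep 3 / p.rep 0)) ∧
      (p.rep 2 / p.rep 0) ^ 2 = (1 - eta11 K * (p.rep 3 / p.rep 0)) *
        (1 - eta12 K * (p.rep 3 / p.rep 0)) := by
  rw [div_pow, div_pow, hp.1, hp.2]
  constructor <;> field_simp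

/-- At an infinity point x or x⁻¹ is a local coordinate in which the form becomes the explicit
`formCoeff`; `HasRes.comp` carries the residue to the parameter of an arbitrary coordinate disc. -/
theorem hasRes_Jpt (h : Incident K xin yin) (m n : ℤ) (ha : a ∈ ball (0 : ℂ) 1) (i : Fin 8)
    (hai : D.Φ a = Jpt K i) :
    HasRes (fun z => wave K m n (D.Φ z) * transformant K xin yin (D.Φ z) * psi K D.Φ z) a
      ((2 * Real.pi * Complex.I)⁻¹ * resTerm K xin yin m n i) := by
  have hc := f3Zero_ne h
  have hs2 : (sgn2 i : ℂ) ≠ 0 := fun e => by have := sgn2_sq i; rw [e] at this; simp at this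
  have hs3 : (sgn3 i : ℂ) ≠ 0 := fun e => by have := sgn3_sq i; rw [e] at this; simp at this
  rw [Jpt_eq] at hai
  by_cases hi : overZero i
  · rw [if_pos hi] at hai
    have h3 : (D.Φ a).rep 3 ≠ 0 := by rw [hai]; exact affPt_rep _ _ _
    have hX : xc (D.Φ a) = 0 := by rw [hai, xc_affPt]
    have hU : f2 (D.Φ a) = sgn2 i * (f3Zero K)⁻¹ := by rw [hai, f2_affPt]
    have hV : f3 (D.Φ a) = sgn3 i * f3Zero K := by rw [hai, f3_affPt]
    have hU0 : f2 (D.Φ a) ≠ 0 := by rw [hU]; exact mul_ne_zero hs2 (inv_ne_zero hc)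
    have hV0 : f3 (D.Φ a) ≠ 0 := by rw [hV]; exact mul_ne_zero hs3 hc
    have hXa := CoordDisc.analyticAt_xc ha h3
    have hUa := CoordDisc.analyticAt_f2 ha h3
    have hVa := CoordDisc.analyticAt_f3 ha h3
    have hXd := CoordDisc.deriv_xc_ne_zero ha h3 hU0 hV0
    have hfin := (D.analyticAt_ratio ha h3).2
    have hmem := CoordDisc.eventually_mem ha
    have e2 : ∀ᶠ z in 𝓝 a, f2 (D.Φ z) = sgn2 i * f2In K (xc (D.Φ z)) := by
      refine eventually_eq_of_sq_eq hUa.continuousAt ?_ (by rw [hX, f2In_zero, hU]) hU0 ?_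
      · exact continuousAt_const.mul (ContinuousAt.comp_of_eq (g := f2In K)
          (analyticAt_f2In_zero K).continuousAt hXa.continuousAt hX)
      · filter_upwards [hfin, hmem] with z h1 h2
        rw [mul_pow, f2In_sq h, sgn2_sq, one_mul, f2_sq (D.mem z h2) h1]
    have e3 : ∀ᶠ z in 𝓝 a, f3 (D.Φ z) = sgn3 i * f3In K (xc (D.Φ z)) := by
      refine eventually_eq_of_sq_eq hVa.continuousAt ?_ (by rw [hX, f3In_zero, hV]) hV0 ?_
      · exact continuousAt_const.mul (ContinuousAt.comp_of_eq
          (analyticAt_f3In (K := K) (x := 0) (by simp) (by simp)).continuousAt hXa.continuousAt hX)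
      · filter_upwards [hfin, hmem] with z h1 h2
        rw [mul_pow, f3In_sq h, sgn3_sq, one_mul, f3_sq (D.mem z h2) h1]
    have key := HasRes.comp (ξ := fun z => xc (D.Φ z)) (a := a)
      (by simp only [hX]; exact hasRes_formCoeff_zero h m n hi) hXa hXd
    refine key.congr ?_
    have hne : ∀ᶠ z in 𝓝[≠] a, xc (D.Φ z) ≠ 0 :=
      hXa.differentiableAt.hasDerivAt.eventually_ne hXd
    filter_upwards [hne, nhdsWithin_le_nhds e2, nhdsWithin_le_nhds e3, nhdsWithin_le_nhds hfin,
      nhdsWithin_le_nhds hmem, nhdsWithin_le_nhds (hUa.continuousAt.eventually_ne hU0),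
      nhdsWithin_le_nhds (hVa.continuousAt.eventually_ne hV0)] with z h1 h2 h3 h4 h5 h6 h7
    rw [psi_eq_of_f1_ne (D.mem z h5) h4 h1 (mul_ne_zero h6 h7), ← h2, ← h3,
      ← wave_mul_transformant_div h]
    ring
  · rw [if_neg hi] at hai
    have h0 : (D.Φ a).rep 0 ≠ 0 := by rw [hai]; exact infPt_rep_zero _ _
    have hT : (D.Φ a).rep 3 / (D.Φ a).rep 0 = 0 := by rw [hai, infPt, ratio_mk]; simp
    have hU : (D.Φ a).rep 1 / (D.Φ a).rep 0 = sgn2 i := by rw [hai, infPt, ratio_mk]; simp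
    have hV : (D.Φ a).rep 2 / (D.Φ a).rep 0 = sgn3 i := by rw [hai, infPt, ratio_mk]; simp
    have hr := D.analyticAt_ratio ha h0
    have hU0 : (D.Φ a).rep 1 / (D.Φ a).rep 0 ≠ 0 := by rw [hU]; exact hs2
    have hV0 : (D.Φ a).rep 2 / (D.Φ a).rep 0 ≠ 0 := by rw [hV]; exact hs3
    have hTd := CoordDisc.deriv_inv_xc_ne_zero ha h0 (left_ne_zero_of_mul hU0)
      (left_ne_zero_of_mul hV0)
    have hmem := CoordDisc.eventually_mem ha
    have e2 : ∀ᶠ z in 𝓝 a, (D.Φ z).rep 1 / (D.Φ z).rep 0 =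
        sgn2 i * gInf2 K ((D.Φ z).rep 3 / (D.Φ z).rep 0) := by
      refine eventually_eq_of_sq_eq (hr.1 1).continuousAt ?_ (by rw [hT, gInf2_zero, hU, mul_one])
        hU0 ?_
      · exact continuousAt_const.mul (ContinuousAt.comp_of_eq
          (analyticAt_gInf2_zero K).continuousAt (hr.1 3).continuousAt hT)
      · filter_upwards [hr.2, hmem] with z h1 h2
        rw [mul_pow, gInf2_sq, sgn2_sq, one_mul, (H2_inf_coords (D.mem z h2) h1).1]
    have e3 : ∀ᶠ z in 𝓝 a, (D.Φ z).rep 2 / (D.Φ z).rep 0 =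
        sgn3 i * gInf3 K ((D.Φ z).rep 3 / (D.Φ z).rep 0) := by
      refine eventually_eq_of_sq_eq (hr.1 2).continuousAt ?_ (by rw [hT, gInf3_zero, hV, mul_one])
        hV0 ?_
      · exact continuousAt_const.mul (ContinuousAt.comp_of_eq
          (analyticAt_gInf3_zero K).continuousAt (hr.1 3).continuousAt hT)
      · filter_upwards [hr.2, hmem] with z h1 h2
        rw [mul_pow, gInf3_sq, sgn3_sq, one_mul, (H2_inf_coords (D.mem z h2) h1).2]
    have key := HasRes.comp (ξ := fun z => (D.Φ z).rep 3 / (D.Φ z).rep 0) (a := a)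
      (by simp only [hT]; exact hasRes_formCoeff_inf (K := K) (xin := xin) (yin := yin) m n hi) (hr.1 3) hTd
    refine key.congr ?_
    have hne : ∀ᶠ z in 𝓝[≠] a, (D.Φ z).rep 3 / (D.Φ z).rep 0 ≠ 0 :=
      (hr.1 3).differentiableAt.hasDerivAt.eventually_ne hTd
    filter_upwards [hne, nhdsWithin_le_nhds e2, nhdsWithin_le_nhds e3, nhdsWithin_le_nhds hr.2,
      nhdsWithin_le_nhds hmem, nhdsWithin_le_nhds ((hr.1 1).continuousAt.eventually_ne hU0),
      nhdsWithin_le_nhds ((hr.1 2).continuousAt.eventually_ne hV0),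
      nhdsWithin_le_nhds (hr.1 3).eventually_analyticAt] with z h1 h2 h3 h4 h5 h6 h7 h8
    have hz3 : (D.Φ z).rep 3 ≠ 0 := left_ne_zero_of_mul h1
    have hx : xc (D.Φ z) = ((D.Φ z).rep 3 / (D.Φ z).rep 0)⁻¹ := by rw [xc, inv_div]
    have hf2 : f2 (D.Φ z) = (D.Φ z).rep 1 / (D.Φ z).rep 0 / ((D.Φ z).rep 3 / (D.Φ z).rep 0) := by
      rw [f2]; field_simp
    have hf3 : f3 (D.Φ z) = (D.Φ z).rep 2 / (D.Φ z).rep 0 / ((D.Φ z).rep 3 / (D.Φ z).rep 0) := by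
      rw [f3]; field_simp
    have hxz : xc (D.Φ z) ≠ 0 := by rw [hx]; exact inv_ne_zero h1
    have hd : deriv (fun w => xc (D.Φ w)) z = -(((D.Φ z).rep 3 / (D.Φ z).rep 0) ^ 2)⁻¹ *
        deriv (fun w => (D.Φ w).rep 3 / (D.Φ w).rep 0) z := by
      have h9 := ((hasDerivAt_inv h1).comp z h8.differentiableAt.hasDerivAt).deriv
      rw [← h9]
      congr 1
      ext w
      simp only [Function.comp_apply, xc, inv_div]
    rw [psi_eq_of_f1_ne (D.mem z h5) hz3 hxz, hd, ← h2, ← h3, ← hf2, ← hf3, ← hx,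
      ← wave_mul_transformant_div h]
    · ring
    · rw [f1, hf2, hf3]
      exact mul_ne_zero (div_ne_zero h6 h1) (div_ne_zero h7 h1)

end

end

end HalfLine

namespace HalfLine

noncomputable section

/-! ### The poles of the transformant -/

section
variable {K xin yin : ℂ} {D : CoordDisc K} {a z : ℂ}

/-- The value of `f₂` at `p₁` and `p₄`. -/
def f2P (K xin yin : ℂ) : ℂ := -(xin * (yin - yin⁻¹)) / f3In K xin

theorem f2P_sq (h : Incident K xin yin) :
    f2P K xin yin ^ 2 = (xin - eta21 K) * (xin - eta22 K) := by
  have := f3In_ne h h.x_lt.le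
  rw [f2P, div_pow, neg_sq, h.sq_eq, ← f3In_sq h xin]
  field_simp

theorem f3In_mul_f2P (h : Incident K xin yin) :
    f3In K xin * f2P K xin yin = -(xin * (yin - yin⁻¹)) := by
  have := f3In_ne h h.x_lt.le
  rw [f2P]; field_simp

/-- In this form the numerator vanishes at the points over x_in where f₂ = -f₂(p₁). Over x_in poles
therefore occur only where f₂ = f₂(p₁), that is at p₁ and p₄. -/
theorem transformant_eq_f2P (h : Incident K xin yin) (p : P3) :
    transformant K xin yin p = f3In K xin * (f2P K xin yin + f2 p) /
      (4 * Real.pi * Complex.I * (xc p - xin)) := by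
  rw [transformant_eq h, mul_add, f3In_mul_f2P h]; ring

theorem p1_eq : p1 K xin yin = affPt xin (f2P K xin yin) (-f3In K xin) := rfl
theorem p4_eq : p4 K xin yin = affPt xin (f2P K xin yin) (f3In K xin) := rfl

theorem pi_I_ne : (Real.pi : ℂ) * Complex.I ≠ 0 :=
  mul_ne_zero (Complex.ofReal_ne_zero.mpr Real.pi_ne_zero) Complex.I_ne_zero

/-- Near a point over `x_in` with `f₂ = f₂(p₁)` the form `A Ψ` has a simple pole. -/
theorem exists_simple_pole (h : Incident K xin yin) (ha : a ∈ ball (0 : ℂ) 1) {v : ℂ}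
    (hav : D.Φ a = affPt xin (f2P K xin yin) v) :
    ∃ κ : ℂ → ℂ, AnalyticAt ℂ κ a ∧ κ a = (2 * Real.pi * Complex.I)⁻¹ * (f3In K xin / v) ∧
      ∀ᶠ z in 𝓝[≠] a, transformant K xin yin (D.Φ z) * psi K D.Φ z = κ z * (z - a)⁻¹ := by
  have h3 : (D.Φ a).rep 3 ≠ 0 := by rw [hav]; exact affPt_rep _ _ _
  have hX : xc (D.Φ a) = xin := by rw [hav, xc_affPt]
  have hU : f2 (D.Φ a) = f2P K xin yin := by rw [hav, f2_affPt]
  have hV : f3 (D.Φ a) = v := by rw [hav, f3_affPt]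
  have hV0 : f3 (D.Φ a) ≠ 0 := f3_ne_zero h (D.mem a ha) h3 (by rw [hX]; exact h.x_lt.le)
  have hv0 : v ≠ 0 := hV ▸ hV0
  have hreg : D.Regular a := ⟨ha, h3, by rw [hX]; exact h.x_ne⟩
  have hXa := CoordDisc.analyticAt_xc ha h3
  have hUa := CoordDisc.analyticAt_f2 ha h3
  have hVa := CoordDisc.analyticAt_f3 ha h3
  have hpi := pi_I_ne
  -- If f₂(p₁) = 0, then x_in is one of η₂₁, η₂₂ and x ramifies at p₁ and p₄; f₂ replaces it as
  -- local coordinate.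
  by_cases hu : f2P K xin yin = 0
  · have hx2 : 2 * xc (D.Φ a) - (eta21 K + eta22 K) ≠ 0 := by
      have := f2P_sq h
      rw [hu, zero_pow two_ne_zero] at this
      rw [hX]
      rcases mul_eq_zero.mp this.symm with e | e
      · rw [sub_eq_zero.mp e]
        exact fun e' => eta21_ne_eta22 K (by linear_combination e')
      · rw [sub_eq_zero.mp e]
        exact fun e' => eta21_ne_eta22 K (by linear_combination -e')
    have hUd := CoordDisc.deriv_f2_ne_zero ha h3 hx2 hV0
    obtain ⟨κ, hκ, hκa, hκe⟩ := exists_logDeriv_eq hUa hUd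
    have hxa : AnalyticAt ℂ (fun w => 2 * xc (D.Φ w) - (eta21 K + eta22 K)) a :=
      (analyticAt_const.mul hXa).sub analyticAt_const
    refine ⟨fun z => f3In K xin / (2 * Real.pi * Complex.I * f3 (D.Φ z)) *
      ((xc (D.Φ z) + xin - (eta21 K + eta22 K)) / (2 * xc (D.Φ z) - (eta21 K + eta22 K))) * κ z,
      ?_, ?_, ?_⟩
    · refine AnalyticAt.mul (AnalyticAt.mul (analyticAt_const.div (analyticAt_const.mul hVa) ?_)
        (((hXa.add analyticAt_const).sub analyticAt_const).div hxa hx2)) hκ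
      rw [mul_assoc 2]
      exact mul_ne_zero (mul_ne_zero two_ne_zero hpi) hV0
    · simp only [hκa, hV]
      have : (xc (D.Φ a) + xin - (eta21 K + eta22 K)) / (2 * xc (D.Φ a) - (eta21 K + eta22 K)) = 1 := by
        rw [← div_self hx2]; congr 1; rw [hX]; ring
      rw [this, mul_one, mul_one, div_eq_mul_inv, div_eq_mul_inv, mul_inv]; ring
    · have hUne : ∀ᶠ z in 𝓝[≠] a, f2 (D.Φ z) ≠ 0 := by
        have := hUa.differentiableAt.hasDerivAt.eventually_ne (c := 0) hUd
        exact this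
      filter_upwards [hκe, hUne, nhdsWithin_le_nhds hreg.eventually,
        nhdsWithin_le_nhds (hVa.continuousAt.eventually_ne hV0),
        nhdsWithin_le_nhds (hxa.continuousAt.eventually_ne hx2),
        nhdsWithin_le_nhds (eventually_eventually_nhds.mpr hreg.eventually)]
        with z h1 h2 h4 h5 h6 h7
      -- x_in is now a root of the quadratic f₂², the other root being η₂₁ + η₂₂ - x_in. Thus f₂/(x
      -- - x_in) is (x + x_in - η₂₁ - η₂₂)/f₂, a simple pole in f₂.
      have hs : ∀ w, D.Regular w → f2 (D.Φ w) ^ 2 =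
          (xc (D.Φ w) - xin) * (xc (D.Φ w) + xin - (eta21 K + eta22 K)) := by
        intro w hw
        have e1 := f2_sq hw.mem hw.2.1
        have e2 := f2P_sq h
        rw [hu, zero_pow two_ne_zero] at e2
        linear_combination e1 - e2
      have hxd := (CoordDisc.analyticAt_xc h4.1 h4.2.1).differentiableAt.hasDerivAt
      have hud := (CoordDisc.analyticAt_f2 h4.1 h4.2.1).differentiableAt.hasDerivAt
      have hd : 2 * f2 (D.Φ z) * deriv (fun w => f2 (D.Φ w)) z =
          (2 * xc (D.Φ z) - (eta21 K + eta22 K)) * deriv (fun w => xc (D.Φ w)) z := by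
        have d1 := hud.fun_pow 2
        have d2 := (hxd.sub_const xin).mul ((hxd.add_const xin).sub_const (eta21 K + eta22 K))
        have := d1.unique (d2.congr_of_eventuallyEq (by
          filter_upwards [h7] with w hw using hs w hw))
        simp only [Nat.cast_ofNat, Nat.add_one_sub_one, pow_one] at this
        linear_combination this
      have hsz := hs z h4
      have hf22 : f2 (D.Φ z) ^ 2 ≠ 0 := pow_ne_zero 2 h2
      rw [hsz] at hf22
      have hxx := left_ne_zero_of_mul hf22
      have hxs := right_ne_zero_of_mul hf22
      rw [mul_assoc, ← h1, hU, hu, sub_zero, psi_eq_of_f1_ne h4.mem h4.2.1 h4.2.2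
        (mul_ne_zero h2 h5), transformant_eq_f2P h, hu, zero_add, f1]
      have hd' : deriv (fun w => xc (D.Φ w)) z = 2 * f2 (D.Φ z) * deriv (fun w => f2 (D.Φ w)) z /
          (2 * xc (D.Φ z) - (eta21 K + eta22 K)) := by
        rw [hd, mul_comm, mul_div_assoc, div_self h6, mul_one]
      rw [hd']
      have hpi1 : (Real.pi : ℂ) ≠ 0 := left_ne_zero_of_mul hpi
      have hpi2 := Complex.I_ne_zero
      have hgoal : f2 (D.Φ z) / (xc (D.Φ z) - xin) =
          (xc (D.Φ z) + xin - (eta21 K + eta22 K)) * (f2 (D.Φ z))⁻¹ := by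
        field_simp; linear_combination hsz
      calc _ = f3In K xin / (2 * Real.pi * Complex.I * f3 (D.Φ z)) *
            (f2 (D.Φ z) / (xc (D.Φ z) - xin)) / (2 * xc (D.Φ z) - (eta21 K + eta22 K)) *
              deriv (fun w => f2 (D.Φ w)) z := by
            field_simp; ring
        _ = _ := by rw [hgoal]; ring
  · have hU0 : f2 (D.Φ a) ≠ 0 := by rwa [hU]
    have hXd := CoordDisc.deriv_xc_ne_zero ha h3 hU0 hV0
    obtain ⟨κ, hκ, hκa, hκe⟩ := exists_logDeriv_eq hXa hXd
    -- At a the sum f₂(p₁) + f₂ equals 2 f₂(p₁), which reduces 4πi to 2πi.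
    refine ⟨fun z => f3In K xin * (f2P K xin yin + f2 (D.Φ z)) /
      (4 * Real.pi * Complex.I * (f2 (D.Φ z) * f3 (D.Φ z))) * κ z, ?_, ?_, ?_⟩
    · refine AnalyticAt.mul (AnalyticAt.div (analyticAt_const.mul (analyticAt_const.add hUa))
        (analyticAt_const.mul (hUa.mul hVa)) ?_) hκ
      rw [mul_assoc 4]
      exact mul_ne_zero (mul_ne_zero (by norm_num) hpi) (mul_ne_zero hU0 hV0)
    · simp only [hκa, hV, hU, mul_one]
      have hpi1 : (Real.pi : ℂ) ≠ 0 := left_ne_zero_of_mul hpi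
      have hpi2 := Complex.I_ne_zero
      field_simp
      ring
    · filter_upwards [hκe, nhdsWithin_le_nhds hreg.eventually,
        nhdsWithin_le_nhds (hVa.continuousAt.eventually_ne hV0),
        nhdsWithin_le_nhds (hUa.continuousAt.eventually_ne hU0)] with z h1 h4 h5 h6
      rw [hX] at h1
      rw [mul_assoc, ← h1, psi_eq_of_f1_ne h4.mem h4.2.1 h4.2.2 (mul_ne_zero h6 h5),
        transformant_eq_f2P h, f1]
      simp only [div_eq_mul_inv, mul_inv]
      ring

theorem tendsto_of_simple_pole {κ F : ℂ → ℂ} (hκ : AnalyticAt ℂ κ a)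
    (hF : ∀ᶠ z in 𝓝[≠] a, F z = κ z * (z - a)⁻¹) :
    Tendsto (fun s => (s - a) * F s) (𝓝[≠] a) (𝓝 (κ a)) := by
  refine (hκ.continuousAt.continuousWithinAt.tendsto).congr' ?_
  filter_upwards [hF, self_mem_nhdsWithin] with s hs hne
  have : s - a ≠ 0 := sub_ne_zero.mpr hne
  rw [hs]; field_simp

theorem tendsto_p1 (h : Incident K xin yin) (ha : a ∈ ball (0 : ℂ) 1)
    (hp : D.Φ a = p1 K xin yin) :
    Tendsto (fun s => (s - a) * (transformant K xin yin (D.Φ s) * psi K D.Φ s)) (𝓝[≠] a)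
      (𝓝 (-(2 * Real.pi * Complex.I)⁻¹)) := by
  obtain ⟨κ, hκ, hκa, he⟩ := exists_simple_pole h ha hp
  have := tendsto_of_simple_pole hκ he
  rwa [hκa, div_neg, div_self (f3In_ne h h.x_lt.le), mul_neg_one] at this

theorem tendsto_p4 (h : Incident K xin yin) (ha : a ∈ ball (0 : ℂ) 1)
    (hp : D.Φ a = p4 K xin yin) :
    Tendsto (fun s => (s - a) * (transformant K xin yin (D.Φ s) * psi K D.Φ s)) (𝓝[≠] a)
      (𝓝 (2 * Real.pi * Complex.I)⁻¹) := by
  obtain ⟨κ, hκ, hκa, he⟩ := exists_simple_pole h ha hp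
  have := tendsto_of_simple_pole hκ he
  rwa [hκa, div_self (f3In_ne h h.x_lt.le), mul_one] at this

/-- The transformant with its removable singularities removed. -/
def transformantReg (K xin yin : ℂ) (p : P3) : ℂ :=
  open Classical in
  if xc p = xin then f3In K xin * (2 * xin - (eta21 K + eta22 K)) /
    (4 * Real.pi * Complex.I * (f2 p - f2P K xin yin))
  else transformant K xin yin p

/-- With x = x_in and f₂ = f₂(p₁) only the sign of f₃ is free, and its two values give p₁ and p₄. -/
theorem f2_ne_f2P (h : Incident K xin yin) {p : P3} (hp : p ∈ H2 K) (h3 : p.rep 3 ≠ 0)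
    (h1 : p ≠ p1 K xin yin) (h4 : p ≠ p4 K xin yin) (hx : xc p = xin) : f2 p ≠ f2P K xin yin := by
  intro hf
  have := f3_sq hp h3
  rw [hx, ← f3In_sq h] at this
  rcases sq_eq_sq_iff_eq_or_eq_neg.mp this with e | e
  · exact h4 (eq_of_finite_coords h3 (affPt_rep _ _ _) (by rw [hx, p4_eq, xc_affPt])
      (by rw [hf, p4_eq, f2_affPt]) (by rw [e, p4_eq, f3_affPt]))
  · exact h1 (eq_of_finite_coords h3 (affPt_rep _ _ _) (by rw [hx, p1_eq, xc_affPt])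
      (by rw [hf, p1_eq, f2_affPt]) (by rw [e, p1_eq, f3_affPt]))

/-- If x_in is a zero of f₂, then f₂(p₁) = 0 and the only points over x_in are p₁ and p₄. So x is a
local coordinate at every other point over x_in. -/
theorem f2_ne_zero_of_xc (h : Incident K xin yin) {p : P3} (hp : p ∈ H2 K) (h3 : p.rep 3 ≠ 0)
    (h1 : p ≠ p1 K xin yin) (h4 : p ≠ p4 K xin yin) (hx : xc p = xin) : f2 p ≠ 0 := by
  intro h0
  have := f2_ne_f2P h hp h3 h1 h4 hx
  have h2 := f2_sq hp h3
  rw [hx, ← f2P_sq h, h0, zero_pow two_ne_zero] at h2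
  rw [h0] at this
  exact this (pow_eq_zero_iff two_ne_zero |>.mp h2.symm).symm

theorem analyticAt_transformantReg (h : Incident K xin yin) (hz : z ∈ ball (0 : ℂ) 1)
    (h3 : (D.Φ z).rep 3 ≠ 0) (h1 : D.Φ z ≠ p1 K xin yin) (h4 : D.Φ z ≠ p4 K xin yin) :
    AnalyticAt ℂ (fun w => transformantReg K xin yin (D.Φ w)) z := by
  have hXa := CoordDisc.analyticAt_xc hz h3
  have hUa := CoordDisc.analyticAt_f2 hz h3
  have hpi := pi_I_ne
  by_cases hx : xc (D.Φ z) = xin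
  · have hne := f2_ne_f2P h (D.mem z hz) h3 h1 h4 hx
    have hna : AnalyticAt ℂ (fun w => f2 (D.Φ w) - f2P K xin yin) z := hUa.sub analyticAt_const
    have : AnalyticAt ℂ (fun w => f3In K xin * (xc (D.Φ w) + xin - (eta21 K + eta22 K)) /
        (4 * Real.pi * Complex.I * (f2 (D.Φ w) - f2P K xin yin))) z := by
      refine AnalyticAt.div (analyticAt_const.mul ((hXa.add analyticAt_const).sub analyticAt_const))
        (analyticAt_const.mul hna) ?_
      rw [mul_assoc 4]
      exact mul_ne_zero (mul_ne_zero (by norm_num) hpi) (sub_ne_zero.mpr hne)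
    refine this.congr ?_
    filter_upwards [hna.continuousAt.eventually_ne (sub_ne_zero.mpr hne),
      CoordDisc.eventually_mem hz, (D.analyticAt_ratio hz h3).2] with w h5 h6 h7
    rw [transformantReg]
    split_ifs with hw
    · rw [hw]; ring
    · have e1 := f2_sq (D.mem w h6) h7
      have e2 := f2P_sq h
      have hw' : xc (D.Φ w) - xin ≠ 0 := sub_ne_zero.mpr hw
      have hpi1 : (Real.pi : ℂ) ≠ 0 := left_ne_zero_of_mul hpi
      have hpi2 := Complex.I_ne_zero
      rw [transformant_eq_f2P h]
      -- Since f₂² - f₂(p₁)² = (x - x_in)(x + x_in - η₂₁ - η₂₂), the vanishing denominator is traded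
      -- for f₂ - f₂(p₁), which is nonzero here.
      have key : (xc (D.Φ w) + xin - (eta21 K + eta22 K)) / (f2 (D.Φ w) - f2P K xin yin) =
          (f2P K xin yin + f2 (D.Φ w)) / (xc (D.Φ w) - xin) := by
        rw [div_eq_div_iff h5 hw']; linear_combination e2 - e1
      calc _ = f3In K xin / (4 * Real.pi * Complex.I) *
            ((xc (D.Φ w) + xin - (eta21 K + eta22 K)) / (f2 (D.Φ w) - f2P K xin yin)) := by
            rw [div_mul_div_comm]
        _ = _ := by rw [key, div_mul_div_comm]
  · have : AnalyticAt ℂ (fun w => transformant K xin yin (D.Φ w)) z := by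
      rw [show (fun w => transformant K xin yin (D.Φ w)) = _ from
        funext fun w => transformant_eq_f2P h (D.Φ w)]
      refine AnalyticAt.div (analyticAt_const.mul (analyticAt_const.add hUa))
        (analyticAt_const.mul (hXa.sub analyticAt_const)) ?_
      rw [mul_assoc 4]
      exact mul_ne_zero (mul_ne_zero (by norm_num) hpi) (sub_ne_zero.mpr hx)
    refine this.congr ?_
    filter_upwards [hXa.continuousAt.eventually_ne hx] with w hw
    rw [transformantReg, if_neg hw]

theorem deriv_xc_ne_zero_of_xc_eq (h : Incident K xin yin) (hz : z ∈ ball (0 : ℂ) 1)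
    (h3 : (D.Φ z).rep 3 ≠ 0) (h1 : D.Φ z ≠ p1 K xin yin) (h4 : D.Φ z ≠ p4 K xin yin)
    (hx : xc (D.Φ z) = xin) : deriv (fun w => xc (D.Φ w)) z ≠ 0 :=
  CoordDisc.deriv_xc_ne_zero hz h3 (f2_ne_zero_of_xc h (D.mem z hz) h3 h1 h4 hx)
    (f3_ne_zero h (D.mem z hz) h3 (by rw [hx]; exact h.x_lt.le))

theorem H2_rep_of_inf {p : P3} (hp : p ∈ H2 K) (h3 : p.rep 3 = 0) :
    p.rep 0 ≠ 0 ∧ p.rep 1 ^ 2 = p.rep 0 ^ 2 ∧ p.rep 2 ^ 2 = p.rep 0 ^ 2 := by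
  have h1 := hp.1
  have h2 := hp.2
  rw [h3] at h1 h2
  have e1 : p.rep 1 ^ 2 = p.rep 0 ^ 2 := by rw [h1]; ring
  have e2 : p.rep 2 ^ 2 = p.rep 0 ^ 2 := by rw [h2]; ring
  refine ⟨fun h0 => p.rep_nonzero (funext fun j => ?_), e1, e2⟩
  rw [h0, zero_pow two_ne_zero, pow_eq_zero_iff two_ne_zero] at e1 e2
  fin_cases j
  · exact h0
  · exact e1
  · exact e2
  · exact h3

/-- The points over `x_in` are isolated. -/
theorem eventually_nhdsNE_xc_ne (h : Incident K xin yin) (hz : z ∈ ball (0 : ℂ) 1) :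
    ∀ᶠ w in 𝓝[≠] z, xc (D.Φ w) ≠ xin := by
  -- `H2` has at most four points over x_in, and Φ is injective, so their preimages in the disc form
  -- a finite set.
  set T : Set P3 := {affPt xin (f2P K xin yin) (f3In K xin),
    affPt xin (f2P K xin yin) (-f3In K xin), affPt xin (-f2P K xin yin) (f3In K xin),
    affPt xin (-f2P K xin yin) (-f3In K xin)} with hT
  set Q : Set ℂ := {w | w ∈ ball (0 : ℂ) 1 ∧ xc (D.Φ w) = xin} with hQ
  have hmaps : MapsTo D.Φ Q T := by
    rintro w ⟨hw, hx⟩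
    have h3 : (D.Φ w).rep 3 ≠ 0 := fun e => h.x_ne (by rw [← hx, xc, e, div_zero])
    have e2 := f2_sq (D.mem w hw) h3
    have e3 := f3_sq (D.mem w hw) h3
    rw [hx, ← f2P_sq h] at e2
    rw [hx, ← f3In_sq h] at e3
    have hp : ∀ u v, f2 (D.Φ w) = u → f3 (D.Φ w) = v → D.Φ w = affPt xin u v := fun u v hu hv =>
      eq_of_finite_coords h3 (affPt_rep _ _ _) (by rw [hx, xc_affPt]) (by rw [hu, f2_affPt])
        (by rw [hv, f3_affPt])
    rcases sq_eq_sq_iff_eq_or_eq_neg.mp e2 with hu | hu <;>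
      rcases sq_eq_sq_iff_eq_or_eq_neg.mp e3 with hv | hv <;>
      simp [hT, hp _ _ hu hv]
  have hfin : Q.Finite := Set.Finite.of_injOn hmaps (D.inj.mono fun w hw => hw.1)
    (by rw [hT]; exact Set.toFinite _)
  have hcl : (Q \ {z})ᶜ ∈ 𝓝 z :=
    (hfin.subset sdiff_subset).isClosed.isOpen_compl.mem_nhds (by simp)
  filter_upwards [nhdsWithin_le_nhds hcl, self_mem_nhdsWithin,
    nhdsWithin_le_nhds (CoordDisc.eventually_mem hz)] with w h1 h2 h3 hx
  exact h1 ⟨⟨h3, hx⟩, h2⟩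

/-- The transformant has a limit at every point other than `p₁` and `p₄`. -/
theorem exists_tendsto_transformant (h : Incident K xin yin) (hz : z ∈ ball (0 : ℂ) 1)
    (h1 : D.Φ z ≠ p1 K xin yin) (h4 : D.Φ z ≠ p4 K xin yin) :
    ∃ b : ℂ, Tendsto (fun s => transformant K xin yin (D.Φ s)) (𝓝[≠] z) (𝓝 b) := by
  by_cases h3 : (D.Φ z).rep 3 = 0
  · obtain ⟨h0, e1, e2⟩ := H2_rep_of_inf (D.mem z hz) h3
    have hne1 : (D.Φ z).rep 1 ≠ 0 := fun e => h0 <| by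
      rw [e, zero_pow two_ne_zero] at e1; exact (pow_eq_zero_iff two_ne_zero).mp e1.symm
    have hne2 : (D.Φ z).rep 2 ≠ 0 := fun e => h0 <| by
      rw [e, zero_pow two_ne_zero] at e2; exact (pow_eq_zero_iff two_ne_zero).mp e2.symm
    have hr := D.analyticAt_ratio hz h0
    have hTd := CoordDisc.deriv_inv_xc_ne_zero hz h0 hne1 hne2
    have hT : (D.Φ z).rep 3 / (D.Φ z).rep 0 = 0 := by rw [h3, zero_div]
    -- At infinity numerator and denominator are multiplied by τ = x⁻¹; the denominator then tends
    -- to 4πi.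
    have hc : ContinuousAt (fun w => f3In K xin * (f2P K xin yin * ((D.Φ w).rep 3 / (D.Φ w).rep 0) +
        (D.Φ w).rep 1 / (D.Φ w).rep 0) /
          (4 * Real.pi * Complex.I * (1 - xin * ((D.Φ w).rep 3 / (D.Φ w).rep 0)))) z := by
      refine ContinuousAt.div ?_ ?_ ?_
      · exact continuousAt_const.mul ((continuousAt_const.mul (hr.1 3).continuousAt).add
          (hr.1 1).continuousAt)
      · exact continuousAt_const.mul
          (continuousAt_const.sub (continuousAt_const.mul (hr.1 3).continuousAt))
      · rw [hT, mul_zero, sub_zero, mul_one, mul_assoc 4]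
        exact mul_ne_zero (by norm_num) pi_I_ne
    refine ⟨_, hc.continuousWithinAt.tendsto.congr' ?_⟩
    have hne : ∀ᶠ w in 𝓝[≠] z, (D.Φ w).rep 3 / (D.Φ w).rep 0 ≠ 0 :=
      (hr.1 3).differentiableAt.hasDerivAt.eventually_ne hTd
    filter_upwards [hne, nhdsWithin_le_nhds hr.2] with w h5 h6
    have h7 : (D.Φ w).rep 3 ≠ 0 := left_ne_zero_of_mul h5
    have ex : xc (D.Φ w) - xin = (1 - xin * ((D.Φ w).rep 3 / (D.Φ w).rep 0)) *
        ((D.Φ w).rep 3 / (D.Φ w).rep 0)⁻¹ := by rw [xc]; field_simp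
    have ef : f2P K xin yin + f2 (D.Φ w) = (f2P K xin yin * ((D.Φ w).rep 3 / (D.Φ w).rep 0) +
        (D.Φ w).rep 1 / (D.Φ w).rep 0) * ((D.Φ w).rep 3 / (D.Φ w).rep 0)⁻¹ := by
      rw [f2]; field_simp
    rw [transformant_eq_f2P h, ex, ef, ← mul_assoc, ← mul_assoc,
      mul_div_mul_right _ _ (inv_ne_zero h5)]
  · refine ⟨_, (analyticAt_transformantReg h hz h3 h1 h4).continuousAt.continuousWithinAt.tendsto.congr'
      ?_⟩
    filter_upwards [eventually_nhdsNE_xc_ne h hz] with w hw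
    rw [transformantReg, if_neg hw]

/-! ### The residue theorem on `H₂` -/

theorem Jpt_injective (h : Incident K xin yin) : Function.Injective (Jpt K) := by
  have hc := f3Zero_ne h
  have key : ∀ i j : Fin 8, overZero i = overZero j → sgn2 i = sgn2 j → sgn3 i = sgn3 j → i = j := by
    decide
  intro i j hij
  rw [Jpt_eq, Jpt_eq] at hij
  by_cases hi : overZero i <;> by_cases hj : overZero j
  · rw [if_pos hi, if_pos hj] at hij
    have h2 := congrArg f2 hij
    have h3 := congrArg f3 hij
    rw [f2_affPt, f2_affPt] at h2
    rw [f3_affPt, f3_affPt] at h3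
    exact key i j (by rw [hi, hj]) (Int.cast_injective (mul_right_cancel₀ (inv_ne_zero hc) h2))
      (Int.cast_injective (mul_right_cancel₀ hc h3))
  · rw [if_pos hi, if_neg hj] at hij
    exact absurd (infPt_rep _ _) (by rw [← hij]; exact affPt_rep _ _ _)
  · rw [if_neg hi, if_pos hj] at hij
    exact absurd (infPt_rep _ _) (by rw [hij]; exact affPt_rep _ _ _)
  · rw [if_neg hi, if_neg hj] at hij
    have h2 := congrArg (fun p : P3 => p.rep 1 / p.rep 0) hij
    have h3 := congrArg (fun p : P3 => p.rep 2 / p.rep 0) hij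
    simp only [infPt, ratio_mk] at h2 h3
    simp only [Bool.not_eq_true] at hi hj
    exact key i j (by rw [hi, hj]) (by simpa using h2) (by simpa using h3)

/-- The infinity points and `p₁`, `p₄` as a family. -/
def markedPt (K xin yin : ℂ) : Fin 8 ⊕ Bool → P3
  | Sum.inl i => Jpt K i
  | Sum.inr true => p1 K xin yin
  | Sum.inr false => p4 K xin yin

/-- `2πi` times the residues of `w_{m,n} A Ψ`. -/
def markedRes (K xin yin : ℂ) (m n : ℤ) : Fin 8 ⊕ Bool → ℂ
  | Sum.inl i => resTerm K xin yin m n i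
  | Sum.inr true => -(xin ^ m * yin ^ n)
  | Sum.inr false => xin ^ m * yin⁻¹ ^ n

theorem marked_eq_range : marked K xin yin = range (markedPt K xin yin) := by
  ext p
  constructor
  · rintro (⟨i, rfl⟩ | rfl | rfl)
    · exact ⟨Sum.inl i, rfl⟩
    · exact ⟨Sum.inr true, rfl⟩
    · exact ⟨Sum.inr false, rfl⟩
  · rintro ⟨i | (_ | _), rfl⟩
    · exact Or.inl ⟨i, rfl⟩
    · exact Or.inr (Or.inr rfl)
    · exact Or.inr (Or.inl rfl)

/-- Over x = ∞ this is the default value of division by zero. It lets `xc` alone separate all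
infinity points from p₁ and p₄. -/
theorem xc_Jpt (K : ℂ) (i : Fin 8) : xc (Jpt K i) = 0 := by
  rw [Jpt_eq]
  split_ifs
  · exact xc_affPt _ _ _
  · rw [xc, infPt_rep, div_zero]

theorem p1_ne_p4 (h : Incident K xin yin) : p1 K xin yin ≠ p4 K xin yin := by
  intro e
  have := congrArg f3 e
  rw [p1_eq, p4_eq, f3_affPt, f3_affPt] at this
  exact f3In_ne h h.x_lt.le (by linear_combination -this / 2)

theorem markedPt_injective (h : Incident K xin yin) : Function.Injective (markedPt K xin yin) := by
  have hx := h.x_ne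
  have e1 : xc (p1 K xin yin) = xin := xc_affPt _ _ _
  have e4 : xc (p4 K xin yin) = xin := xc_affPt _ _ _
  have hJ1 : ∀ i, Jpt K i ≠ p1 K xin yin := fun i e => by
    have := congrArg xc e; rw [xc_Jpt, e1] at this; exact hx this.symm
  have hJ4 : ∀ i, Jpt K i ≠ p4 K xin yin := fun i e => by
    have := congrArg xc e; rw [xc_Jpt, e4] at this; exact hx this.symm
  have h14 := p1_ne_p4 h
  rintro (i | (_ | _)) (j | (_ | _)) e
  · exact congrArg Sum.inl (Jpt_injective h e)
  · exact absurd e (hJ4 i)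
  · exact absurd e (hJ1 i)
  · exact absurd e.symm (hJ4 j)
  · rfl
  · exact absurd e.symm h14
  · exact absurd e.symm (hJ1 j)
  · exact absurd e h14
  · rfl

theorem exists_sign {a b : ℂ} (h : a ^ 2 = b ^ 2) : ∃ s : ℤ, (s = 1 ∨ s = -1) ∧ a = s * b := by
  rcases sq_eq_sq_iff_eq_or_eq_neg.mp h with e | e
  · exact ⟨1, Or.inl rfl, by simp [e]⟩
  · exact ⟨-1, Or.inr rfl, by simp [e]⟩

/-- The points of `H₂` over `x = 0` and `x = ∞` are the eight infinity points. -/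
theorem mem_range_Jpt (h : Incident K xin yin) {p : P3} (hp : p ∈ H2 K)
    (hx : p.rep 3 = 0 ∨ xc p = 0) : p ∈ range (Jpt K) := by
  -- The eight infinity points exhaust the choices of zero or infinity and of the two signs.
  have key : ∀ b : Bool, ∀ s ∈ ({1, -1} : Finset ℤ), ∀ t ∈ ({1, -1} : Finset ℤ), ∃ i : Fin 8,
      overZero i = b ∧ sgn2 i = s ∧ sgn3 i = t := by decide
  by_cases h3 : p.rep 3 = 0
  · obtain ⟨h0, e1, e2⟩ := H2_rep_of_inf hp h3
    obtain ⟨s, hs, es⟩ := exists_sign e1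
    obtain ⟨t, ht, et⟩ := exists_sign e2
    obtain ⟨i, hi, his, hit⟩ := key false s (by simpa using hs) t (by simpa using ht)
    refine ⟨i, ?_⟩
    rw [Jpt_eq, hi, his, hit, if_neg (by simp)]
    refine eq_of_ratio_eq 0 (infPt_rep_zero _ _) h0 fun j => ?_
    rw [infPt, ratio_mk]
    fin_cases j
    · simp [h0]
    · simp [es, h0]
    · simp [et, h0]
    · simp [h3]
  · have hx := hx.resolve_left h3
    have e1 := f2_sq hp h3
    have e2 := f3_sq hp h3
    rw [hx, zero_sub, zero_sub, neg_mul_neg] at e1 e2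
    rw [← f3Zero_inv_sq h] at e1
    rw [← f3Zero_sq h] at e2
    obtain ⟨s, hs, es⟩ := exists_sign e1
    obtain ⟨t, ht, et⟩ := exists_sign e2
    obtain ⟨i, hi, his, hit⟩ := key true s (by simpa using hs) t (by simpa using ht)
    refine ⟨i, ?_⟩
    rw [Jpt_eq, hi, his, hit, if_pos rfl]
    exact eq_of_finite_coords (affPt_rep _ _ _) h3 (by rw [xc_affPt, hx]) (by rw [f2_affPt, es])
      (by rw [f3_affPt, et])

theorem regular_of_notMem (h : Incident K xin yin) (hz : z ∈ ball (0 : ℂ) 1)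
    (hm : D.Φ z ∉ range (Jpt K)) : D.Regular z :=
  ⟨hz, fun e => hm (mem_range_Jpt h (D.mem z hz) (Or.inl e)),
    fun e => hm (mem_range_Jpt h (D.mem z hz) (Or.inr e))⟩

/-- s = 1 gives y = y_in, the case of p₁, and s = -1 gives y = y_in⁻¹, the case of p₄. -/
theorem yc_affPt (h : Incident K xin yin) {u v s : ℂ} (huv : u * v = s * (xin * (yin - yin⁻¹))) :
    yc K (affPt xin u v) = ((yin + yin⁻¹) + s * (yin - yin⁻¹)) / 2 := by
  have hx := h.x_ne
  rw [yc, f1, xc_affPt, f2_affPt, f3_affPt, huv, h.add_inv]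
  field_simp

theorem wave_p1 (h : Incident K xin yin) (m n : ℤ) :
    wave K m n (p1 K xin yin) = xin ^ m * yin ^ n := by
  rw [wave, p1_eq, yc_affPt h (s := 1) (by linear_combination -f3In_mul_f2P h), xc_affPt]
  congr 2; ring

theorem wave_p4 (h : Incident K xin yin) (m n : ℤ) :
    wave K m n (p4 K xin yin) = xin ^ m * yin⁻¹ ^ n := by
  rw [wave, p4_eq, yc_affPt h (s := -1) (by linear_combination f3In_mul_f2P h), xc_affPt]
  congr 2; ring

theorem hasRes_marked (h : Incident K xin yin) (m n : ℤ) (ha : a ∈ ball (0 : ℂ) 1)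
    (i : Fin 8 ⊕ Bool) (hai : D.Φ a = markedPt K xin yin i) :
    HasRes (fun z => wave K m n (D.Φ z) * transformant K xin yin (D.Φ z) * psi K D.Φ z) a
      ((2 * Real.pi * Complex.I)⁻¹ * markedRes K xin yin m n i) := by
  have hf := f3In_ne h h.x_lt.le
  have simple : ∀ v, D.Φ a = affPt xin (f2P K xin yin) v →
      HasRes (fun z => wave K m n (D.Φ z) * transformant K xin yin (D.Φ z) * psi K D.Φ z) a
        (wave K m n (D.Φ a) * ((2 * Real.pi * Complex.I)⁻¹ * (f3In K xin / v))) := by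
    intro v hv
    obtain ⟨κ, hκ, hκa, he⟩ := exists_simple_pole h ha hv
    have hreg : D.Regular a := ⟨ha, by rw [hv]; exact affPt_rep _ _ _, by
      rw [hv, xc_affPt]; exact h.x_ne⟩
    have := hasRes_simple_pole ((hreg.analyticAt_wave m n).mul hκ)
    simp only [Pi.mul_apply, hκa] at this
    refine this.congr ?_
    filter_upwards [he] with z hz
    rw [mul_assoc, hz, mul_assoc]
  rcases i with i | (_ | _)
  · exact hasRes_Jpt h m n ha i hai
  · have := simple _ hai
    rw [hai, markedPt, wave_p4 h, div_self hf, mul_one, mul_comm] at this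
    exact this
  · have := simple _ hai
    rw [hai, markedPt, wave_p1 h, div_neg, div_self hf, mul_neg_one, mul_neg, mul_comm, ← mul_neg]
      at this
    exact this

end

/-- Shows that the parameters at which a curve crosses a removable singularity with nonzero velocity
are negligible for the integral. -/
theorem countable_setOf_isolated_in {B : Set ℝ} (hB : ∀ t ∈ B, ∀ᶠ s in 𝓝[≠] t, s ∉ B) :
    B.Countable := by
  refine Set.Countable.mono (fun t ht => ?_) (countable_setOfPred_isolated_right_within (s := B))
  refine ⟨ht, ?_⟩
  rw [← Filter.empty_mem_iff_bot]
  have h1 : ∀ᶠ s in 𝓝[B ∩ Ioi t] t, s ∉ B :=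
    nhdsWithin_mono t (fun s hs => ne_of_gt hs.2) (hB t ht)
  filter_upwards [h1, self_mem_nhdsWithin] with s h2 h3 using h2 h3.1

section
variable {K xin yin : ℂ}

theorem Loop.winding_eq (L : Loop K) {z : ℂ} (hz : z ∈ ball (0 : ℂ) 1) {p : P3} (hp : L.Φ z = p) :
    L.winding p = (2 * Real.pi * Complex.I)⁻¹ * ∫ t in (0 : ℝ)..1, deriv L.γ t / (L.γ t - z) := by
  have : {w ∈ ball (0 : ℂ) 1 | L.Φ w = p} = {z} := by
    ext w
    constructor
    · rintro ⟨h1, h2⟩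
      exact L.inj h1 hz (by rw [h2, hp])
    · rintro rfl
      exact ⟨hz, hp⟩
  rw [Loop.winding, this, finsum_mem_singleton]

theorem Loop.winding_eq_zero (L : Loop K) {p : P3} (hp : ∀ z ∈ ball (0 : ℂ) 1, L.Φ z ≠ p) :
    L.winding p = 0 := by
  have : {w ∈ ball (0 : ℂ) 1 | L.Φ w = p} = ∅ := by
    ext w
    simp only [mem_empty_iff_false, iff_false]
    rintro ⟨h1, h2⟩
    exact hp w h1 h2
  rw [Loop.winding, this, finsum_mem_empty]

/-- The integral along a loop, with the removable singularities of the integrand removed. -/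
theorem Loop.integral_eq_reg (h : Incident K xin yin) (L : Loop K)
    (hL : ∀ t ∈ Icc (0 : ℝ) 1, L.Φ (L.γ t) ∉ marked K xin yin) (m n : ℤ) :
    L.integral xin yin m n = ∫ t in (0 : ℝ)..1,
      (wave K m n (L.Φ (L.γ t)) * transformantReg K xin yin (L.Φ (L.γ t)) *
        psi K L.Φ (L.γ t)) * deriv L.γ t := by
  have hdγ : Differentiable ℝ L.γ := L.smooth.differentiable one_ne_zero
  have hreg : ∀ t ∈ Icc (0 : ℝ) 1, L.toCoordDisc.Regular (L.γ t) := fun t ht =>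
    regular_of_notMem h (L.inside t ht) fun hm => hL t ht (Or.inl hm)
  -- `transformant` has a default value at the regular points over x_in, so the integrand may be
  -- wrong there. Passages with nonzero velocity are isolated, hence form a null set; with zero
  -- velocity both integrands vanish.
  set B : Set ℝ := {t | t ∈ Icc (0 : ℝ) 1 ∧ xc (L.Φ (L.γ t)) = xin ∧ deriv L.γ t ≠ 0} with hB
  have hcount : B.Countable := by
    refine countable_setOf_isolated_in fun t ht => ?_
    obtain ⟨ht1, ht2, ht3⟩ := ht
    have hr := hreg t ht1
    have hd := deriv_xc_ne_zero_of_xc_eq h hr.1 hr.2.1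
      (fun e => hL t ht1 (Or.inr (Or.inl e))) (fun e => hL t ht1 (Or.inr (Or.inr e))) ht2
    have hx := (CoordDisc.analyticAt_xc hr.1 hr.2.1).differentiableAt.hasDerivAt
    have hcomp := hx.comp_of_eq t (hdγ t).hasDerivAt rfl
    filter_upwards [hcomp.eventually_ne (c := xin) (mul_ne_zero hd ht3)] with s hs hsB
    exact hs hsB.2.1
  rw [Loop.integral]
  refine intervalIntegral.integral_congr_ae ?_
  have hae : ∀ᵐ t : ℝ, t ∉ B := hcount.ae_notMem _
  filter_upwards [hae] with t htB ht
  rw [uIoc_of_le zero_le_one] at ht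
  have ht' : t ∈ Icc (0 : ℝ) 1 := Ioc_subset_Icc_self ht
  rw [(hreg t ht').psi_comp (hdγ t)]
  by_cases hx : xc (L.Φ (L.γ t)) = xin
  · have : deriv L.γ t = 0 := by
      by_contra hne
      exact htB ⟨ht', hx, hne⟩
    rw [this]; ring
  · rw [transformantReg, if_neg hx]; ring

/-- The residue theorem of the disc is applied to the marked points with a preimage in it. The other
marked points have winding number zero, so the sum may run over all of them. -/
theorem Loop.integral_eq_sum (h : Incident K xin yin) (L : Loop K)
    (hL : ∀ t ∈ Icc (0 : ℝ) 1, L.Φ (L.γ t) ∉ marked K xin yin) (m n : ℤ) :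
    L.integral xin yin m n =
      ∑ i, markedRes K xin yin m n i * L.winding (markedPt K xin yin i) := by
  classical
  have hinj := markedPt_injective h
  set T : Finset (Fin 8 ⊕ Bool) :=
    Finset.univ.filter fun i => ∃ z ∈ ball (0 : ℂ) 1, L.Φ z = markedPt K xin yin i with hT
  have hex : ∀ i, ∃ z, i ∈ T → z ∈ ball (0 : ℂ) 1 ∧ L.Φ z = markedPt K xin yin i := fun i => by
    by_cases hi : i ∈ T
    · obtain ⟨z, h1, h2⟩ := (Finset.mem_filter.mp hi).2
      exact ⟨z, fun _ => ⟨h1, h2⟩⟩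
    · exact ⟨0, fun hc => absurd hc hi⟩
  choose zf hzf using hex
  have hzinj : Set.InjOn zf T := fun i hi j hj e => hinj (by
    rw [← (hzf i hi).2, ← (hzf j hj).2, e])
  set r : ℂ → ℂ := fun z => (2 * Real.pi * Complex.I)⁻¹ *
    markedRes K xin yin m n (Function.invFun (markedPt K xin yin) (L.Φ z)) with hr
  have hrz : ∀ i ∈ T, r (zf i) = (2 * Real.pi * Complex.I)⁻¹ * markedRes K xin yin m n i := by
    intro i hi
    simp only [hr]
    rw [(hzf i hi).2, Function.leftInverse_invFun hinj]
  have hnot : ∀ z ∈ ball (0 : ℂ) 1, z ∉ T.image zf → L.Φ z ∉ marked K xin yin := by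
    intro z hz hzS hm
    rw [marked_eq_range] at hm
    obtain ⟨i, hi⟩ := hm
    have hiT : i ∈ T := Finset.mem_filter.mpr ⟨Finset.mem_univ i, z, hz, hi.symm⟩
    exact hzS (Finset.mem_image.mpr ⟨i, hiT, L.inj (hzf i hiT).1 hz (by rw [(hzf i hiT).2, hi])⟩)
  rw [L.integral_eq_reg h hL, integral_eq_sum_residues L.smooth L.closed L.inside r (T.image zf)
    (fun z => wave K m n (L.Φ z) * transformantReg K xin yin (L.Φ z) * psi K L.Φ z) ?_ ?_ ?_,
    Finset.sum_image hzinj]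
  · rw [← Finset.sum_subset (Finset.subset_univ T)]
    · refine Finset.sum_congr rfl fun i hi => ?_
      rw [hrz i hi, L.winding_eq (hzf i hi).1 (hzf i hi).2]
      ring
    · intro i _ hi
      rw [L.winding_eq_zero, mul_zero]
      intro z hz e
      exact hi (Finset.mem_filter.mpr ⟨Finset.mem_univ i, z, hz, e⟩)
  · intro z hz hzS
    have hm := hnot z hz hzS
    have hreg : L.toCoordDisc.Regular z := regular_of_notMem h hz fun hm' => hm (Or.inl hm')
    exact ((hreg.analyticAt_wave m n).mul (analyticAt_transformantReg h hz hreg.2.1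
      (fun e => hm (Or.inr (Or.inl e))) (fun e => hm (Or.inr (Or.inr e))))).mul
      (hreg.analyticAt_psi h)
  · intro z hz
    obtain ⟨i, hi, rfl⟩ := Finset.mem_image.mp hz
    rw [hrz i hi]
    refine (hasRes_marked h m n (hzf i hi).1 i (hzf i hi).2).congr ?_
    filter_upwards [eventually_nhdsNE_xc_ne h (hzf i hi).1] with w hw
    rw [transformantReg, if_neg hw]
  · intro t ht hm
    obtain ⟨i, hi, e⟩ := Finset.mem_image.mp hm
    exact hL t ht (by rw [marked_eq_range, ← e]; exact ⟨i, (hzf i hi).2.symm⟩)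

end

end

end HalfLine

namespace HalfLine

noncomputable section

/-! ### Contours -/

section
variable {K xin yin : ℂ}

theorem Contour.integral_eq_sum (h : Incident K xin yin) (m n : ℤ) (c : Contour K)
    (hc : ∀ L ∈ c, ∀ t ∈ Icc (0 : ℝ) 1, L.Φ (L.γ t) ∉ marked K xin yin) :
    c.integral xin yin m n =
      ∑ i, markedRes K xin yin m n i * c.winding (markedPt K xin yin i) := by
  induction c with
  | nil => simp [Contour.integral, Contour.winding]
  | cons L c ih =>
    have h1 := L.integral_eq_sum h (hc L (by simp)) m n
    have h2 := ih fun L' hL' => hc L' (by simp [hL'])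
    simp only [Contour.integral, Contour.winding, List.map_cons, List.sum_cons] at h2 ⊢
    rw [h1, h2, ← Finset.sum_add_distrib]
    exact Finset.sum_congr rfl fun i _ => by ring

theorem Contour.Encircles.integral_eq (h : Incident K xin yin) {c : Contour K}
    {s : Finset (Fin 8)} (hc : c.Encircles xin yin (Jpt K '' s)) (m n : ℤ) :
    c.integral xin yin m n = ∑ i ∈ s, resTerm K xin yin m n i := by
  classical
  have hinj := markedPt_injective h
  have hm : ∀ i, markedPt K xin yin i ∈ marked K xin yin := fun i => by
    rw [marked_eq_range]; exact ⟨i, rfl⟩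
  have hw : ∀ b, c.winding (markedPt K xin yin (Sum.inr b)) = 0 := fun b => by
    refine hc.2.2 _ (hm _) ?_
    rintro ⟨i, _, e⟩
    exact absurd (hinj (a₁ := Sum.inl i) (a₂ := Sum.inr b) e) (by simp)
  have hJ : ∀ i, c.winding (Jpt K i) = if i ∈ s then 1 else 0 := fun i => by
    split_ifs with hi
    · exact hc.2.1 _ (hm (Sum.inl i)) ⟨i, hi, rfl⟩
    · refine hc.2.2 _ (hm (Sum.inl i)) ?_
      rintro ⟨k, hk, e⟩
      exact hi (Jpt_injective h e ▸ hk)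
  rw [c.integral_eq_sum h m n hc.1, Fintype.sum_sum_type]
  simp only [hw, mul_zero, Finset.sum_const_zero, add_zero]
  simp only [markedPt, markedRes, hJ, mul_ite, mul_zero, mul_one, Finset.sum_ite_mem,
    Finset.univ_inter]

theorem Contour.Encircles.integral_eq_single (h : Incident K xin yin) {c : Contour K} {i : Fin 8}
    (hc : c.Encircles xin yin {Jpt K i}) (m n : ℤ) :
    c.integral xin yin m n = resTerm K xin yin m n i := by
  have : c.Encircles xin yin (Jpt K '' (({i} : Finset (Fin 8)) : Set (Fin 8))) := by simpa using hc
  rw [this.integral_eq h, Finset.sum_singleton]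

/-- The sum of the residues encircled by the contour number `j`. -/
def resSum (K xin yin : ℂ) (j : Fin 8) (m n : ℤ) : ℂ :=
  resTerm K xin yin m n (j + 1) + resTerm K xin yin m n (j + 2) +
    resTerm K xin yin m n (j + 3) + resTerm K xin yin m n (j + 4)

theorem Contour.IsGamma.integral_eq (h : Incident K xin yin) {c : Contour K} {j : Fin 8}
    (hc : c.IsGamma xin yin j) (m n : ℤ) :
    c.integral xin yin m n = resSum K xin yin j m n := by
  have : c.Encircles xin yin
      (Jpt K '' (({j + 1, j + 2, j + 3, j + 4} : Finset (Fin 8)) : Set (Fin 8))) := by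
    have e : Jpt K '' (({j + 1, j + 2, j + 3, j + 4} : Finset (Fin 8)) : Set (Fin 8)) =
      {Jpt K (j + 1), Jpt K (j + 2), Jpt K (j + 3), Jpt K (j + 4)} := by
      simp [Set.image_insert_eq]
    rw [e]; exact hc
  have d : ∀ j : Fin 8, j + 1 ∉ ({j + 2, j + 3, j + 4} : Finset (Fin 8)) ∧
      j + 2 ∉ ({j + 3, j + 4} : Finset (Fin 8)) ∧ j + 3 ∉ ({j + 4} : Finset (Fin 8)) := by decide
  rw [this.integral_eq h, Finset.sum_insert (d j).1, Finset.sum_insert (d j).2.1,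
    Finset.sum_insert (d j).2.2, Finset.sum_singleton, resSum]
  ring

/-- A small circle in a coordinate disc about an infinity point. -/
theorem exists_loop_of_disc (D : CoordDisc K) (i : Fin 8)
    (hD : D.Φ 0 = Jpt K i) (h0 : ∀ z ∈ ball (0 : ℂ) 1, xc (D.Φ z) = 0 → z = 0)
    (hx : ∀ z ∈ ball (0 : ℂ) 1, xc (D.Φ z) ≠ xin) :
    ∃ L : Loop K, (∀ t ∈ Icc (0 : ℝ) 1, L.Φ (L.γ t) ∉ marked K xin yin) ∧
      ∀ p ∈ marked K xin yin, L.winding p = open Classical in if p = Jpt K i then 1 else 0 := by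
  have hb : ∀ t, circ 0 (1 / 2) t ∈ ball (0 : ℂ) 1 := fun t => by
    have := circ_mem_sphere 0 (ρ := 1 / 2) (by norm_num) t
    rw [mem_sphere] at this
    rw [mem_ball, this]; norm_num
  have hne : ∀ t, circ 0 (1 / 2) t ≠ 0 := fun t e => by
    have := circ_mem_sphere 0 (ρ := 1 / 2) (by norm_num) t
    rw [mem_sphere, e, dist_self] at this
    norm_num at this
  let L : Loop K := { D with
    γ := circ 0 (1 / 2)
    smooth := circ_contDiff 0 _
    closed := circ_closed 0 _
    inside := fun t _ => hb t }
  have hmark : ∀ z ∈ ball (0 : ℂ) 1, D.Φ z ∈ marked K xin yin → z = 0 := by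
    rintro z hz (⟨k, hk⟩ | e | e)
    · exact h0 z hz (by rw [← hk, xc_Jpt])
    · exact absurd (by rw [e, p1_eq, xc_affPt]) (hx z hz)
    · exact absurd (by rw [e, p4_eq, xc_affPt]) (hx z hz)
  refine ⟨L, fun t _ hm => hne t (hmark _ (hb t) hm), fun p hp => ?_⟩
  split_ifs with hpi
  · rw [L.winding_eq (z := 0) (by simp) (hD.trans hpi.symm)]
    have : ∫ t in (0 : ℝ)..1, deriv L.γ t / (L.γ t - 0) = 2 * Real.pi * Complex.I :=
      winding_circ (by simp)
    rw [this, inv_mul_cancel₀ Complex.two_pi_I_ne_zero]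
  · refine L.winding_eq_zero fun z hz e => hpi ?_
    have e : D.Φ z = p := e
    have := hmark z hz (by rw [e]; exact hp)
    rw [← e, this, hD]

theorem analyticAt_vec4 {g₀ g₁ g₂ g₃ : ℂ → ℂ} {z : ℂ} (h₀ : AnalyticAt ℂ g₀ z)
    (h₁ : AnalyticAt ℂ g₁ z) (h₂ : AnalyticAt ℂ g₂ z) (h₃ : AnalyticAt ℂ g₃ z) :
    AnalyticAt ℂ (fun w => ![g₀ w, g₁ w, g₂ w, g₃ w]) z := by
  refine AnalyticAt.pi fun j => ?_
  fin_cases j <;> assumption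

theorem norm_mul_lt_one {a x : ℂ} {r : ℝ} (ha : ‖a‖ * r ≤ 1) (hx : ‖x‖ < r) :
    ‖a * x‖ < 1 := by
  rw [norm_mul]
  rcases eq_or_lt_of_le (norm_nonneg a) with h0 | h0
  · rw [← h0, zero_mul]; exact one_pos
  · exact lt_of_lt_of_le (mul_lt_mul_of_pos_left hx h0) ha

theorem exists_loop_Jpt (h : Incident K xin yin) (i : Fin 8) :
    ∃ L : Loop K, (∀ t ∈ Icc (0 : ℝ) 1, L.Φ (L.γ t) ∉ marked K xin yin) ∧
      ∀ p ∈ marked K xin yin, L.winding p = open Classical in if p = Jpt K i then 1 else 0 := by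
  -- In either coordinate, x near 0 or τ = x⁻¹ near 0, the nearest branch points have modulus at
  -- least |η₂₁| or |η₂₂|. The bound by |x_in| < 1 keeps p₁ and p₄ out of every such disc.
  set r : ℝ := min ‖xin‖ (min ‖eta21 K‖ ‖eta22 K‖)
  have hr0 : 0 < r := lt_min (norm_pos_iff.mpr h.x_ne)
    (lt_min (norm_pos_iff.mpr (eta21_ne K)) (norm_pos_iff.mpr (eta22_ne K)))
  have hr1 : r ≤ ‖xin‖ := min_le_left _ _
  have hr2 : r ≤ ‖eta21 K‖ := (min_le_right _ _).trans (min_le_left _ _)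
  have hr3 : r ≤ ‖eta22 K‖ := (min_le_right _ _).trans (min_le_right _ _)
  have hrlt : r < 1 := hr1.trans_lt h.x_lt
  have b11 : ‖eta11 K‖ * r ≤ 1 := by
    rw [eta11_eq, norm_inv, inv_mul_le_iff₀ (norm_pos_iff.mpr (eta21_ne K)), mul_one]; exact hr2
  have b12 : ‖eta12 K‖ * r ≤ 1 := by
    rw [eta12_eq, norm_inv, inv_mul_le_iff₀ (norm_pos_iff.mpr (eta22_ne K)), mul_one]; exact hr3
  have b21 : ‖eta21 K‖ * r ≤ 1 := by nlinarith [h.norm_eta21, norm_nonneg (eta21 K)]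
  have b22 : ‖eta22 K‖ * r ≤ 1 := by nlinarith [h.norm_eta22, norm_nonneg (eta22 K)]
  have hrz : ∀ z ∈ ball (0 : ℂ) 1, ‖(r : ℂ) * z‖ < r := fun z hz => by
    rw [mem_ball_zero_iff] at hz
    rw [norm_mul, Complex.norm_real, Real.norm_of_nonneg hr0.le]
    nlinarith
  have hrc : (r : ℂ) ≠ 0 := Complex.ofReal_ne_zero.mpr hr0.ne'
  have hlin : ∀ z, AnalyticAt ℂ (fun w : ℂ => (r : ℂ) * w) z := fun z => by fun_prop
  have hg2 : ∀ z ∈ ball (0 : ℂ) 1, AnalyticAt ℂ (fun w => gInf2 K (r * w)) z := fun z hz =>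
    AnalyticAt.fun_comp (g := gInf2 K) (analyticAt_gInf2 (norm_mul_lt_one b21 (hrz z hz))
      (norm_mul_lt_one b22 (hrz z hz))) (hlin z)
  have hg3 : ∀ z ∈ ball (0 : ℂ) 1, AnalyticAt ℂ (fun w => gInf3 K (r * w)) z := fun z hz =>
    AnalyticAt.fun_comp (g := gInf3 K) (analyticAt_gInf3 (norm_mul_lt_one b11 (hrz z hz))
      (norm_mul_lt_one b12 (hrz z hz))) (hlin z)
  by_cases hi : overZero i
  · let D : CoordDisc K :=
      { Φ := fun z => affPt (r * z) (sgn2 i * f2In K (r * z)) (sgn3 i * f3In K (r * z))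
        hol := fun z hz => ⟨fun w => ![r * w, sgn2 i * f2In K (r * w), sgn3 i * f3In K (r * w), 1],
          analyticAt_vec4 (hlin z) (analyticAt_const.mul (analyticAt_const.mul (hg3 z hz)))
            (analyticAt_const.mul (by
              simp only [f3In_eq]; exact analyticAt_const.mul (hg2 z hz))) analyticAt_const,
          Eventually.of_forall fun w => ⟨fun e => one_ne_zero (congrFun e 3), rfl⟩⟩
        mem := fun z _ => mk_mem_H2 _
          (by simp [mul_pow, sgn2_sq, f2In_sq h]) (by simp [mul_pow, sgn3_sq, f3In_sq h])
        inj := fun z _ w _ e => by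
          have := congrArg xc e
          simp only [xc_affPt] at this
          exact mul_left_cancel₀ hrc this }
    refine exists_loop_of_disc D i ?_ (fun z _ e => ?_) (fun z hz e => ?_)
    · rw [Jpt_eq, if_pos hi]
      simp [D, f2In_zero, f3In_zero]
    · have e : xc (affPt (r * z) (sgn2 i * f2In K (r * z)) (sgn3 i * f3In K (r * z))) = 0 := e
      rw [xc_affPt] at e
      exact (mul_eq_zero.mp e).resolve_left hrc
    · have e : xc (affPt (r * z) (sgn2 i * f2In K (r * z)) (sgn3 i * f3In K (r * z))) = xin := e
      rw [xc_affPt] at e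
      have := hrz z hz
      rw [e] at this
      exact absurd this (not_lt.mpr hr1)
  · have hv : ∀ z : ℂ, (![1, sgn2 i * gInf2 K (r * z), sgn3 i * gInf3 K (r * z), r * z] :
        Fin 4 → ℂ) ≠ 0 := fun z e => one_ne_zero (congrFun e 0)
    have hxc : ∀ z : ℂ, xc (Projectivization.mk ℂ _ (hv z)) = (r * z)⁻¹ := fun z => by
      rw [xc, ratio_mk]; simp
    let D : CoordDisc K :=
      { Φ := fun z => Projectivization.mk ℂ _ (hv z)
        hol := fun z hz => ⟨_, analyticAt_vec4 analyticAt_const (analyticAt_const.mul (hg2 z hz))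
            (analyticAt_const.mul (hg3 z hz)) (hlin z),
          Eventually.of_forall fun w => ⟨hv w, rfl⟩⟩
        mem := fun z _ => mk_mem_H2 _
          (by simp [mul_pow, sgn2_sq, gInf2_sq]) (by simp [mul_pow, sgn3_sq, gInf3_sq])
        inj := fun z _ w _ e => by
          have := congrArg xc e
          simp only [hxc] at this
          -- `xc` is (r z)⁻¹, and inversion is injective on all of ℂ with 0⁻¹ = 0, so the centre
          -- needs no separate case.
          exact mul_left_cancel₀ hrc (inv_injective this) }
    refine exists_loop_of_disc D i ?_ (fun z _ e => ?_) (fun z hz e => ?_)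
    · rw [Jpt_eq, if_neg hi]
      simp [D, infPt, gInf2_zero, gInf3_zero]
    · have e : xc (Projectivization.mk ℂ _ (hv z)) = 0 := e
      rw [hxc] at e
      exact (mul_eq_zero.mp (inv_eq_zero.mp e)).resolve_left hrc
    · have e : xc (Projectivization.mk ℂ _ (hv z)) = xin := e
      rw [hxc] at e
      have h1 := hrz z hz
      have h2 : (r : ℂ) * z = xin⁻¹ := by rw [← e, inv_inv]
      rw [h2, norm_inv] at h1
      have h3 := (one_lt_inv₀ (norm_pos_iff.mpr h.x_ne)).mpr h.x_lt
      linarith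

/-- Only winding numbers are prescribed, so four small circles about the four infinity points form
such a contour. -/
theorem exists_isGamma (h : Incident K xin yin) (j : Fin 8) :
    ∃ c : Contour K, c.IsGamma xin yin j := by
  classical
  choose L hL using exists_loop_Jpt h
  have hinj := Jpt_injective h
  refine ⟨[L (j + 1), L (j + 2), L (j + 3), L (j + 4)], ?_, ?_, ?_⟩
  · intro L' hL'
    simp only [List.mem_cons, List.not_mem_nil, or_false] at hL'
    rcases hL' with rfl | rfl | rfl | rfl
    · exact (hL _).1
    · exact (hL _).1
    · exact (hL _).1
    · exact (hL _).1
  · have d : ∀ j : Fin 8, j + 1 ≠ j + 2 ∧ j + 1 ≠ j + 3 ∧ j + 1 ≠ j + 4 ∧ j + 2 ≠ j + 3 ∧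
        j + 2 ≠ j + 4 ∧ j + 3 ≠ j + 4 := by decide
    obtain ⟨d1, d2, d3, d4, d5, d6⟩ := d j
    intro p hp hS
    simp only [Contour.winding, List.map_cons, List.map_nil, List.sum_cons, List.sum_nil,
      (hL _).2 p hp]
    rcases hS with rfl | rfl | rfl | rfl
    · simp [hinj.eq_iff, d1, d2, d3]
    · simp [hinj.eq_iff, d1.symm, d4, d5]
    · simp [hinj.eq_iff, d2.symm, d4.symm, d6]
    · simp [hinj.eq_iff, d3.symm, d5.symm, d6.symm]
  · intro p hp hS
    simp only [Contour.winding, List.map_cons, List.map_nil, List.sum_cons, List.sum_nil,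
      (hL _).2 p hp]
    simp only [mem_insert_iff, mem_singleton_iff, not_or] at hS
    simp [hS]

end

end

end HalfLine

namespace HalfLine

noncomputable section

/-! ### The branches on the unit circle -/

section
variable {K xin yin : ℂ}

/-- The branch of `f₂` outside the unit circle, equivalent to `x` at infinity. -/
def f2Out (K x : ℂ) : ℂ := x * gInf2 K x⁻¹

/-- The analytic continuation of `Ξ` from the unit circle. -/
def XiCont (K x : ℂ) : ℂ := (4 - K ^ 2 - x - x⁻¹ + f2Out K x * f3In K x / x) / 2

theorem f2Out_sq {x : ℂ} (hx : x ≠ 0) : f2Out K x ^ 2 = (x - eta21 K) * (x - eta22 K) := by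
  rw [f2Out, mul_pow, gInf2_sq]; field_simp

theorem XiCont_mul (h : Incident K xin yin) {x : ℂ} (hx : x ≠ 0) :
    XiCont K x * ((4 - K ^ 2 - x - x⁻¹ - f2Out K x * f3In K x / x) / 2) = 1 := by
  have h1 : (f2Out K x * f3In K x) ^ 2 = ((4 - K ^ 2) * x - 1 - x ^ 2) ^ 2 - 4 * x ^ 2 := by
    rw [← quadrics_mul, mul_pow, f2Out_sq hx, f3In_sq h]
  rw [XiCont]
  field_simp
  linear_combination -h1

theorem XiCont_ne_zero (h : Incident K xin yin) {x : ℂ} (hx : x ≠ 0) : XiCont K x ≠ 0 :=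
  left_ne_zero_of_mul_eq_one (XiCont_mul h hx)

theorem XiCont_inv (h : Incident K xin yin) {x : ℂ} (hx : x ≠ 0) :
    (XiCont K x)⁻¹ = (4 - K ^ 2 - x - x⁻¹ - f2Out K x * f3In K x / x) / 2 :=
  (eq_inv_of_mul_eq_one_right (XiCont_mul h hx)).symm

theorem XiCont_add_inv (h : Incident K xin yin) {x : ℂ} (hx : x ≠ 0) :
    XiCont K x + (XiCont K x)⁻¹ = 4 - K ^ 2 - x - x⁻¹ := by
  rw [XiCont_inv h hx, XiCont]; ring

/-- The annulus about the unit circle free of branch points. -/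
def InAnnulus (K x : ℂ) : Prop :=
  x ≠ 0 ∧ ‖eta21 K * x‖ < 1 ∧ ‖eta22 K * x‖ < 1 ∧ ‖eta21 K * x⁻¹‖ < 1 ∧ ‖eta22 K * x⁻¹‖ < 1

theorem Incident.inAnnulus (h : Incident K xin yin) {x : ℂ} (hx : ‖x‖ = 1) : InAnnulus K x := by
  have h1 := h.norm_eta21
  have h2 := h.norm_eta22
  exact ⟨norm_pos_iff.mp (by rw [hx]; exact one_pos), by simpa [hx] using h1, by simpa [hx] using h2,
    by simpa [hx] using h1, by simpa [hx] using h2⟩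

theorem InAnnulus.eventually {x : ℂ} (hx : InAnnulus K x) : ∀ᶠ z in 𝓝 x, InAnnulus K z := by
  have hi : ContinuousAt (fun z : ℂ => z⁻¹) x := continuousAt_inv₀ hx.1
  have c1 : ContinuousAt (fun z : ℂ => ‖eta21 K * z‖) x := by fun_prop
  have c2 : ContinuousAt (fun z : ℂ => ‖eta22 K * z‖) x := by fun_prop
  have c3 : ContinuousAt (fun z : ℂ => ‖eta21 K * z⁻¹‖) x := (continuousAt_const.mul hi).norm
  have c4 : ContinuousAt (fun z : ℂ => ‖eta22 K * z⁻¹‖) x := (continuousAt_const.mul hi).norm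
  filter_upwards [isOpen_ne.mem_nhds hx.1, c1.eventually_lt_const hx.2.1,
    c2.eventually_lt_const hx.2.2.1, c3.eventually_lt_const hx.2.2.2.1,
    c4.eventually_lt_const hx.2.2.2.2] with z h0 h1 h2 h3 h4
  exact ⟨h0, h1, h2, h3, h4⟩

theorem InAnnulus.analyticAt_f2Out {x : ℂ} (hx : InAnnulus K x) : AnalyticAt ℂ (f2Out K) x := by
  have h1 : AnalyticAt ℂ (fun z : ℂ => z⁻¹) x := analyticAt_inv hx.1
  exact analyticAt_id.mul (AnalyticAt.fun_comp (g := gInf2 K)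
    (analyticAt_gInf2 hx.2.2.2.1 hx.2.2.2.2) h1)

theorem InAnnulus.analyticAt_f3In {x : ℂ} (hx : InAnnulus K x) : AnalyticAt ℂ (f3In K) x :=
  HalfLine.analyticAt_f3In hx.2.1 hx.2.2.1

theorem InAnnulus.analyticAt_XiCont {x : ℂ} (hx : InAnnulus K x) : AnalyticAt ℂ (XiCont K) x := by
  have h1 : AnalyticAt ℂ (fun z : ℂ => z⁻¹) x := analyticAt_inv hx.1
  exact (((analyticAt_const.sub analyticAt_id).sub h1).add
    ((hx.analyticAt_f2Out.mul hx.analyticAt_f3In).div analyticAt_id hx.1)).div analyticAt_const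
      two_ne_zero

theorem gInf2_ne_zero {τ : ℂ} (h1 : ‖eta21 K * τ‖ < 1) (h2 : ‖eta22 K * τ‖ < 1) :
    gInf2 K τ ≠ 0 :=
  mul_ne_zero (csqrt_one_sub_ne_zero h1) (csqrt_one_sub_ne_zero h2)

theorem InAnnulus.f2Out_ne_zero {x : ℂ} (hx : InAnnulus K x) : f2Out K x ≠ 0 :=
  mul_ne_zero hx.1 (gInf2_ne_zero hx.2.2.2.1 hx.2.2.2.2)

theorem f3In_ne_zero (h : Incident K xin yin) {x : ℂ} (h1 : ‖eta21 K * x‖ < 1)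
    (h2 : ‖eta22 K * x‖ < 1) : f3In K x ≠ 0 := by
  rw [f3In_eq]; exact mul_ne_zero (f3Zero_ne h) (gInf2_ne_zero h1 h2)

/-- The sign of `f3Zero` was fixed by exactly this identity; it selects the root inside the unit
disc at one point. -/
theorem XiCont_one (h : Incident K xin yin) : XiCont K 1 = Xi K 1 := by
  have h1 : (1 : ℂ) - eta21 K ≠ 0 := sub_ne_zero.mpr (ne_of_norm_lt_norm (by
    simpa using h.norm_eta21)).symm
  have h2 : (1 : ℂ) - eta22 K ≠ 0 := sub_ne_zero.mpr (ne_of_norm_lt_norm (by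
    simpa using h.norm_eta22)).symm
  have e : f2Out K 1 * f3In K 1 = Xi K 1 - (Xi K 1)⁻¹ := by
    have := gInf2_sq K 1
    rw [f2Out, f3In_eq, inv_one, one_mul,
      show gInf2 K 1 * (f3Zero K * gInf2 K 1) = f3Zero K * gInf2 K 1 ^ 2 by ring, this, f3Zero]
    field_simp
  have e2 := Xi_add_inv K 1
  rw [XiCont, div_one, e, ← e2]
  ring

/-- The modulus is continuous on the connected circle, is less than 1 at x = 1, and never equals 1
because y + y⁻¹ is non-real there. -/
theorem norm_XiCont_lt_one (h : Incident K xin yin) {x : ℂ} (hx : ‖x‖ = 1) : ‖XiCont K x‖ < 1 := by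
  have hpre : IsPreconnected (sphere (0 : ℂ) 1) :=
    isPreconnected_sphere (by rw [Complex.rank_real_complex]; norm_num) 0 1
  have hcont : ContinuousOn (fun z => ‖XiCont K z‖) (sphere (0 : ℂ) 1) := fun z hz =>
    (h.inAnnulus (mem_sphere_zero_iff_norm.mp hz)).analyticAt_XiCont.continuousAt.norm.continuousWithinAt
  by_contra hlt
  have h1 : (1 : ℂ) ∈ sphere (0 : ℂ) 1 := by simp
  have hone : ‖XiCont K 1‖ ≤ 1 := by rw [XiCont_one h]; exact (h.norm_Xi (by simp)).le
  obtain ⟨z, hz, hz1⟩ := hpre.intermediate_value h1 (mem_sphere_zero_iff_norm.mpr hx) hcont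
    ⟨hone, not_lt.mp hlt⟩
  have hzn : ‖z‖ = 1 := mem_sphere_zero_iff_norm.mp hz
  have hz0 : z ≠ 0 := (h.inAnnulus hzn).1
  refine norm_ne_one_of_add_inv_im_ne ?_ hz1
  rw [XiCont_add_inv h hz0]
  have hr : (z + z⁻¹).im = 0 := by
    rw [Complex.inv_def, Complex.normSq_eq_norm_sq, hzn]; simp
  have := h.im_sub_ne (4 - (z + z⁻¹)) (by rw [Complex.sub_im, hr]; simp)
  rw [show 4 - K ^ 2 - z - z⁻¹ = -(K ^ 2 - (4 - (z + z⁻¹))) by ring, Complex.neg_im]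
  exact neg_ne_zero.mpr this

theorem Xi_eq_XiCont (h : Incident K xin yin) {x : ℂ} (hx : ‖x‖ = 1) : Xi K x = XiCont K x := by
  have hx0 := (h.inAnnulus hx).1
  have hr : (x + x⁻¹).im = 0 := by
    rw [Complex.inv_def, Complex.normSq_eq_norm_sq, hx]; simp
  refine (eq_innerRoot ?_ (XiCont_ne_zero h hx0) ?_ (norm_XiCont_lt_one h hx)).symm
  · have := h.im_sub_ne (4 - (x + x⁻¹)) (by rw [Complex.sub_im, hr]; simp)
    convert this using 2; ring
  · rw [XiCont_add_inv h hx0]; ring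

/-! ### Symmetric combinations of the integrand -/

/-- The coefficients in `(a + b u)^n = powPair.1 + powPair.2 u`, `u² = q`. -/
def powPair (a b q : ℂ) : ℕ → ℂ × ℂ
  | 0 => (1, 0)
  | n + 1 => (a * (powPair a b q n).1 + b * q * (powPair a b q n).2,
      a * (powPair a b q n).2 + b * (powPair a b q n).1)

theorem powPair_spec {a b q u : ℂ} (hu : u ^ 2 = q) (n : ℕ) :
    (a + b * u) ^ n = (powPair a b q n).1 + (powPair a b q n).2 * u := by
  induction n with
  | zero => simp [powPair]
  | succ n ih =>
    rw [pow_succ, ih]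
    simp only [powPair]
    linear_combination (b * (powPair a b q n).2) * hu

theorem analyticAt_powPair {a b q : ℂ → ℂ} {z : ℂ} (ha : AnalyticAt ℂ a z) (hb : AnalyticAt ℂ b z)
    (hq : AnalyticAt ℂ q z) (n : ℕ) :
    AnalyticAt ℂ (fun w => (powPair (a w) (b w) (q w) n).1) z ∧
      AnalyticAt ℂ (fun w => (powPair (a w) (b w) (q w) n).2) z := by
  induction n with
  | zero => exact ⟨analyticAt_const, analyticAt_const⟩
  | succ n ih =>
    exact ⟨(ha.mul ih.1).add ((hb.mul hq).mul ih.2), (ha.mul ih.2).add (hb.mul ih.1)⟩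

/-- The coefficients in `(a + b u)^n = zpowPair.1 + zpowPair.2 u` for `n : ℤ`, where `u² = q` and
`(a + b u) (a - b u) = 1`. -/
def zpowPair (a b q : ℂ) (n : ℤ) : ℂ × ℂ := powPair a (if 0 ≤ n then b else -b) q n.natAbs

/-- Negative powers need no division, as the conjugate a - b u is the inverse. The coefficients
therefore stay analytic where a, b and q are. -/
theorem zpowPair_spec {a b q u : ℂ} (hu : u ^ 2 = q) (h1 : (a + b * u) * (a - b * u) = 1) (n : ℤ) :
    (a + b * u) ^ n = (zpowPair a b q n).1 + (zpowPair a b q n).2 * u := by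
  rw [zpowPair, ← powPair_spec hu]
  split_ifs with hn
  · conv_lhs => rw [← Int.natAbs_of_nonneg hn, zpow_natCast]
  · have hinv : a + -b * u = (a + b * u)⁻¹ := by
      rw [← eq_inv_of_mul_eq_one_right h1]; ring
    have hn' : n = -(n.natAbs : ℤ) := by omega
    rw [hinv, inv_pow]
    conv_lhs => rw [hn', zpow_neg, zpow_natCast]

theorem analyticAt_zpowPair {a b q : ℂ → ℂ} {z : ℂ} (ha : AnalyticAt ℂ a z)
    (hb : AnalyticAt ℂ b z) (hq : AnalyticAt ℂ q z) (n : ℤ) :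
    AnalyticAt ℂ (fun w => (zpowPair (a w) (b w) (q w) n).1) z ∧
      AnalyticAt ℂ (fun w => (zpowPair (a w) (b w) (q w) n).2) z := by
  by_cases hn : 0 ≤ n
  · simp only [zpowPair, if_pos hn]; exact analyticAt_powPair ha hb hq _
  · simp only [zpowPair, if_neg hn]; exact analyticAt_powPair ha hb.neg hq _

theorem dispersion_mul {x u v : ℂ} (hx : x ≠ 0) (hu : u ^ 2 = (x - eta21 K) * (x - eta22 K))
    (hv : v ^ 2 = (x - eta11 K) * (x - eta12 K)) :
    ((4 - K ^ 2 - x - x⁻¹ + u * v / x) / 2) * ((4 - K ^ 2 - x - x⁻¹ - u * v / x) / 2) = 1 := by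
  have h1 : (u * v) ^ 2 = ((4 - K ^ 2) * x - 1 - x ^ 2) ^ 2 - 4 * x ^ 2 := by
    rw [← quadrics_mul, mul_pow, hu, hv]
  field_simp
  linear_combination -h1

/-- The pair for `y^n` as a function of `f₂`. -/
def innerPair (K : ℂ) (n : ℤ) (x v : ℂ) : ℂ × ℂ :=
  zpowPair ((4 - K ^ 2 - x - x⁻¹) / 2) (v / (2 * x)) ((x - eta21 K) * (x - eta22 K)) n

theorem innerPair_spec {x u v : ℂ} (hx : x ≠ 0) (hu : u ^ 2 = (x - eta21 K) * (x - eta22 K))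
    (hv : v ^ 2 = (x - eta11 K) * (x - eta12 K)) (n : ℤ) :
    ((4 - K ^ 2 - x - x⁻¹ + u * v / x) / 2) ^ n =
      (innerPair K n x v).1 + (innerPair K n x v).2 * u := by
  have e : (4 - K ^ 2 - x - x⁻¹) / 2 + v / (2 * x) * u = (4 - K ^ 2 - x - x⁻¹ + u * v / x) / 2 := by
    field_simp
  have e' : (4 - K ^ 2 - x - x⁻¹) / 2 - v / (2 * x) * u =
      (4 - K ^ 2 - x - x⁻¹ - u * v / x) / 2 := by
    field_simp
  rw [innerPair, ← zpowPair_spec hu, e]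
  rw [e, e', dispersion_mul hx hu hv]

/-- The sum of the two values of the integrand with a given `f₃` is single-valued. -/
theorem formCoeff_add_neg_f2 {x u v : ℂ} (hx : x ≠ 0) (hu0 : u ≠ 0)
    (hu : u ^ 2 = (x - eta21 K) * (x - eta22 K)) (hv : v ^ 2 = (x - eta11 K) * (x - eta12 K))
    (m n : ℤ) :
    formCoeff K xin yin m n x u v + formCoeff K xin yin m n x (-u) v =
      x ^ m * ((innerPair K n x v).1 * f3In K xin -
        (innerPair K n x v).2 * (xin * (yin - yin⁻¹))) /
          (2 * Real.pi * Complex.I * v) * (x - xin)⁻¹ := by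
  rw [formCoeff, formCoeff, innerPair_spec hx hu hv, innerPair_spec hx (by rw [neg_sq, hu]) hv]
  simp only [div_eq_mul_inv, mul_inv, inv_neg, neg_mul]
  have h4 : (4 : ℂ)⁻¹ = 2⁻¹ * 2⁻¹ := by norm_num
  have h2 : (2 : ℂ) * 2⁻¹ = 1 := by norm_num
  have hu1 : u * u⁻¹ = 1 := mul_inv_cancel₀ hu0
  rw [h4]
  linear_combination (x ^ m * ((innerPair K n x v).1 * f3In K xin -
        (innerPair K n x v).2 * (xin * (yin - yin⁻¹))) * 2⁻¹ * (Real.pi : ℂ)⁻¹ * Complex.I⁻¹ * v⁻¹ *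
          (x - xin)⁻¹) * (2 * 2⁻¹ * hu1 + h2)

/-- The pair for `y^n` as a function of `τ f₃`, `τ = x⁻¹`. -/
def outerPair (K : ℂ) (n : ℤ) (τ u : ℂ) : ℂ × ℂ :=
  zpowPair ((4 - K ^ 2 - τ - τ⁻¹) / 2) (u / (2 * τ)) ((1 - eta11 K * τ) * (1 - eta12 K * τ)) n

theorem outerPair_spec {τ u w : ℂ} (hτ : τ ≠ 0)
    (hu : u ^ 2 = (1 - eta21 K * τ) * (1 - eta22 K * τ))
    (hw : w ^ 2 = (1 - eta11 K * τ) * (1 - eta12 K * τ)) (n : ℤ) :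
    ((4 - K ^ 2 - τ⁻¹ - τ⁻¹⁻¹ + u / τ * (w / τ) / τ⁻¹) / 2) ^ n =
      (outerPair K n τ u).1 + (outerPair K n τ u).2 * w := by
  have e : (4 - K ^ 2 - τ - τ⁻¹) / 2 + u / (2 * τ) * w =
      (4 - K ^ 2 - τ⁻¹ - τ⁻¹⁻¹ + u / τ * (w / τ) / τ⁻¹) / 2 := by
    rw [inv_inv]; field_simp; ring
  have e' : (4 - K ^ 2 - τ - τ⁻¹) / 2 - u / (2 * τ) * w =
      (4 - K ^ 2 - τ⁻¹ - τ⁻¹⁻¹ - u / τ * (w / τ) / τ⁻¹) / 2 := by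
    rw [inv_inv]; field_simp; ring
  rw [outerPair, ← zpowPair_spec hw, e]
  rw [e, e', dispersion_mul (inv_ne_zero hτ)]
  · rw [div_pow, hu]; field_simp
  · rw [div_pow, hw]; field_simp

/-- The sum of the two values of the integrand with a given `f₂` is single-valued. -/
theorem formCoeff_add_neg_f3 {τ u w : ℂ} (hτ : τ ≠ 0) (hw0 : w ≠ 0)
    (hu : u ^ 2 = (1 - eta21 K * τ) * (1 - eta22 K * τ))
    (hw : w ^ 2 = (1 - eta11 K * τ) * (1 - eta12 K * τ)) (m n : ℤ) :
    (formCoeff K xin yin m n τ⁻¹ (u / τ) (w / τ) + formCoeff K xin yin m n τ⁻¹ (u / τ) (-w / τ)) *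
        (τ ^ 2)⁻¹ =
      τ⁻¹ ^ m * (-(τ * (xin * (yin - yin⁻¹)) - f3In K xin * u)) * (outerPair K n τ u).2 /
        (2 * Real.pi * Complex.I * u * (1 - xin * τ)) := by
  have e : -(xin * (yin - yin⁻¹) - f3In K xin * (u / τ)) / (4 * Real.pi * Complex.I * (τ⁻¹ - xin)) =
      -(τ * (xin * (yin - yin⁻¹)) - f3In K xin * u) / (4 * Real.pi * Complex.I * (1 - xin * τ)) := by
    rw [show xin * (yin - yin⁻¹) - f3In K xin * (u / τ) =
      (τ * (xin * (yin - yin⁻¹)) - f3In K xin * u) * τ⁻¹ by field_simp,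
      show τ⁻¹ - xin = (1 - xin * τ) * τ⁻¹ by field_simp, ← neg_mul,
      ← mul_assoc (4 * Real.pi * Complex.I : ℂ),
      mul_div_mul_right _ _ (inv_ne_zero hτ)]
  rw [formCoeff, formCoeff, outerPair_spec hτ hu hw, outerPair_spec hτ hu (by rw [neg_sq, hw]), e]
  simp only [div_eq_mul_inv, mul_inv, inv_neg, neg_mul, inv_inv]
  have h4 : (4 : ℂ)⁻¹ = 2⁻¹ * 2⁻¹ := by norm_num
  have h2 : (2 : ℂ) * 2⁻¹ = 1 := by norm_num
  have hw1 : w * w⁻¹ = 1 := mul_inv_cancel₀ hw0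
  have ht : τ ^ 2 * (τ ^ 2)⁻¹ = 1 := mul_inv_cancel₀ (pow_ne_zero 2 hτ)
  rw [h4]
  linear_combination (-(τ⁻¹ ^ m * (τ * (xin * (yin + -yin⁻¹)) - f3In K xin * u) *
    (outerPair K n τ u).2 * 2⁻¹ * (Real.pi : ℂ)⁻¹ * Complex.I⁻¹ * u⁻¹ * (1 - xin * τ)⁻¹)) *
      (2 * 2⁻¹ * w * w⁻¹ * ht + 2 * 2⁻¹ * hw1 + h2)

end

end

end HalfLine

namespace HalfLine

noncomputable section

/-! ### Comparison with the Wiener–Hopf integral -/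

section
variable {K xin yin : ℂ}

/-- The integral over the lift of the unit circle on which `f₂ = s f2Out`, `f₃ = t f3In`. -/
def circleForm (K xin yin : ℂ) (m n : ℤ) (s t : ℂ) : ℂ :=
  ∮ x in C(0, 1), formCoeff K xin yin m n x (s * f2Out K x) (t * f3In K x)

theorem sphere_sub_ne (h : Incident K xin yin) {x : ℂ} (hx : ‖x‖ = 1) : x - xin ≠ 0 :=
  sub_ne_zero.mpr (ne_of_norm_lt_norm (by rw [hx]; exact h.x_lt)).symm

theorem circleIntegrable_formCoeff (h : Incident K xin yin) (m n : ℤ) {s t : ℂ} (hs : s ^ 2 = 1)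
    (ht : t ^ 2 = 1) : CircleIntegrable
      (fun x => formCoeff K xin yin m n x (s * f2Out K x) (t * f3In K x)) 0 1 := by
  refine ContinuousOn.circleIntegrable zero_le_one fun x hx => ContinuousAt.continuousWithinAt ?_
  have hx1 : ‖x‖ = 1 := mem_sphere_zero_iff_norm.mp hx
  have ha := h.inAnnulus hx1
  have hs0 : s ≠ 0 := fun e => by simp [e] at hs
  have ht0 : t ≠ 0 := fun e => by simp [e] at ht
  have hu : ContinuousAt (fun x => s * f2Out K x) x :=
    continuousAt_const.mul ha.analyticAt_f2Out.continuousAt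
  have hv : ContinuousAt (fun x => t * f3In K x) x :=
    continuousAt_const.mul ha.analyticAt_f3In.continuousAt
  have hi : ContinuousAt (fun z : ℂ => z⁻¹) x := continuousAt_inv₀ ha.1
  have huv0 : s * f2Out K x * (t * f3In K x) ≠ 0 :=
    mul_ne_zero (mul_ne_zero hs0 ha.f2Out_ne_zero)
      (mul_ne_zero ht0 (f3In_ne_zero h ha.2.1 ha.2.2.1))
  have hy : ContinuousAt (fun x => (4 - K ^ 2 - x - x⁻¹ +
      s * f2Out K x * (t * f3In K x) / x) / 2) x :=
    (((continuousAt_const.sub continuousAt_id).sub hi).add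
      ((hu.mul hv).div continuousAt_id ha.1)).div_const 2
  have hy0 := left_ne_zero_of_mul_eq_one (dispersion_mul (K := K) (u := s * f2Out K x)
    (v := t * f3In K x) ha.1 (by rw [mul_pow, hs, one_mul, f2Out_sq ha.1])
    (by rw [mul_pow, ht, one_mul, f3In_sq h]))
  have hd : (4 * Real.pi * Complex.I : ℂ) * (x - xin) ≠ 0 :=
    mul_ne_zero (by rw [mul_assoc]; exact mul_ne_zero (by norm_num) pi_I_ne) (sphere_sub_ne h hx1)
  unfold formCoeff
  refine ContinuousAt.div (ContinuousAt.mul (ContinuousAt.mul (continuousAt_zpow₀ x m (Or.inl ha.1))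
    (hy.zpow₀ n (Or.inl hy0))) (ContinuousAt.div ?_ ?_ hd)) (hu.mul hv) huv0
  · exact (continuousAt_const.sub (continuousAt_const.mul hu)).neg
  · exact continuousAt_const.mul (continuousAt_id.sub continuousAt_const)

theorem exists_radius (h : Incident K xin yin) : ∃ R : ℝ, 1 < R ∧ ∀ x ∈ ball (0 : ℂ) R,
    ‖eta21 K * x‖ < 1 ∧ ‖eta22 K * x‖ < 1 ∧ ‖xin * x‖ < 1 := by
  have key : ∀ a : ℂ, a ≠ 0 → ‖a‖ < 1 → 1 < ‖a‖⁻¹ ∧ ∀ x : ℂ, ‖x‖ < ‖a‖⁻¹ → ‖a * x‖ < 1 := by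
    intro a ha h1
    have hp := norm_pos_iff.mpr ha
    refine ⟨(one_lt_inv₀ hp).mpr h1, fun x hx => ?_⟩
    rw [norm_mul]
    calc ‖a‖ * ‖x‖ < ‖a‖ * ‖a‖⁻¹ := mul_lt_mul_of_pos_left hx hp
      _ = 1 := mul_inv_cancel₀ hp.ne'
  obtain ⟨a1, a2⟩ := key _ (eta21_ne K) h.norm_eta21
  obtain ⟨b1, b2⟩ := key _ (eta22_ne K) h.norm_eta22
  obtain ⟨c1, c2⟩ := key _ h.x_ne h.x_lt
  refine ⟨min ‖eta21 K‖⁻¹ (min ‖eta22 K‖⁻¹ ‖xin‖⁻¹), lt_min a1 (lt_min b1 c1), fun x hx => ?_⟩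
  rw [mem_ball_zero_iff, lt_min_iff, lt_min_iff] at hx
  exact ⟨a2 x hx.1, b2 x hx.2.1, c2 x hx.2.2⟩

/-- The annulus of `|x| < 1` on which `f₃ = t f3In`. -/
theorem circleForm_add_interior (h : Incident K xin yin) (m n : ℤ) {i k : Fin 8}
    (hi : overZero i) (hk : overZero k) (his : sgn2 i = 1) (hks : sgn2 k = -1)
    (hik : sgn3 k = sgn3 i) :
    circleForm K xin yin m n 1 (sgn3 i) + circleForm K xin yin m n (-1) (sgn3 i) =
      resTerm K xin yin m n i + resTerm K xin yin m n k +
        sgn3 i * (xin ^ m * ((yin + yin⁻¹ - sgn3 i * (yin - yin⁻¹)) / 2) ^ n) := by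
  set t : ℂ := ((sgn3 i : ℤ) : ℂ) with ht
  have ht2 : t ^ 2 = 1 := sgn3_sq i
  have ht0 : t ≠ 0 := fun e => by rw [e] at ht2; simp at ht2
  have hpi := Complex.two_pi_I_ne_zero
  obtain ⟨R, hR, hRx⟩ := exists_radius h
  have hvsq : ∀ x, (t * f3In K x) ^ 2 = (x - eta11 K) * (x - eta12 K) := fun x => by
    rw [mul_pow, ht2, one_mul, f3In_sq h]
  -- The sum over ±f₂ depends on f₂ only through its square, so the branch points η₂ₖ inside the
  -- disc disappear. Apart from x = 0, the only possible pole is the factor (x - x_in)⁻¹.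
  set κ : ℂ → ℂ := fun x => x ^ m * ((innerPair K n x (t * f3In K x)).1 * f3In K xin -
    (innerPair K n x (t * f3In K x)).2 * (xin * (yin - yin⁻¹))) /
      (2 * Real.pi * Complex.I * (t * f3In K x)) with hκ
  have hκan : ∀ x ∈ ball (0 : ℂ) R, x ≠ 0 → AnalyticAt ℂ κ x := by
    intro x hx hx0
    have hv : AnalyticAt ℂ (fun x => t * f3In K x) x :=
      analyticAt_const.mul (analyticAt_f3In (hRx x hx).1 (hRx x hx).2.1)
    have hi : AnalyticAt ℂ (fun z : ℂ => z⁻¹) x := analyticAt_inv hx0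
    have hp := analyticAt_zpowPair (a := fun x => (4 - K ^ 2 - x - x⁻¹) / 2)
      (b := fun x => t * f3In K x / (2 * x)) (q := fun x => (x - eta21 K) * (x - eta22 K)) (z := x)
      (((analyticAt_const.sub analyticAt_id).sub hi).div analyticAt_const two_ne_zero)
      (hv.div (analyticAt_const.mul analyticAt_id) (mul_ne_zero two_ne_zero hx0)) (by fun_prop) n
    refine AnalyticAt.div (AnalyticAt.mul (analyticAt_id.fun_zpow hx0)
      ((hp.1.mul analyticAt_const).sub (hp.2.mul analyticAt_const))) (analyticAt_const.mul hv) ?_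
    exact mul_ne_zero hpi (mul_ne_zero ht0 (f3In_ne_zero h (hRx x hx).1 (hRx x hx).2.1))
  have hxinR : xin ∈ ball (0 : ℂ) R := by rw [mem_ball_zero_iff]; exact h.x_lt.trans hR
  -- Both points over x_in with the given f₃ enter the sum, but the transformant is regular at one
  -- of them. What remains is the wave at p₁ or p₄, according to the sign t.
  have hκx : κ xin = (2 * Real.pi * Complex.I)⁻¹ *
      (t * (xin ^ m * ((yin + yin⁻¹ - t * (yin - yin⁻¹)) / 2) ^ n)) := by
    have hf := f3In_ne h h.x_lt.le
    have hsp := innerPair_spec (K := K) (u := f2P K xin yin) (v := t * f3In K xin) h.x_ne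
      (f2P_sq h) (hvsq xin) n
    have hfp := f3In_mul_f2P h
    have e1 : (4 - K ^ 2 - xin - xin⁻¹ + f2P K xin yin * (t * f3In K xin) / xin) / 2 =
        (yin + yin⁻¹ - t * (yin - yin⁻¹)) / 2 := by
      have hx := h.x_ne
      rw [h.add_inv, show f2P K xin yin * (t * f3In K xin) = -t * (xin * (yin - yin⁻¹)) by
        linear_combination t * hfp]
      field_simp
      ring
    rw [e1] at hsp
    have e2 : (innerPair K n xin (t * f3In K xin)).1 * f3In K xin -
        (innerPair K n xin (t * f3In K xin)).2 * (xin * (yin - yin⁻¹)) =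
        f3In K xin * ((yin + yin⁻¹ - t * (yin - yin⁻¹)) / 2) ^ n := by
      rw [hsp]; linear_combination -(innerPair K n xin (t * f3In K xin)).2 * hfp
    have et : t⁻¹ = t := by
      rw [inv_eq_iff_eq_inv]; exact eq_inv_of_mul_eq_one_left (by rw [← sq, ht2])
    simp only [hκ]
    rw [e2, div_eq_mul_inv, mul_inv _ (t * f3In K xin), mul_inv t, et]
    have hff : f3In K xin * (f3In K xin)⁻¹ = 1 := mul_inv_cancel₀ hf
    linear_combination (xin ^ m * ((yin + yin⁻¹ - t * (yin - yin⁻¹)) / 2) ^ n *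
      (2 * Real.pi * Complex.I)⁻¹ * t) * hff
  have hres0 : HasRes (fun x => κ x * (x - xin)⁻¹) 0 ((2 * Real.pi * Complex.I)⁻¹ *
      (resTerm K xin yin m n i + resTerm K xin yin m n k)) := by
    have r1 := (hasRes_formCoeff_zero h m n hi).add (hasRes_formCoeff_zero h m n hk)
    rw [← mul_add] at r1
    refine r1.congr ?_
    have hne := (analyticAt_f2In_zero K).continuousAt.eventually_ne
      (by rw [f2In_zero]; exact inv_ne_zero (f3Zero_ne h))
    filter_upwards [self_mem_nhdsWithin, nhdsWithin_le_nhds hne] with x hx hf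
    rw [his, hks, hik, ← ht]
    simp only [Int.cast_one, one_mul, Int.cast_neg, neg_mul]
    rw [formCoeff_add_neg_f2 hx hf (f2In_sq h x) (hvsq x)]
  have hresx : HasRes (fun x => κ x * (x - xin)⁻¹) xin (κ xin) :=
    hasRes_simple_pole (hκan xin hxinR h.x_ne)
  have hcirc := circleIntegral_eq_sum_residues (R := R) (ρ := 1) zero_le_one hR
    (fun a => if a = 0 then (2 * Real.pi * Complex.I)⁻¹ *
      (resTerm K xin yin m n i + resTerm K xin yin m n k) else κ xin) {0, xin}
    (by simpa using h.x_lt) (fun x => κ x * (x - xin)⁻¹) ?_ ?_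
  · rw [Finset.sum_pair h.x_ne.symm, if_pos rfl, if_neg h.x_ne, hκx, ← mul_add, ← mul_assoc,
      mul_inv_cancel₀ hpi, one_mul] at hcirc
    rw [← hcirc, circleForm, circleForm, ← circleIntegral.integral_add
      (circleIntegrable_formCoeff h m n (one_pow 2) ht2)
      (circleIntegrable_formCoeff h m n (by norm_num) ht2)]
    refine circleIntegral.integral_congr zero_le_one fun x hx => ?_
    have ha := h.inAnnulus (mem_sphere_zero_iff_norm.mp hx)
    simp only [one_mul, neg_mul]
    rw [formCoeff_add_neg_f2 ha.1 ha.f2Out_ne_zero (f2Out_sq ha.1) (hvsq x)]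
  · intro x hx hxS
    simp only [Finset.mem_insert, Finset.mem_singleton, not_or] at hxS
    have h2 : AnalyticAt ℂ (fun x => (x - xin)⁻¹) x :=
      (analyticAt_id.sub analyticAt_const).inv (sub_ne_zero.mpr hxS.2)
    exact (hκan x hx hxS.1).mul h2
  · intro a ha
    simp only [Finset.mem_insert, Finset.mem_singleton] at ha
    rcases ha with rfl | rfl
    · simpa using hres0
    · rw [if_neg h.x_ne]; exact hresx

/-- Under θ ↦ 2π - θ the reversal of orientation cancels the minus sign in d(z⁻¹). -/
theorem circleIntegral_inv (f : ℂ → ℂ) :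
    ∮ z in C(0, 1), f z = ∮ z in C(0, 1), f z⁻¹ * (z ^ 2)⁻¹ := by
  simp only [circleIntegral]
  have := intervalIntegral.integral_comp_sub_left (a := 0) (b := 2 * Real.pi)
    (fun θ => deriv (circleMap 0 1) θ • f (circleMap 0 1 θ)) (2 * Real.pi)
  rw [sub_self, sub_zero] at this
  rw [← this]
  refine intervalIntegral.integral_congr fun θ _ => ?_
  have e : circleMap 0 1 (2 * Real.pi - θ) = (circleMap 0 1 θ)⁻¹ := by
    simp only [circleMap, zero_add, Complex.ofReal_one, one_mul]
    rw [← Complex.exp_neg]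
    push_cast
    rw [show (2 * Real.pi - θ : ℂ) * Complex.I = 2 * Real.pi * Complex.I + -(θ * Complex.I) by ring,
      Complex.exp_add, Complex.exp_two_pi_mul_I, one_mul]
  have hne : circleMap 0 1 θ ≠ 0 := circleMap_ne_center one_ne_zero
  simp only [deriv_circleMap, e, smul_eq_mul]
  field_simp

/-- The annulus of `|x| > 1` on which `f₂ = s f2Out`. -/
theorem circleForm_add_exterior (h : Incident K xin yin) (m n : ℤ) {i k : Fin 8}
    (hi : ¬overZero i) (hk : ¬overZero k) (his : sgn3 i = 1) (hks : sgn3 k = -1)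
    (hik : sgn2 k = sgn2 i) :
    circleForm K xin yin m n (sgn2 i) 1 + circleForm K xin yin m n (sgn2 i) (-1) =
      -(resTerm K xin yin m n i + resTerm K xin yin m n k) := by
  set s : ℂ := ((sgn2 i : ℤ) : ℂ) with hs
  have hs2 : s ^ 2 = 1 := sgn2_sq i
  have hs0 : s ≠ 0 := fun e => by rw [e] at hs2; simp at hs2
  have hpi := Complex.two_pi_I_ne_zero
  obtain ⟨R, hR, hRx⟩ := exists_radius h
  have husq : ∀ τ, (s * gInf2 K τ) ^ 2 = (1 - eta21 K * τ) * (1 - eta22 K * τ) := fun τ => by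
    rw [mul_pow, hs2, one_mul, gInf2_sq]
  -- The sum over ±f₃ removes the branch points outside the unit circle. The factor 1 - x_in τ does
  -- not vanish for |τ| ≤ 1, so τ = 0 is the only possible pole.
  set κ : ℂ → ℂ := fun τ => τ⁻¹ ^ m * (-(τ * (xin * (yin - yin⁻¹)) - f3In K xin * (s * gInf2 K τ))) *
    (outerPair K n τ (s * gInf2 K τ)).2 /
      (2 * Real.pi * Complex.I * (s * gInf2 K τ) * (1 - xin * τ)) with hκ
  have hκan : ∀ τ ∈ ball (0 : ℂ) R, τ ≠ 0 → AnalyticAt ℂ κ τ := by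
    intro τ hτ hτ0
    have hu : AnalyticAt ℂ (fun τ => s * gInf2 K τ) τ :=
      analyticAt_const.mul (analyticAt_gInf2 (hRx τ hτ).1 (hRx τ hτ).2.1)
    have hi : AnalyticAt ℂ (fun z : ℂ => z⁻¹) τ := analyticAt_inv hτ0
    have hp := analyticAt_zpowPair (a := fun x => (4 - K ^ 2 - x - x⁻¹) / 2)
      (b := fun x => s * gInf2 K x / (2 * x))
      (q := fun x => (1 - eta11 K * x) * (1 - eta12 K * x)) (z := τ)
      (((analyticAt_const.sub analyticAt_id).sub hi).div analyticAt_const two_ne_zero)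
      (hu.div (analyticAt_const.mul analyticAt_id) (mul_ne_zero two_ne_zero hτ0)) (by fun_prop) n
    refine AnalyticAt.div (AnalyticAt.mul (AnalyticAt.mul (hi.fun_zpow (inv_ne_zero hτ0)) ?_) hp.2)
      (AnalyticAt.mul (analyticAt_const.mul hu) (by fun_prop)) ?_
    · exact ((analyticAt_id.mul analyticAt_const).sub (analyticAt_const.mul hu)).neg
    · refine mul_ne_zero (mul_ne_zero hpi (mul_ne_zero hs0
        (gInf2_ne_zero (hRx τ hτ).1 (hRx τ hτ).2.1))) ?_
      exact Complex.slitPlane_ne_zero (mem_slitPlane_one_sub (hRx τ hτ).2.2)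
  -- κ carries the factor +τ⁻² of `circleIntegral_inv`, while dx = -τ⁻² dτ; hence the minus sign.
  have hres0 : HasRes κ 0 ((2 * Real.pi * Complex.I)⁻¹ *
      -(resTerm K xin yin m n i + resTerm K xin yin m n k)) := by
    have r1 := ((hasRes_formCoeff_inf (K := K) (xin := xin) (yin := yin) m n hi).add
      (hasRes_formCoeff_inf (K := K) (xin := xin) (yin := yin) m n hk)).const_mul (-1)
    rw [← mul_add, neg_one_mul, ← mul_neg] at r1
    refine r1.congr ?_
    have hne := (analyticAt_gInf3_zero K).continuousAt.eventually_ne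
      (by rw [gInf3_zero]; exact one_ne_zero)
    filter_upwards [self_mem_nhdsWithin, nhdsWithin_le_nhds hne] with τ hτ hf
    rw [his, hks, hik, ← hs]
    simp only [Int.cast_one, one_mul, Int.cast_neg, neg_mul]
    have := formCoeff_add_neg_f3 (K := K) (xin := xin) (yin := yin) hτ hf (husq τ)
      (gInf3_sq K τ) m n
    simp only [hκ]
    rw [← this]; ring
  have hcirc := circleIntegral_eq_sum_residues (R := R) (ρ := 1) zero_le_one hR
    (fun _ => (2 * Real.pi * Complex.I)⁻¹ * -(resTerm K xin yin m n i + resTerm K xin yin m n k))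
    {0} (by simp) κ (fun τ hτ hτS => hκan τ hτ (by simpa using hτS)) (by simpa using hres0)
  rw [Finset.sum_singleton, ← mul_assoc, mul_inv_cancel₀ hpi, one_mul] at hcirc
  rw [← hcirc, circleForm, circleForm, ← circleIntegral.integral_add
    (circleIntegrable_formCoeff h m n hs2 (one_pow 2))
    (circleIntegrable_formCoeff h m n hs2 (by norm_num)), circleIntegral_inv]
  refine circleIntegral.integral_congr zero_le_one fun τ hτ => ?_
  have ha := h.inAnnulus (mem_sphere_zero_iff_norm.mp hτ)
  have ha' := h.inAnnulus (x := τ⁻¹) (by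
    rw [norm_inv, mem_sphere_zero_iff_norm.mp hτ, inv_one])
  have hτ0 := ha.1
  have hw0 : τ * f3In K τ⁻¹ ≠ 0 := mul_ne_zero hτ0 (f3In_ne_zero h ha'.2.1 ha'.2.2.1)
  have hwsq : (τ * f3In K τ⁻¹) ^ 2 = (1 - eta11 K * τ) * (1 - eta12 K * τ) := by
    rw [mul_pow, f3In_sq h]; field_simp
  have := formCoeff_add_neg_f3 (K := K) (xin := xin) (yin := yin) hτ0 hw0 (husq τ) hwsq m n
  simp only [hκ]
  rw [← this]
  simp only [one_mul, neg_mul]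
  have e1 : s * f2Out K τ⁻¹ = s * gInf2 K τ / τ := by rw [f2Out, inv_inv]; ring
  have e2 : τ * f3In K τ⁻¹ / τ = f3In K τ⁻¹ := by field_simp
  have e3 : -(τ * f3In K τ⁻¹) / τ = -f3In K τ⁻¹ := by field_simp
  rw [e1, e2, e3]

/-- Reversing both f₂ and f₃ preserves f₁ and y = Ξ. In the difference of the two lifts the term
f₁(p₁) of A cancels and f₃(p₁) f₂ doubles, leaving the Wiener–Hopf integrand. -/
theorem whScattered_eq_of_nonneg (h : Incident K xin yin) (m : ℤ) {n : ℤ} (hn : 0 ≤ n) :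
    whScattered K xin m n = circleForm K xin yin m n (-1) (-1) - circleForm K xin yin m n 1 1 := by
  rw [circleForm, circleForm, ← circleIntegral.integral_sub
    (circleIntegrable_formCoeff h m n (by norm_num) (by norm_num))
    (circleIntegrable_formCoeff h m n (one_pow 2) (one_pow 2)), whScattered,
    ← circleIntegral.integral_const_mul]
  refine circleIntegral.integral_congr zero_le_one fun x hx => ?_
  have hx1 := mem_sphere_zero_iff_norm.mp hx
  have ha := h.inAnnulus hx1
  have hu := ha.f2Out_ne_zero
  have hv := f3In_ne_zero h ha.2.1 ha.2.2.1
  have hpow : Xi K x ^ n.natAbs = XiCont K x ^ n := by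
    rw [Xi_eq_XiCont h hx1]
    conv_rhs => rw [← Int.natAbs_of_nonneg hn, zpow_natCast]
  have hxx := sphere_sub_ne h hx1
  have hpi1 : (Real.pi : ℂ) ≠ 0 := left_ne_zero_of_mul pi_I_ne
  have hI := Complex.I_ne_zero
  simp only [hpow, formCoeff, one_mul, neg_mul, mul_neg, neg_neg]
  rw [show (4 - K ^ 2 - x - x⁻¹ + f2Out K x * f3In K x / x) / 2 = XiCont K x from rfl]
  field_simp
  ring

/-- On the lifts with opposite signs y = Ξ⁻¹, so for n ≤ 0 again y^n = Ξ^|n|. -/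
theorem whScattered_eq_of_nonpos (h : Incident K xin yin) (m : ℤ) {n : ℤ} (hn : n ≤ 0) :
    whScattered K xin m n = circleForm K xin yin m n 1 (-1) - circleForm K xin yin m n (-1) 1 := by
  rw [circleForm, circleForm, ← circleIntegral.integral_sub
    (circleIntegrable_formCoeff h m n (one_pow 2) (by norm_num))
    (circleIntegrable_formCoeff h m n (by norm_num) (one_pow 2)), whScattered,
    ← circleIntegral.integral_const_mul]
  refine circleIntegral.integral_congr zero_le_one fun x hx => ?_
  have hx1 := mem_sphere_zero_iff_norm.mp hx
  have ha := h.inAnnulus hx1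
  have hu := ha.f2Out_ne_zero
  have hv := f3In_ne_zero h ha.2.1 ha.2.2.1
  have hpow : Xi K x ^ n.natAbs = (XiCont K x)⁻¹ ^ n := by
    rw [Xi_eq_XiCont h hx1, inv_zpow', ← zpow_natCast]
    congr 1; omega
  have hxx := sphere_sub_ne h hx1
  have hpi1 : (Real.pi : ℂ) ≠ 0 := left_ne_zero_of_mul pi_I_ne
  have hI := Complex.I_ne_zero
  have hy : (4 - K ^ 2 - x - x⁻¹ + -(f2Out K x * f3In K x) / x) / 2 = (XiCont K x)⁻¹ := by
    rw [XiCont_inv h ha.1]; ring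
  simp only [hpow, formCoeff, one_mul, neg_mul, mul_neg, hy]
  field_simp
  ring

/-- The residue sums are the Wiener–Hopf solution and its mirror image. -/
theorem resSum_zero (h : Incident K xin yin) (m : ℤ) {n : ℤ} (hn : 0 ≤ n) :
    resSum K xin yin 0 m n = xin ^ m * yin ^ n + whScattered K xin m n := by
  -- Points 1, 2 lie outside the circle with f₂ = `f2Out`, points 3, 4 inside with f₃ = -`f3In`.
  -- Their common lift, with signs (1, -1), cancels in e1 - e2; the pole p₁ contributes the incident
  -- wave.
  have e1 := circleForm_add_exterior h m n (i := 1) (k := 2) (by decide) (by decide) rfl rfl rfl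
  have e2 := circleForm_add_interior h m n (i := 3) (k := 4) rfl rfl rfl rfl rfl
  have e3 := whScattered_eq_of_nonneg h m hn
  rw [show sgn2 1 = 1 from rfl] at e1
  rw [show sgn3 3 = -1 from rfl] at e2
  simp only [Int.cast_one, Int.cast_neg] at e1 e2
  rw [show (yin + yin⁻¹ - -1 * (yin - yin⁻¹)) / 2 = yin by ring] at e2
  rw [resSum, e3]
  simp only [zero_add]
  linear_combination e1 - e2

theorem resSum_two (h : Incident K xin yin) (m : ℤ) {n : ℤ} (hn : n ≤ 0) :
    resSum K xin yin 2 m n = xin ^ m * yin ^ n + whScattered K xin m n := by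
  have e1 := circleForm_add_exterior h m n (i := 6) (k := 5) (by decide) (by decide) rfl rfl rfl
  have e2 := circleForm_add_interior h m n (i := 3) (k := 4) rfl rfl rfl rfl rfl
  have e3 := whScattered_eq_of_nonpos h m hn
  rw [show sgn2 6 = -1 from rfl] at e1
  rw [show sgn3 3 = -1 from rfl] at e2
  simp only [Int.cast_one, Int.cast_neg] at e1 e2
  rw [show (yin + yin⁻¹ - -1 * (yin - yin⁻¹)) / 2 = yin by ring] at e2
  rw [resSum, e3, show (2 + 1 : Fin 8) = 3 from rfl, show (2 + 2 : Fin 8) = 4 from rfl,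
    show (2 + 3 : Fin 8) = 5 from rfl, show (2 + 4 : Fin 8) = 6 from rfl]
  linear_combination e1 - e2

theorem resSum_four (h : Incident K xin yin) (m : ℤ) {n : ℤ} (hn : 0 ≤ n) :
    resSum K xin yin 4 m n = -(xin ^ m * yin⁻¹ ^ n + whScattered K xin m n) := by
  have e1 := circleForm_add_exterior h m n (i := 6) (k := 5) (by decide) (by decide) rfl rfl rfl
  have e2 := circleForm_add_interior h m n (i := 0) (k := 7) rfl rfl rfl rfl rfl
  have e3 := whScattered_eq_of_nonneg h m hn
  rw [show sgn2 6 = -1 from rfl] at e1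
  rw [show sgn3 0 = 1 from rfl] at e2
  simp only [Int.cast_one, Int.cast_neg] at e1 e2
  rw [show (yin + yin⁻¹ - 1 * (yin - yin⁻¹)) / 2 = yin⁻¹ by ring] at e2
  rw [resSum, e3, show (4 + 1 : Fin 8) = 5 from rfl, show (4 + 2 : Fin 8) = 6 from rfl,
    show (4 + 3 : Fin 8) = 7 from rfl, show (4 + 4 : Fin 8) = 0 from rfl]
  linear_combination e1 - e2

theorem resSum_six (h : Incident K xin yin) (m : ℤ) {n : ℤ} (hn : n ≤ 0) :
    resSum K xin yin 6 m n = -(xin ^ m * yin⁻¹ ^ n + whScattered K xin m n) := by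
  have e1 := circleForm_add_exterior h m n (i := 1) (k := 2) (by decide) (by decide) rfl rfl rfl
  have e2 := circleForm_add_interior h m n (i := 0) (k := 7) rfl rfl rfl rfl rfl
  have e3 := whScattered_eq_of_nonpos h m hn
  rw [show sgn2 1 = 1 from rfl] at e1
  rw [show sgn3 0 = 1 from rfl] at e2
  simp only [Int.cast_one] at e1 e2
  rw [show (yin + yin⁻¹ - 1 * (yin - yin⁻¹)) / 2 = yin⁻¹ by ring] at e2
  rw [resSum, e3, show (6 + 1 : Fin 8) = 7 from rfl, show (6 + 2 : Fin 8) = 0 from rfl,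
    show (6 + 3 : Fin 8) = 1 from rfl, show (6 + 4 : Fin 8) = 2 from rfl]
  linear_combination e1 - e2

end

end

end HalfLine

namespace HalfLine

noncomputable section

/-! ### Exponential decay of the scattered field -/

section
variable {K xin yin : ℂ}

theorem circleIntegral_eq_of_analyticAt {f : ℂ → ℂ} {r R : ℝ} (hr : 0 < r) (hrR : r ≤ R)
    (hf : ∀ z, r ≤ ‖z‖ → ‖z‖ ≤ R → AnalyticAt ℂ f z) :
    ∮ z in C(0, R), f z = ∮ z in C(0, r), f z := by
  refine Complex.circleIntegral_eq_of_differentiable_on_annulus_off_countable hr hrR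
    (Set.countable_empty) (fun z hz => ?_) fun z hz => ?_
  · rw [Set.mem_sdiff, mem_closedBall_zero_iff, mem_ball_zero_iff, not_lt] at hz
    exact (hf z hz.2 hz.1).continuousAt.continuousWithinAt
  · rw [sdiff_empty, Set.mem_sdiff, mem_ball_zero_iff, mem_closedBall_zero_iff, not_le] at hz
    exact (hf z hz.2.le hz.1.le).differentiableAt

/-- The nearest point of the circle is z/|z|, and 1 - δ ≤ (1 + δ)⁻¹ bounds the distance on the inner
side. -/
theorem mem_cthickening_sphere {δ : ℝ} (hδ : 0 < δ) {z : ℂ} (h1 : (1 + δ)⁻¹ ≤ ‖z‖)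
    (h2 : ‖z‖ ≤ 1 + δ) : z ∈ cthickening δ (sphere (0 : ℂ) 1) := by
  have hz : 0 < ‖z‖ := lt_of_lt_of_le (by positivity) h1
  have hz0 : (‖z‖ : ℂ) ≠ 0 := by exact_mod_cast hz.ne'
  refine mem_cthickening_of_dist_le z (z / ‖z‖) δ _ ?_ ?_
  · rw [mem_sphere_zero_iff_norm, norm_div, Complex.norm_real, norm_norm, div_self hz.ne']
  · have e : z - z / ‖z‖ = z / ‖z‖ * ((‖z‖ - 1 : ℝ) : ℂ) := by
      push_cast; field_simp
    rw [dist_eq_norm, e, norm_mul, norm_div, Complex.norm_real, norm_norm, div_self hz.ne', one_mul,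
      Complex.norm_real, Real.norm_eq_abs, abs_le]
    have : 1 - δ ≤ (1 + δ)⁻¹ := by
      rw [← one_div, le_div_iff₀ (by positivity)]; nlinarith
    constructor <;> linarith

/-- A closed annulus about the unit circle on which the continuation of `Ξ` is bounded by a constant
less than one. -/
theorem exists_decay_annulus (h : Incident K xin yin) : ∃ δ q M : ℝ, 0 < δ ∧ 0 ≤ q ∧ q < 1 ∧ 0 ≤ M ∧
    ∀ z : ℂ, (1 + δ)⁻¹ ≤ ‖z‖ → ‖z‖ ≤ 1 + δ → InAnnulus K z ∧ z - xin ≠ 0 ∧ ‖XiCont K z‖ ≤ q ∧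
      ‖f3In K xin / (f3In K z * (z - xin))‖ ≤ M := by
  have hG : sphere (0 : ℂ) 1 ⊆ interior {z | InAnnulus K z ∧ ‖XiCont K z‖ < 1 ∧ z - xin ≠ 0} := by
    intro z hz
    have hz1 := mem_sphere_zero_iff_norm.mp hz
    have ha := h.inAnnulus hz1
    rw [mem_interior_iff_mem_nhds]
    have c : ContinuousAt (fun z => z - xin) z := by fun_prop
    exact ha.eventually.and ((ha.analyticAt_XiCont.continuousAt.norm.eventually_lt
      continuousAt_const (norm_XiCont_lt_one h hz1)).and (c.eventually_ne (sphere_sub_ne h hz1)))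
  -- The strict inequality |Ξ| < 1 on the compact circle persists on a closed annulus, where the
  -- maximum is attained and is thus less than 1.
  obtain ⟨δ, hδ, hsub⟩ := (isCompact_sphere (0 : ℂ) 1).exists_cthickening_subset_open
    isOpen_interior hG
  replace hsub := hsub.trans interior_subset
  have hcomp : IsCompact (cthickening δ (sphere (0 : ℂ) 1)) := (isCompact_sphere (0 : ℂ) 1).cthickening
  have hne : (cthickening δ (sphere (0 : ℂ) 1)).Nonempty :=
    ⟨1, self_subset_cthickening _ (by simp)⟩
  obtain ⟨z₁, hz₁, hmax₁⟩ := hcomp.exists_isMaxOn hne (f := fun z => ‖XiCont K z‖) fun z hz =>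
    (hsub hz).1.analyticAt_XiCont.continuousAt.norm.continuousWithinAt
  obtain ⟨z₂, -, hmax₂⟩ := hcomp.exists_isMaxOn hne
    (f := fun z => ‖f3In K xin / (f3In K z * (z - xin))‖) fun z hz => by
      obtain ⟨ha, -, hx⟩ := hsub hz
      refine (ContinuousAt.div continuousAt_const (ha.analyticAt_f3In.continuousAt.mul
        (continuousAt_id.sub continuousAt_const)) ?_).norm.continuousWithinAt
      exact mul_ne_zero (f3In_ne_zero h ha.2.1 ha.2.2.1) hx
  refine ⟨δ, ‖XiCont K z₁‖, _, hδ, norm_nonneg _, (hsub hz₁).2.1,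
    norm_nonneg (f3In K xin / (f3In K z₂ * (z₂ - xin))), fun z h1 h2 => ?_⟩
  have hz := mem_cthickening_sphere hδ h1 h2
  exact ⟨(hsub hz).1, (hsub hz).2.2, hmax₁ hz, hmax₂ hz⟩

/-- The circle is shrunk for m ≥ 0 and enlarged for m ≤ 0, so that z^m contributes (1 + δ)^(-|m|).
On both circles the continued Ξ is at most q in modulus. -/
theorem exists_norm_whScattered_le (h : Incident K xin yin) : ∃ C q : ℝ, 0 ≤ C ∧ 0 < q ∧ q < 1 ∧
    ∀ m n : ℤ, ‖whScattered K xin m n‖ ≤ C * q ^ (m.natAbs + n.natAbs) := by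
  obtain ⟨δ, q, M, hδ, hq0, hq1, hM, hA⟩ := exists_decay_annulus h
  have hd1 : (1 : ℝ) < 1 + δ := by linarith
  have hi1 : (1 + δ)⁻¹ < 1 := inv_lt_one_of_one_lt₀ hd1
  have hi0 : 0 < (1 + δ)⁻¹ := by positivity
  refine ⟨(1 + δ) * M, max (1 + δ)⁻¹ q, by positivity, lt_max_of_lt_left hi0, max_lt hi1 hq1,
    fun m n => ?_⟩
  set g : ℂ → ℂ := fun z => z ^ m * XiCont K z ^ n.natAbs * f3In K xin / (f3In K z * (z - xin))
    with hg
  have hgan : ∀ z : ℂ, (1 + δ)⁻¹ ≤ ‖z‖ → ‖z‖ ≤ 1 + δ → AnalyticAt ℂ g z := by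
    intro z h1 h2
    obtain ⟨ha, hx, -, -⟩ := hA z h1 h2
    exact (((analyticAt_id.fun_zpow ha.1).mul (ha.analyticAt_XiCont.pow _)).mul analyticAt_const).div
      (ha.analyticAt_f3In.mul (analyticAt_id.sub analyticAt_const))
      (mul_ne_zero (f3In_ne_zero h ha.2.1 ha.2.2.1) hx)
  have hXi : ∮ z in C(0, 1), z ^ m * Xi K z ^ n.natAbs * f3In K xin / (f3In K z * (z - xin)) =
      ∮ z in C(0, 1), g z := by
    refine circleIntegral.integral_congr zero_le_one fun z hz => ?_
    simp only [hg, Xi_eq_XiCont h (mem_sphere_zero_iff_norm.mp hz)]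
  have key : ∃ R : ℝ, (1 + δ)⁻¹ ≤ R ∧ R ≤ 1 + δ ∧ R ^ m = (1 + δ)⁻¹ ^ m.natAbs ∧
      ∮ z in C(0, 1), g z = ∮ z in C(0, R), g z := by
    rcases le_total 0 m with hm | hm
    · refine ⟨(1 + δ)⁻¹, le_rfl, (hi1.trans hd1).le, ?_, circleIntegral_eq_of_analyticAt hi0 hi1.le
        fun z h1 h2 => hgan z h1 (h2.trans hd1.le)⟩
      conv_lhs => rw [← Int.natAbs_of_nonneg hm, zpow_natCast]
    · refine ⟨1 + δ, (hi1.trans hd1).le, le_rfl, ?_, (circleIntegral_eq_of_analyticAt one_pos hd1.le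
        fun z h1 h2 => hgan z (hi1.le.trans h1) h2).symm⟩
      rw [← zpow_natCast, inv_zpow']
      congr 1; omega
  obtain ⟨R, hR1, hR2, hRm, hRint⟩ := key
  have hR0 : 0 ≤ R := hi0.le.trans hR1
  have hbd : ∀ z ∈ sphere (0 : ℂ) R,
      ‖g z‖ ≤ (max (1 + δ)⁻¹ q) ^ (m.natAbs + n.natAbs) * M := by
    intro z hz
    rw [mem_sphere_zero_iff_norm] at hz
    obtain ⟨-, -, h3, h4⟩ := hA z (by rw [hz]; exact hR1) (by rw [hz]; exact hR2)
    simp only [hg]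
    rw [mul_div_assoc, norm_mul, norm_mul, norm_zpow, norm_pow, hz, hRm, pow_add]
    gcongr
    · exact le_max_left _ _
    · exact h3.trans (le_max_right _ _)
  rw [whScattered, hXi, hRint, neg_mul, norm_neg, ← smul_eq_mul]
  calc _ ≤ R * ((max (1 + δ)⁻¹ q) ^ (m.natAbs + n.natAbs) * M) :=
        circleIntegral.norm_two_pi_i_inv_smul_integral_le_of_norm_le_const hR0 hbd
    _ ≤ (1 + δ) * ((max (1 + δ)⁻¹ q) ^ (m.natAbs + n.natAbs) * M) := by
        have : (0 : ℝ) ≤ (max (1 + δ)⁻¹ q) ^ (m.natAbs + n.natAbs) * M :=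
          mul_nonneg (pow_nonneg (hi0.le.trans (le_max_left _ _)) _) hM
        gcongr
    _ = _ := by ring

end

end

end HalfLine

namespace HalfLine

noncomputable section

/-! ### The residues satisfy the stencil equation -/

section
variable {K xin yin : ℂ}

theorem formCoeff_stencil {x u v : ℂ} (hx : x ≠ 0) (hu : u ^ 2 = (x - eta21 K) * (x - eta22 K))
    (hv : v ^ 2 = (x - eta11 K) * (x - eta12 K)) (m n : ℤ) :
    formCoeff K xin yin (m + 1) n x u v + formCoeff K xin yin (m - 1) n x u v +
      formCoeff K xin yin m (n + 1) x u v + formCoeff K xin yin m (n - 1) x u v +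
      (K ^ 2 - 4) * formCoeff K xin yin m n x u v = 0 := by
  have hy := dispersion_mul hx hu hv
  set y := (4 - K ^ 2 - x - x⁻¹ + u * v / x) / 2 with hydef
  have hy0 : y ≠ 0 := left_ne_zero_of_mul_eq_one hy
  have hyi : y⁻¹ = (4 - K ^ 2 - x - x⁻¹ - u * v / x) / 2 := inv_eq_of_mul_eq_one_right hy
  have hs : x + x⁻¹ + y + y⁻¹ + (K ^ 2 - 4) = 0 := by rw [hyi, hydef]; ring
  simp only [formCoeff, ← hydef]
  rw [zpow_add_one₀ hx, zpow_sub_one₀ hx, zpow_add_one₀ hy0, zpow_sub_one₀ hy0]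
  linear_combination (x ^ m * y ^ n * (-(xin * (yin - yin⁻¹) - f3In K xin * u) /
    (4 * Real.pi * Complex.I * (x - xin))) / (u * v)) * hs

/-- The stencil combination of integrands vanishes identically, and residues are linear and unique.
-/
theorem resTerm_stencil (h : Incident K xin yin) (m n : ℤ) (i : Fin 8) :
    resTerm K xin yin (m + 1) n i + resTerm K xin yin (m - 1) n i +
      resTerm K xin yin m (n + 1) i + resTerm K xin yin m (n - 1) i +
      (K ^ 2 - 4) * resTerm K xin yin m n i = 0 := by
  have key : ∃ G : ℤ → ℤ → ℂ → ℂ,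
      (∀ m n, HasRes (G m n) 0 ((2 * Real.pi * Complex.I)⁻¹ * resTerm K xin yin m n i)) ∧
      ∀ z ≠ 0, G (m + 1) n z + G (m - 1) n z + G m (n + 1) z + G m (n - 1) z +
        (K ^ 2 - 4) * G m n z = 0 := by
    by_cases hi : overZero i
    · refine ⟨_, fun m n => hasRes_formCoeff_zero h m n hi, fun z hz => formCoeff_stencil hz ?_ ?_ m n⟩
      · rw [mul_pow, sgn2_sq, one_mul, f2In_sq h]
      · rw [mul_pow, sgn3_sq, one_mul, f3In_sq h]
    · refine ⟨_, fun m n => hasRes_formCoeff_inf (K := K) (xin := xin) (yin := yin) m n hi,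
        fun z hz => ?_⟩
      have := formCoeff_stencil (K := K) (xin := xin) (yin := yin) (inv_ne_zero hz)
        (u := sgn2 i * gInf2 K z / z) (v := sgn3 i * gInf3 K z / z) ?_ ?_ m n
      · linear_combination -(z ^ 2)⁻¹ * this
      · rw [div_pow, mul_pow, sgn2_sq, one_mul, gInf2_sq]; field_simp
      · rw [div_pow, mul_pow, sgn3_sq, one_mul, gInf3_sq]; field_simp
  obtain ⟨G, hG, hst⟩ := key
  have hsum := ((((hG (m + 1) n).add (hG (m - 1) n)).add (hG m (n + 1))).add (hG m (n - 1))).add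
    ((hG m n).const_mul (K ^ 2 - 4))
  have h0 : HasRes (fun _ => (0 : ℂ)) 0 0 := hasRes_zero_of_analyticAt analyticAt_const
  have := hsum.unique (h0.congr (by
    filter_upwards [self_mem_nhdsWithin] with z hz using hst z hz))
  have hpi : (2 * Real.pi * Complex.I)⁻¹ ≠ 0 := inv_ne_zero Complex.two_pi_I_ne_zero
  refine (mul_eq_zero.mp (?_ : (2 * Real.pi * Complex.I)⁻¹ * _ = 0)).resolve_left hpi
  rw [← this]; ring

theorem poleCoeff_of_nonpos (g : ℂ → ℂ) {N : ℤ} (hN : N ≤ 0) : poleCoeff g N = 0 :=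
  if_neg hN.not_gt

/-- In the given half-plane the wave cancels the pole. The points i and i + 4 share the half-plane,
and they are the ones by which consecutive contours differ. -/
theorem resTerm_eq_zero (K xin yin : ℂ) (m n : ℤ) :
    (0 ≤ m + n → resTerm K xin yin m n 0 = 0 ∧ resTerm K xin yin m n 4 = 0) ∧
    (m ≤ n → resTerm K xin yin m n 1 = 0 ∧ resTerm K xin yin m n 5 = 0) ∧
    (m + n ≤ 0 → resTerm K xin yin m n 2 = 0 ∧ resTerm K xin yin m n 6 = 0) ∧
    (n ≤ m → resTerm K xin yin m n 3 = 0 ∧ resTerm K xin yin m n 7 = 0) := by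
  refine ⟨fun h => ?_, fun h => ?_, fun h => ?_, fun h => ?_⟩ <;>
  · constructor <;> simp only [resTerm, Matrix.cons_val] <;> rw [poleCoeff_of_nonpos _ (by omega)] <;>
      simp

/-- For n = 0 the wave does not see y. The paired points have equal f₂, hence equal A, and opposite
f₃, which reverses the sign of Ψ. -/
theorem resTerm_axis (K xin yin : ℂ) (m : ℤ) :
    resTerm K xin yin m 0 1 + resTerm K xin yin m 0 2 = 0 ∧
    resTerm K xin yin m 0 5 + resTerm K xin yin m 0 6 = 0 ∧
    resTerm K xin yin m 0 0 + resTerm K xin yin m 0 3 = 0 ∧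
    resTerm K xin yin m 0 4 + resTerm K xin yin m 0 7 = 0 := by
  simp [resTerm]

/-! ### The field on the branched lattice -/

/-- A contour describing the node `(m, n)` of the sheet `k`. -/
def sheetIndex (n : ℤ) (k : ZMod 2) : Fin 8 :=
  if k.val = 0 then if 0 ≤ n then 0 else 2 else if 0 ≤ n then 4 else 6

/-- The field, as a sum of residues at infinity points. -/
def fieldU (K xin yin : ℂ) : S2 → ℂ
  | S2.origin => 0
  | S2.node m n k _ => resSum K xin yin (sheetIndex n k) m n

theorem resSum_origin (K xin yin : ℂ) (j : Fin 8) : resSum K xin yin j 0 0 = 0 := by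
  have : ∀ i, resTerm K xin yin 0 0 i = 0 := fun i => by
    fin_cases i <;> simp [resTerm, poleCoeff]
  simp [resSum, this]

theorem fieldU_at (K xin yin : ℂ) (m n : ℤ) (k : ZMod 2) :
    fieldU K xin yin (S2.at m n k) = resSum K xin yin (sheetIndex n k) m n := by
  unfold S2.at
  split_ifs with h
  · rw [h.1, h.2, resSum_origin]; rfl
  · rfl

/-- The nodes `(m, n)` of the sheet `k` described by the contour number `j`. -/
def Describes (j : Fin 8) (m n : ℤ) (k : ZMod 2) : Prop :=
  ![k.val = 0 ∧ 0 ≤ n, k.val = 0 ∧ m ≤ 0, n ≤ 0 ∧ (k.val = 0 ∨ n = 0 ∧ 0 < m),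
    0 ≤ m ∧ (k.val = 0 ∧ n < 0 ∨ k.val = 1 ∧ 0 ≤ n),
    k.val = 1 ∧ 0 ≤ n, k.val = 1 ∧ m ≤ 0, n ≤ 0 ∧ (k.val = 1 ∨ n = 0 ∧ 0 < m),
    0 ≤ m ∧ (k.val = 1 ∧ n < 0 ∨ k.val = 0 ∧ 0 ≤ n)] j

theorem val_lt_two (k : ZMod 2) : k.val < 2 := ZMod.val_lt k

/-- Every contour describing a node differs from the chosen one by residues that vanish at the node
or, on the ray n = 0, m > 0 common to both sheets, by cancelling pairs. Once the residues are
abstracted to eight numbers, this is finite linear algebra. -/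
theorem fieldU_eq_resSum {j : Fin 8} {m n : ℤ} {k : ZMod 2} (hj : Describes j m n k) :
    fieldU K xin yin (S2.at m n k) = resSum K xin yin j m n := by
  rw [fieldU_at]
  obtain ⟨v0, v1, v2, v3⟩ := resTerm_eq_zero K xin yin m n
  have hk := val_lt_two k
  have ax : n = 0 → resTerm K xin yin m n 1 + resTerm K xin yin m n 2 = 0 ∧
      resTerm K xin yin m n 5 + resTerm K xin yin m n 6 = 0 := by
    rintro rfl; exact ⟨(resTerm_axis K xin yin m).1, (resTerm_axis K xin yin m).2.1⟩
  set r : Fin 8 → ℂ := resTerm K xin yin m n with hr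
  have e0 : resSum K xin yin 0 m n = r 1 + r 2 + r 3 + r 4 := rfl
  have e1 : resSum K xin yin 1 m n = r 2 + r 3 + r 4 + r 5 := rfl
  have e2 : resSum K xin yin 2 m n = r 3 + r 4 + r 5 + r 6 := rfl
  have e3 : resSum K xin yin 3 m n = r 4 + r 5 + r 6 + r 7 := rfl
  have e4 : resSum K xin yin 4 m n = r 5 + r 6 + r 7 + r 0 := rfl
  have e5 : resSum K xin yin 5 m n = r 6 + r 7 + r 0 + r 1 := rfl
  have e6 : resSum K xin yin 6 m n = r 7 + r 0 + r 1 + r 2 := rfl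
  have e7 : resSum K xin yin 7 m n = r 0 + r 1 + r 2 + r 3 := rfl
  clear_value r
  unfold sheetIndex
  fin_cases j <;> simp only [Describes] at hj <;>
    simp only [Fin.zero_eta, Fin.mk_one, Fin.reduceFinMk, Matrix.cons_val] at hj ⊢ <;> grind

/-! ### Polar coordinates -/

/-- The quarter-plane of a node in terms of its polar angle. -/
theorem S2.Polar.exists_quarter {m n : ℤ} {k : ZMod 2} {hmn : ¬(m = 0 ∧ n = 0)} {r φ : ℝ}
    (hP : (S2.node m n k hmn).Polar r φ) : ∃ a l : ℤ,
      a * (Real.pi / 2) ≤ φ ∧ φ < (a + 1) * (Real.pi / 2) ∧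
      (a = 4 * (k.val + 2 * l) ∧ 0 < m ∧ 0 ≤ n ∧ (φ = a * (Real.pi / 2) → n = 0) ∨
       a = 4 * (k.val + 2 * l) + 1 ∧ m ≤ 0 ∧ 0 < n ∧ (φ = a * (Real.pi / 2) → m = 0) ∨
       a = 4 * (k.val + 2 * l) + 2 ∧ m < 0 ∧ n ≤ 0 ∧ (φ = a * (Real.pi / 2) → n = 0) ∨
       a = 4 * (k.val + 2 * l) + 3 ∧ 0 ≤ m ∧ n < 0 ∧ (φ = a * (Real.pi / 2) → m = 0)) := by
  obtain ⟨hr, hm, hn, l, hl1, hl2⟩ := hP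
  have hpi := Real.pi_pos
  obtain ⟨a, ha1, ha2⟩ : ∃ a : ℤ, a * (Real.pi / 2) ≤ φ ∧ φ < (a + 1) * (Real.pi / 2) :=
    ⟨⌊φ / (Real.pi / 2)⌋, by rw [← le_div_iff₀ (by positivity)]; exact Int.floor_le _,
      by rw [← div_lt_iff₀ (by positivity)]; exact Int.lt_floor_add_one _⟩
  have hb1 : 4 * (k.val + 2 * l) < a + 1 := by
    have : ((4 * (k.val + 2 * l) : ℤ) : ℝ) < ((a + 1 : ℤ) : ℝ) := by
      push_cast
      refine lt_of_mul_lt_mul_right ?_ (by positivity : 0 ≤ Real.pi / 2)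
      linarith
    exact_mod_cast this
  have hb2 : a < 4 * (k.val + 2 * l) + 4 := by
    have : ((a : ℤ) : ℝ) < ((4 * (k.val + 2 * l) + 4 : ℤ) : ℝ) := by
      push_cast
      refine lt_of_mul_lt_mul_right ?_ (by positivity : 0 ≤ Real.pi / 2)
      linarith
    exact_mod_cast this
  refine ⟨a, l, ha1, ha2, ?_⟩
  -- ψ in [0, π/2) is the angle within the quarter-plane; sin ψ vanishes exactly when the node lies
  -- on its initial ray.
  obtain ⟨ψ, hψ⟩ : ∃ ψ, φ = a * (Real.pi / 2) + ψ := ⟨_, (add_sub_cancel _ _).symm⟩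
  have hψ0 : 0 ≤ ψ := by linarith
  have hψ1 : ψ < Real.pi / 2 := by linarith
  have hcos : 0 < Real.cos ψ := Real.cos_pos_of_mem_Ioo ⟨by linarith, hψ1⟩
  have hsin : 0 ≤ Real.sin ψ := Real.sin_nonneg_of_nonneg_of_le_pi hψ0 (by linarith)
  have hz : φ = a * (Real.pi / 2) → Real.sin ψ = 0 := fun e => by
    rw [show ψ = 0 by linarith, Real.sin_zero]
  have red : ∀ c : ℝ, (a : ℝ) = 4 * (k.val + 2 * l) + c →
      Real.cos φ = Real.cos (ψ + c * (Real.pi / 2)) ∧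
      Real.sin φ = Real.sin (ψ + c * (Real.pi / 2)) := by
    intro c hc
    have : φ = ψ + c * (Real.pi / 2) + ((k.val + 2 * l : ℤ) : ℝ) * (2 * Real.pi) := by
      rw [hψ, hc]; push_cast; ring
    rw [this, Real.cos_add_int_mul_two_pi, Real.sin_add_int_mul_two_pi]
    exact ⟨rfl, rfl⟩
  have hlt : ∀ {z : ℤ} {w : ℝ}, (z : ℝ) = r * w → 0 < w → 0 < z := fun e hw => by
    have := mul_pos hr hw; rw [← e] at this; exact_mod_cast this
  have hle : ∀ {z : ℤ} {w : ℝ}, (z : ℝ) = r * w → 0 ≤ w → 0 ≤ z := fun e hw => by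
    have := mul_nonneg hr.le hw; rw [← e] at this; exact_mod_cast this
  have hzero : ∀ {z : ℤ} {w : ℝ}, (z : ℝ) = r * w → w = 0 → z = 0 := fun e hw => by
    rw [hw, mul_zero] at e; exact_mod_cast e
  have hng : ∀ {z : ℤ} {w : ℝ}, (z : ℝ) = r * -w → ((-z : ℤ) : ℝ) = r * w := fun e => by
    push_cast; linarith
  obtain hc | hc | hc | hc : a = 4 * (k.val + 2 * l) ∨ a = 4 * (k.val + 2 * l) + 1 ∨
    a = 4 * (k.val + 2 * l) + 2 ∨ a = 4 * (k.val + 2 * l) + 3 := by omega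
  · obtain ⟨e1, e2⟩ := red 0 (by rw [hc]; push_cast; ring)
    rw [zero_mul, add_zero] at e1 e2
    rw [e1] at hm; rw [e2] at hn
    exact Or.inl ⟨hc, hlt hm hcos, hle hn hsin, fun e => hzero hn (hz e)⟩
  · obtain ⟨e1, e2⟩ := red 1 (by rw [hc]; push_cast; ring)
    rw [one_mul, Real.cos_add_pi_div_two] at e1
    rw [one_mul, Real.sin_add_pi_div_two] at e2
    rw [e1] at hm; rw [e2] at hn
    have := hle (hng hm) hsin
    exact Or.inr (Or.inl ⟨hc, by omega, hlt hn hcos, fun e => hzero hm (by rw [hz e, neg_zero])⟩)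
  · obtain ⟨e1, e2⟩ := red 2 (by rw [hc]; push_cast; ring)
    rw [mul_div_cancel₀ _ two_ne_zero, Real.cos_add_pi] at e1
    rw [mul_div_cancel₀ _ two_ne_zero, Real.sin_add_pi] at e2
    rw [e1] at hm; rw [e2] at hn
    have h1 := hlt (hng hm) hcos
    have h2 := hle (hng hn) hsin
    exact Or.inr (Or.inr (Or.inl ⟨hc, by omega, by omega,
      fun e => hzero hn (by rw [hz e, neg_zero])⟩))
  · obtain ⟨e1, e2⟩ := red 3 (by rw [hc]; push_cast; ring)
    rw [show ψ + 3 * (Real.pi / 2) = ψ + Real.pi / 2 + Real.pi by ring, Real.cos_add_pi,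
      Real.cos_add_pi_div_two, neg_neg] at e1
    rw [show ψ + 3 * (Real.pi / 2) = ψ + Real.pi / 2 + Real.pi by ring, Real.sin_add_pi,
      Real.sin_add_pi_div_two] at e2
    rw [e1] at hm; rw [e2] at hn
    have h1 := hlt (hng hn) hcos
    exact Or.inr (Or.inr (Or.inr ⟨hc, hle hm hsin, by omega, fun e => hzero hm (hz e)⟩))

/-- Integer bounds for the number of the quarter-plane. -/
theorem quarter_bounds {a : ℤ} {φ : ℝ} (h1 : a * (Real.pi / 2) ≤ φ)
    (h2 : φ < (a + 1) * (Real.pi / 2)) {j j' : ℤ} (hj : j * (Real.pi / 2) ≤ φ)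
    (hj' : φ ≤ j' * (Real.pi / 2)) : j ≤ a ∧ a ≤ j' ∧ (a = j' → φ = a * (Real.pi / 2)) := by
  have hpi : 0 < Real.pi / 2 := by have := Real.pi_pos; positivity
  refine ⟨?_, ?_, ?_⟩
  · have : (j : ℝ) < ((a + 1 : ℤ) : ℝ) := by
      push_cast; exact lt_of_mul_lt_mul_right (hj.trans_lt h2) hpi.le
    have : j < a + 1 := by exact_mod_cast this
    omega
  · have : (a : ℝ) ≤ j' := le_of_mul_le_mul_right (h1.trans hj') hpi
    exact_mod_cast this
  · rintro rfl; exact le_antisymm hj' h1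

theorem describes_of_describedBy {m n : ℤ} {k : ZMod 2} {hmn : ¬(m = 0 ∧ n = 0)} {j : Fin 8}
    (hP : (S2.node m n k hmn).DescribedBy j) : Describes j m n k := by
  obtain ⟨r, φ, hpol, hj1, hj2⟩ := hP
  obtain ⟨a, l, ha1, ha2, hq⟩ := hpol.exists_quarter
  -- The sector is closed, so a = j + 2 may occur, but only on its last ray; the boundary
  -- information in hq then gives a vanishing coordinate.
  obtain ⟨b1, b2, b3⟩ := quarter_bounds ha1 ha2 (j := (j : ℕ)) (j' := (j : ℕ) + 2)
    (by push_cast; linarith) (by push_cast; linarith)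
  have hk := val_lt_two k
  have hq' : (a = 4 * (k.val + 2 * l) ∧ 0 < m ∧ 0 ≤ n ∧ (a = (j : ℕ) + 2 → n = 0) ∨
       a = 4 * (k.val + 2 * l) + 1 ∧ m ≤ 0 ∧ 0 < n ∧ (a = (j : ℕ) + 2 → m = 0) ∨
       a = 4 * (k.val + 2 * l) + 2 ∧ m < 0 ∧ n ≤ 0 ∧ (a = (j : ℕ) + 2 → n = 0) ∨
       a = 4 * (k.val + 2 * l) + 3 ∧ 0 ≤ m ∧ n < 0 ∧ (a = (j : ℕ) + 2 → m = 0)) :=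
    hq.imp (fun h => ⟨h.1, h.2.1, h.2.2.1, fun e => h.2.2.2 (b3 e)⟩) <| Or.imp
      (fun h => ⟨h.1, h.2.1, h.2.2.1, fun e => h.2.2.2 (b3 e)⟩) <| Or.imp
      (fun h => ⟨h.1, h.2.1, h.2.2.1, fun e => h.2.2.2 (b3 e)⟩)
      (fun h => ⟨h.1, h.2.1, h.2.2.1, fun e => h.2.2.2 (b3 e)⟩)
  clear hq b3 ha1 ha2 hj1 hj2 hpol
  obtain ⟨J, hJ⟩ : ∃ J : ℤ, J = (j : ℕ) := ⟨_, rfl⟩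
  rw [← hJ] at b1 b2 hq'
  fin_cases j <;> simp only [Describes] <;>
    simp only [Fin.zero_eta, Fin.mk_one, Fin.reduceFinMk, Matrix.cons_val] <;>
    simp at hJ <;> omega

end

end

end HalfLine

namespace HalfLine

noncomputable section

/-! ### The diffraction problem -/

section
variable {K xin yin : ℂ}

theorem fieldU_of_describedBy {P : S2} {j : Fin 8} (hP : P.DescribedBy j) :
    fieldU K xin yin P = resSum K xin yin j P.m P.n := by
  match P, hP with
  | S2.origin, _ => exact (resSum_origin K xin yin j).symm
  | S2.node m n k hmn, hP =>
    have := fieldU_eq_resSum (K := K) (xin := xin) (yin := yin) (describes_of_describedBy hP)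
    rwa [S2.at, dif_neg hmn] at this

theorem resSum_stencil (h : Incident K xin yin) (j : Fin 8) (m n : ℤ) :
    resSum K xin yin j (m + 1) n + resSum K xin yin j (m - 1) n + resSum K xin yin j m (n + 1) +
      resSum K xin yin j m (n - 1) + (K ^ 2 - 4) * resSum K xin yin j m n = 0 := by
  unfold resSum
  linear_combination resTerm_stencil h m n (j + 1) + resTerm_stencil h m n (j + 2) +
    resTerm_stencil h m n (j + 3) + resTerm_stencil h m n (j + 4)

theorem val_add_one (k : ZMod 2) : (k + 1).val = 1 - k.val := by revert k; decide

/-- A node different from the origin is described by a common contour with all its neighbours. -/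
theorem exists_describes_neighbours {m n : ℤ} (k : ZMod 2) (hmn : ¬(m = 0 ∧ n = 0)) :
    ∃ j, Describes j (m + 1) n k ∧ Describes j (m - 1) n k ∧
      Describes j m (n + 1) (if 0 < m ∧ n = -1 then k + 1 else k) ∧
      Describes j m (n - 1) (if 0 < m ∧ n = 0 then k + 1 else k) ∧ Describes j m n k := by
  have hk := val_lt_two k
  have hk1 := val_add_one k
  obtain hk0 | hk0 : k.val = 0 ∨ k.val = 1 := by omega
  · rcases lt_trichotomy n 0 with hn | hn | hn
    · refine ⟨2, ?_⟩
      simp only [Describes, Matrix.cons_val]; split_ifs <;> omega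
    · rcases lt_trichotomy m 0 with hm | hm | hm
      · refine ⟨1, ?_⟩
        simp only [Describes, Matrix.cons_val]; split_ifs <;> omega
      · exact absurd ⟨hm, hn⟩ hmn
      -- The lower neighbour lies on the other sheet. Contour 7 describes 7π/2 ≤ φ ≤ 9π/2, which
      -- straddles the cut φ = 4π.
      · refine ⟨7, ?_⟩
        simp only [Describes, Matrix.cons_val]; split_ifs <;> omega
    · refine ⟨0, ?_⟩
      simp only [Describes, Matrix.cons_val]; split_ifs <;> omega
  · rcases lt_trichotomy n 0 with hn | hn | hn
    · refine ⟨6, ?_⟩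
      simp only [Describes, Matrix.cons_val]; split_ifs <;> omega
    · rcases lt_trichotomy m 0 with hm | hm | hm
      · refine ⟨5, ?_⟩
        simp only [Describes, Matrix.cons_val]; split_ifs <;> omega
      · exact absurd ⟨hm, hn⟩ hmn
      · refine ⟨3, ?_⟩
        simp only [Describes, Matrix.cons_val]; split_ifs <;> omega
    · refine ⟨4, ?_⟩
      simp only [Describes, Matrix.cons_val]; split_ifs <;> omega

theorem stencilS2_fieldU (h : Incident K xin yin) : StencilS2 K (fieldU K xin yin) := by
  intro m n k hmn
  obtain ⟨j, h1, h2, h3, h4, h5⟩ := exists_describes_neighbours k hmn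
  rw [fieldU_eq_resSum h1, fieldU_eq_resSum h2, fieldU_eq_resSum h3, fieldU_eq_resSum h4,
    fieldU_eq_resSum h5]
  exact resSum_stencil h j m n

theorem fieldU_axis {m : ℤ} (k : ZMod 2) (hm : 0 ≤ m) : fieldU K xin yin (S2.at m 0 k) = 0 := by
  obtain ⟨v0, -, -, v3⟩ := resTerm_eq_zero K xin yin m 0
  obtain ⟨v4, v4'⟩ := v0 (by omega)
  obtain ⟨v5, v5'⟩ := v3 hm
  obtain ⟨a1, a2, -, -⟩ := resTerm_axis K xin yin m
  rw [fieldU_at, sheetIndex, if_pos le_rfl, if_pos le_rfl]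
  split_ifs
  · change resTerm K xin yin m 0 1 + resTerm K xin yin m 0 2 + resTerm K xin yin m 0 3 +
      resTerm K xin yin m 0 4 = 0
    rw [a1, v5, v4', add_zero, add_zero]
  · change resTerm K xin yin m 0 5 + resTerm K xin yin m 0 6 + resTerm K xin yin m 0 7 +
      resTerm K xin yin m 0 0 = 0
    rw [a2, v5', v4, add_zero, add_zero]

theorem fieldU_at_zero (h : Incident K xin yin) (m n : ℤ) {k : ZMod 2} (hk : k.val = 0) :
    fieldU K xin yin (S2.at m n k) = xin ^ m * yin ^ n + whScattered K xin m n := by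
  rw [fieldU_at, sheetIndex, if_pos hk]
  split_ifs with hn
  · exact resSum_zero h m hn
  · exact resSum_two h m (not_le.mp hn).le

theorem fieldU_at_one (h : Incident K xin yin) (m n : ℤ) {k : ZMod 2} (hk : k.val = 1) :
    fieldU K xin yin (S2.at m n k) = -(xin ^ m * yin⁻¹ ^ n + whScattered K xin m n) := by
  rw [fieldU_at, sheetIndex, if_neg (by omega)]
  split_ifs with hn
  · exact resSum_four h m hn
  · exact resSum_six h m (not_le.mp hn).le

theorem fieldU_eq_wienerHopf (h : Incident K xin yin) {P : S2} {r φ : ℝ} (hP : P.Polar r φ) :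
    (0 ≤ φ → φ ≤ 2 * Real.pi →
      fieldU K xin yin P = xin ^ P.m * yin ^ P.n + whScattered K xin P.m P.n) ∧
    (2 * Real.pi ≤ φ → φ ≤ 4 * Real.pi →
      fieldU K xin yin P = -(xin ^ P.m * yin⁻¹ ^ P.n + whScattered K xin P.m P.n)) := by
  -- The angle ranges are closed, so a node with n = 0, m > 0 falls into both although it carries
  -- one sheet label. Both formulas hold because every expression is zero there.
  have hz : ∀ m : ℤ, 0 ≤ m → xin ^ m * yin ^ (0 : ℤ) + whScattered K xin m 0 = 0 := fun m hm => by
    rw [← fieldU_at_zero h m 0 (k := 0) rfl, fieldU_axis 0 hm]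
  have hz' : ∀ m : ℤ, 0 ≤ m → xin ^ m * yin⁻¹ ^ (0 : ℤ) + whScattered K xin m 0 = 0 := fun m hm => by
    rw [← neg_eq_zero, ← fieldU_at_one h m 0 (k := 1) rfl, fieldU_axis 1 hm]
  match P, hP with
  | S2.origin, _ =>
    have h1 := hz 0 le_rfl
    have h2 := hz' 0 le_rfl
    refine ⟨fun _ _ => h1.symm, fun _ _ => ?_⟩
    change 0 = -(xin ^ (0 : ℤ) * yin⁻¹ ^ (0 : ℤ) + whScattered K xin 0 0)
    rw [h2, neg_zero]
  | S2.node m n k hmn, hP =>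
    obtain ⟨a, l, ha1, ha2, hq⟩ := hP.exists_quarter
    have hk := val_lt_two k
    have hat : S2.node m n k hmn = S2.at m n k := by rw [S2.at, dif_neg hmn]
    rw [hat]
    simp only [← hat, S2.m, S2.n]
    rw [hat]
    constructor
    · intro h1 h2
      obtain ⟨b1, b2, b3⟩ := quarter_bounds ha1 ha2 (j := 0) (j' := 4) (by simpa using h1)
        (by push_cast; linarith)
      have : k.val = 0 ∨ n = 0 ∧ 0 ≤ m := by
        rcases hq with h | h | h | h <;> obtain ⟨q1, q2, q3, q4⟩ := h
        · by_cases e : a = 4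
          · have := q4 (b3 e); omega
          · omega
        all_goals omega
      rcases this with hk0 | ⟨rfl, hm⟩
      · exact fieldU_at_zero h m n hk0
      · rw [hz m hm, fieldU_axis k hm]
    · intro h1 h2
      obtain ⟨b1, b2, b3⟩ := quarter_bounds ha1 ha2 (j := 4) (j' := 8) (by push_cast; linarith)
        (by push_cast; linarith)
      have : k.val = 1 ∨ n = 0 ∧ 0 ≤ m := by
        rcases hq with h | h | h | h <;> obtain ⟨q1, q2, q3, q4⟩ := h
        · by_cases e : a = 8
          · have := q4 (b3 e); omega
          · omega
        all_goals omega
      rcases this with hk0 | ⟨rfl, hm⟩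
      · exact fieldU_at_one h m n hk0
      · rw [hz' m hm, fieldU_axis k hm, neg_zero]

theorem S2.Polar.le_natAbs {P : S2} {r φ : ℝ} (hP : P.Polar r φ) :
    r ≤ ((P.m.natAbs + P.n.natAbs : ℕ) : ℝ) := by
  match P, hP with
  | S2.origin, hP => exact (show r = 0 from hP).trans_le (Nat.cast_nonneg _)
  | S2.node m n k hmn, ⟨hr, hm, hn, _⟩ =>
    simp only [S2.m, S2.n]
    push_cast
    rw [Nat.cast_natAbs, Nat.cast_natAbs, Int.cast_abs, Int.cast_abs]
    have h1 : r ^ 2 = (m : ℝ) ^ 2 + (n : ℝ) ^ 2 := by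
      rw [hm, hn]; linear_combination (-r ^ 2) * Real.sin_sq_add_cos_sq φ
    refine le_of_sq_le_sq ?_ (by positivity)
    rw [h1, ← sq_abs (m : ℝ), ← sq_abs (n : ℝ)]
    nlinarith [mul_nonneg (abs_nonneg (m : ℝ)) (abs_nonneg (n : ℝ))]

theorem radiationS2_fieldU (h : Incident K xin yin) : RadiationS2 xin yin (fieldU K xin yin) := by
  obtain ⟨C, q, hC, hq0, hq1, hb⟩ := exists_norm_whScattered_le h
  refine ⟨C, q, hq0, hq1, fun P r φ hP => ?_⟩
  have hle : ‖whScattered K xin P.m P.n‖ ≤ C * q ^ r := by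
    refine (hb P.m P.n).trans (mul_le_mul_of_nonneg_left ?_ hC)
    rw [← Real.rpow_natCast]
    exact Real.rpow_le_rpow_of_exponent_ge hq0 hq1.le hP.le_natAbs
  obtain ⟨w1, w2⟩ := fieldU_eq_wienerHopf h hP
  refine ⟨fun h1 h2 => ?_, fun h1 h2 => ?_⟩
  · rw [w1 h1 h2, add_sub_cancel_left]; exact hle
  · rw [w2 h1 h2, neg_add_rev, neg_add_cancel_right, norm_neg]; exact hle

/-- The reflection exchanges the sheets and maps n to -n. The scattered field is even in n, and
y_in⁻¹ to the power -n is y_in^n; on the ray n = 0, m > 0 both values are zero. -/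
theorem fieldU_antisymm (h : Incident K xin yin) {P P' : S2} {r φ : ℝ} (hP : P.Polar r φ)
    (hP' : P'.Polar r (4 * Real.pi - φ)) : fieldU K xin yin P' = -fieldU K xin yin P := by
  match P, hP, P', hP' with
  | S2.origin, _, S2.origin, _ => exact neg_zero.symm
  | S2.origin, h1, S2.node _ _ _ _, h2 => exact absurd (show r = 0 from h1) h2.1.ne'
  | S2.node _ _ _ _, h1, S2.origin, h2 => exact absurd (show r = 0 from h2) h1.1.ne'
  | S2.node m n k hmn, h1, S2.node m' n' k' hmn', h2 =>
    have hper : 4 * Real.pi - φ = -φ + ((2 : ℤ) : ℝ) * (2 * Real.pi) := by push_cast; ring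
    have hm : m' = m := by
      have e := h2.2.1
      rw [hper, Real.cos_add_int_mul_two_pi, Real.cos_neg, ← h1.2.1] at e
      exact_mod_cast e
    have hn : n' = -n := by
      have e := h2.2.2.1
      rw [hper, Real.sin_add_int_mul_two_pi, Real.sin_neg, mul_neg, ← h1.2.2.1] at e
      exact_mod_cast e
    subst hm hn
    obtain ⟨a, l, a1, a2, hq⟩ := h1.exists_quarter
    obtain ⟨a', l', a1', a2', hq'⟩ := h2.exists_quarter
    obtain ⟨b1, b2, b3⟩ := quarter_bounds a1' a2' (j := 7 - a) (j' := 8 - a)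
      (by push_cast; linarith) (by push_cast; linarith)
    have hk := val_lt_two k
    have hk' := val_lt_two k'
    have hcases : k.val + k'.val = 1 ∨ n = 0 ∧ 0 ≤ m' := by
      -- The reflection sends quarter a to 7 - a, except that the initial ray of a goes to the
      -- initial ray of 8 - a.
      by_cases e : a' = 8 - a
      · have e' := b3 e
        have e'' : φ = a * (Real.pi / 2) := by rw [e] at e'; push_cast at e'; linarith
        rcases hq with h | h | h | h <;> rcases hq' with h' | h' | h' | h' <;>
          obtain ⟨q1, q2, q3, q4⟩ := h <;> obtain ⟨q1', q2', q3', q4'⟩ := h' <;>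
          have := q4 e'' <;> omega
      · omega
    have hat : S2.node m' n k hmn = S2.at m' n k := by rw [S2.at, dif_neg hmn]
    have hat' : S2.node m' (-n) k' hmn' = S2.at m' (-n) k' := by rw [S2.at, dif_neg hmn']
    rw [hat, hat']
    have hwh : whScattered K xin m' (-n) = whScattered K xin m' n := by
      simp only [whScattered, Int.natAbs_neg]
    rcases hcases with hk1 | ⟨rfl, hm⟩
    · obtain hk0 | hk0 : k.val = 0 ∨ k.val = 1 := by omega
      · rw [fieldU_at_zero h m' n hk0, fieldU_at_one h m' (-n) (by omega), hwh, inv_zpow', neg_neg]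
      · rw [fieldU_at_one h m' n hk0, fieldU_at_zero h m' (-n) (by omega), hwh, inv_zpow', neg_neg]
    · rw [neg_zero, fieldU_axis k hm, fieldU_axis k' hm, neg_zero]

theorem fieldU_of_lt {m n : ℤ} (hn : 0 < n) (hnm : n < m) :
    fieldU K xin yin (S2.at m n 0) = poleCoeff (bracketInf K xin yin 1 n) (m + n) -
      poleCoeff (bracketInf K xin yin 1 (-n)) (m - n) := by
  obtain ⟨v0, -, -, v3⟩ := resTerm_eq_zero K xin yin m n
  rw [fieldU_at, show sheetIndex n 0 = 0 from (if_pos rfl).trans (if_pos hn.le)]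
  change resTerm K xin yin m n 1 + resTerm K xin yin m n 2 + resTerm K xin yin m n 3 +
      resTerm K xin yin m n 4 = _
  rw [(v0 (by omega)).2, (v3 hnm.le).1, add_zero, add_zero]
  change -poleCoeff (bracketInf K xin yin 1 (-n)) (m - n) +
    poleCoeff (bracketInf K xin yin 1 n) (m + n) = _
  ring

theorem fieldU_of_abs_lt {m n : ℤ} (hn : 0 < n) (hmn : m < n) (hmn' : -n < m) :
    fieldU K xin yin (S2.at m n 0) = poleCoeff (bracketInf K xin yin 1 n) (m + n) +
      poleCoeff (bracketZero K xin yin 1 n) (n - m) := by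
  obtain ⟨v0, v1, -, -⟩ := resTerm_eq_zero K xin yin m n
  rw [fieldU_at, show sheetIndex n 0 = 0 from (if_pos rfl).trans (if_pos hn.le)]
  change resTerm K xin yin m n 1 + resTerm K xin yin m n 2 + resTerm K xin yin m n 3 +
      resTerm K xin yin m n 4 = _
  rw [(v0 (by omega)).2, (v1 hmn.le).1, add_zero, zero_add]
  rfl

end

end

end HalfLine

namespace HalfLine

noncomputable section

/-! ### Algebraic functions of the incident wave -/

/-- The incident waves. -/
structure Wave where
  K : ℂ
  xin : ℂ
  yin : ℂ
  inc : Incident K xin yin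

/-- A polynomial in `(K, x_in)` as a function of the incident wave. -/
def evalWave : MvPolynomial (Fin 2) ℂ →+* (Wave → ℂ) :=
  RingHom.pi fun t => MvPolynomial.eval ![t.K, t.xin]

/-- `x_in^N g` is integral over the polynomials in `(K, x_in)` for some `N`. -/
def IsAlg (g : Wave → ℂ) : Prop :=
  ∃ N : ℕ, evalWave.IsIntegralElem ((fun t => t.xin) ^ N * g)

theorem isIntegralElem_xin : evalWave.IsIntegralElem fun t => t.xin := by
  have : (fun t : Wave => t.xin) = evalWave (MvPolynomial.X 1) := by ext t; simp [evalWave]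
  rw [this]; exact RingHom.isIntegralElem_map _

theorem isIntegralElem_K : evalWave.IsIntegralElem fun t => t.K := by
  have : (fun t : Wave => t.K) = evalWave (MvPolynomial.X 0) := by ext t; simp [evalWave]
  rw [this]; exact RingHom.isIntegralElem_map _

theorem isIntegralElem_const (c : ℂ) : evalWave.IsIntegralElem fun _ => c := by
  have : (fun _ : Wave => c) = evalWave (MvPolynomial.C c) := by ext t; simp [evalWave]
  rw [this]; exact RingHom.isIntegralElem_map _

theorem isIntegralElem_pow {g : Wave → ℂ} (hg : evalWave.IsIntegralElem g) (n : ℕ) :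
    evalWave.IsIntegralElem (g ^ n) := by
  induction n with
  | zero => rw [pow_zero]; exact isIntegralElem_const 1
  | succ n ih => rw [pow_succ]; exact ih.mul _ hg

theorem isIntegralElem_of_sq {g : Wave → ℂ} (hg : evalWave.IsIntegralElem (g ^ 2)) :
    evalWave.IsIntegralElem g := by
  let _ := evalWave.toAlgebra
  exact IsIntegral.of_pow (R := MvPolynomial (Fin 2) ℂ) two_pos hg

namespace IsAlg

variable {f g : Wave → ℂ}

theorem of_isIntegralElem (hg : evalWave.IsIntegralElem g) : IsAlg g := ⟨0, by simpa using hg⟩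

theorem const (c : ℂ) : IsAlg fun _ => c := of_isIntegralElem (isIntegralElem_const c)

theorem mul (hf : IsAlg f) (hg : IsAlg g) : IsAlg fun t => f t * g t := by
  obtain ⟨M, hM⟩ := hf
  obtain ⟨N, hN⟩ := hg
  refine ⟨M + N, ?_⟩
  have e : ((fun t => t.xin) ^ (M + N) * fun t => f t * g t) =
      (fun t : Wave => t.xin) ^ M * f * ((fun t => t.xin) ^ N * g) := by
    funext t; simp only [Pi.mul_apply, Pi.pow_apply]; ring
  rw [e]; exact hM.mul _ hN

theorem add (hf : IsAlg f) (hg : IsAlg g) : IsAlg fun t => f t + g t := by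
  obtain ⟨M, hM⟩ := hf
  obtain ⟨N, hN⟩ := hg
  refine ⟨M + N, ?_⟩
  have e : ((fun t => t.xin) ^ (M + N) * fun t => f t + g t) =
      (fun t => t.xin) ^ N * ((fun t : Wave => t.xin) ^ M * f) +
        (fun t => t.xin) ^ M * ((fun t => t.xin) ^ N * g) := by
    funext t; simp only [Pi.mul_apply, Pi.pow_apply, Pi.add_apply]; ring
  rw [e]
  exact ((isIntegralElem_pow isIntegralElem_xin N).mul _ hM).add _
    ((isIntegralElem_pow isIntegralElem_xin M).mul _ hN)

theorem neg (hf : IsAlg f) : IsAlg fun t => -f t := by simpa using (const (-1)).mul hf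

theorem sub (hf : IsAlg f) (hg : IsAlg g) : IsAlg fun t => f t - g t := by
  simpa [sub_eq_add_neg] using hf.add hg.neg

theorem sum {ι : Type*} {s : Finset ι} {F : ι → Wave → ℂ} (hF : ∀ i ∈ s, IsAlg (F i)) :
    IsAlg fun t => ∑ i ∈ s, F i t := by
  classical
  induction s using Finset.induction_on with
  | empty => simpa using const 0
  | insert a s ha ih =>
    simp only [Finset.sum_insert ha]
    exact (hF a (Finset.mem_insert_self a s)).add
      (ih fun i hi => hF i (Finset.mem_insert_of_mem hi))

/-- (x_in^N g)² = x_in^N (x_in^N g²), and an element with integral square is integral. This avoids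
following the choices of square roots. -/
theorem of_sq (hg : IsAlg fun t => g t ^ 2) : IsAlg g := by
  obtain ⟨N, hN⟩ := hg
  have e : ((fun t => t.xin) ^ N * g) ^ 2 =
      (fun t : Wave => t.xin) ^ N * ((fun t => t.xin) ^ N * fun t => g t ^ 2) := by
    funext t; simp only [Pi.mul_apply, Pi.pow_apply]; ring
  exact ⟨N, isIntegralElem_of_sq (by
    rw [e]; exact (isIntegralElem_pow isIntegralElem_xin N).mul _ hN)⟩

theorem K : IsAlg fun t => t.K := of_isIntegralElem isIntegralElem_K

theorem xin : IsAlg fun t => t.xin := of_isIntegralElem isIntegralElem_xin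

theorem xin_inv : IsAlg fun t => t.xin⁻¹ := by
  refine ⟨1, ?_⟩
  convert isIntegralElem_const 1 using 1
  ext t; simp [t.inc.x_ne]

theorem sq (hg : IsAlg g) : IsAlg fun t => g t ^ 2 := by simpa only [pow_two] using hg.mul hg

/-- Both roots of `q² - s q + 1 = 0` are algebraic if `s` is. -/
theorem of_add_mul (hs : IsAlg fun t => f t + g t) (h1 : ∀ t, f t * g t = 1) : IsAlg f := by
  have hd : IsAlg fun t => f t - g t := by
    refine of_sq ?_
    convert hs.sq.sub (const 4) using 2 with t
    linear_combination -4 * h1 t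
  convert (const (1 / 2)).mul (hs.add hd) using 2 with t
  ring

theorem const_sub_K_sq (c : ℂ) : IsAlg fun t => c - t.K ^ 2 := (const c).sub K.sq

theorem eta21 : IsAlg fun t => eta21 t.K :=
  of_add_mul (g := fun t => eta11 t.K) (by simpa only [eta21_add] using const_sub_K_sq 2)
    fun t => eta21_mul t.K

theorem eta22 : IsAlg fun t => eta22 t.K :=
  of_add_mul (g := fun t => eta12 t.K) (by simpa only [eta22_add] using const_sub_K_sq 6)
    fun t => eta22_mul t.K

theorem eta11 : IsAlg fun t => eta11 t.K := by
  convert (const_sub_K_sq 2).sub eta21 using 2 with t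
  linear_combination eta21_add t.K

theorem eta12 : IsAlg fun t => eta12 t.K := by
  convert (const_sub_K_sq 6).sub eta22 using 2 with t
  linear_combination eta22_add t.K

theorem yin_add : IsAlg fun t => t.yin + t.yin⁻¹ := by
  convert ((const_sub_K_sq 4).sub xin).sub xin_inv using 2 with t
  exact t.inc.add_inv

theorem yin : IsAlg fun t => t.yin := of_add_mul yin_add fun t => mul_inv_cancel₀ t.inc.y_ne

theorem yin_inv : IsAlg fun t => t.yin⁻¹ := by
  convert yin_add.sub yin using 2 with t
  ring

theorem f3Zero_inv : IsAlg fun t => (f3Zero t.K)⁻¹ := by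
  refine of_sq ?_
  convert eta21.mul eta22 using 2 with t
  exact f3Zero_inv_sq t.inc

theorem f3In_xin : IsAlg fun t => f3In t.K t.xin := by
  refine of_sq ?_
  convert (xin.sub eta11).mul (xin.sub eta12) using 2 with t
  exact f3In_sq t.inc t.xin

/-- Integrality in the ring of functions on all waves gives one monic polynomial, which stays
nonzero under every specialization. Substituting ξ^N T for T preserves this because x_in ≠ 0. -/
theorem exists_polynomial (hg : IsAlg g) : ∃ Q : Polynomial (MvPolynomial (Fin 2) ℂ), ∀ t : Wave,
    Q.map (MvPolynomial.eval ![t.K, t.xin]) ≠ 0 ∧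
      (Q.map (MvPolynomial.eval ![t.K, t.xin])).eval (g t) = 0 := by
  obtain ⟨N, p, hp, hroot⟩ := hg
  refine ⟨p.comp (Polynomial.C (MvPolynomial.X 1 ^ N) * Polynomial.X), fun t => ?_⟩
  have hx : t.xin ^ N ≠ 0 := pow_ne_zero _ t.inc.x_ne
  have hmap : (Polynomial.C (MvPolynomial.X (1 : Fin 2) ^ N) * Polynomial.X).map
      (MvPolynomial.eval ![t.K, t.xin]) = Polynomial.C (t.xin ^ N) * Polynomial.X := by
    simp
  rw [Polynomial.map_comp, hmap]
  constructor
  · rw [Ne, Polynomial.comp_eq_zero_iff, not_or]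
    refine ⟨(hp.map _).ne_zero, fun h => hx ?_⟩
    have := congrArg (fun q => Polynomial.coeff q 1) h.2
    rwa [Polynomial.coeff_C_mul, Polynomial.coeff_X_one, mul_one,
      Polynomial.coeff_C_of_ne_zero one_ne_zero] at this
  · have h1 := congrFun hroot t
    rw [show Polynomial.eval₂ evalWave ((fun t => t.xin) ^ N * g) p t =
      Pi.evalRingHom (fun _ : Wave => ℂ) t (Polynomial.eval₂ evalWave ((fun t => t.xin) ^ N * g) p)
      from rfl, Polynomial.hom_eval₂] at h1
    rw [Polynomial.eval_comp, Polynomial.eval_map, Polynomial.eval_mul, Polynomial.eval_C,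
      Polynomial.eval_X]
    exact h1

end IsAlg

/-! ### Taylor coefficients depending algebraically on the incident wave -/

/-- A family of functions analytic at zero with algebraic Taylor coefficients. -/
def TaylorAlg (F : Wave → ℂ → ℂ) : Prop :=
  (∀ t, AnalyticAt ℂ (F t) 0) ∧ ∀ k : ℕ, IsAlg fun t => iteratedDeriv k (F t) 0

namespace TaylorAlg

variable {F G H : Wave → ℂ → ℂ}

theorem const {g : Wave → ℂ} (hg : IsAlg g) : TaylorAlg fun t _ => g t := by
  refine ⟨fun t => analyticAt_const, fun k => ?_⟩
  simp only [iteratedDeriv_const]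
  split_ifs
  · exact hg
  · exact IsAlg.const 0

theorem id : TaylorAlg fun _ z => z := ⟨fun _ => analyticAt_id, fun _ => IsAlg.const _⟩

theorem add (hF : TaylorAlg F) (hG : TaylorAlg G) : TaylorAlg fun t z => F t z + G t z := by
  refine ⟨fun t => (hF.1 t).add (hG.1 t), fun k => ?_⟩
  convert (hF.2 k).add (hG.2 k) using 2 with t
  exact iteratedDeriv_fun_add (hF.1 t).contDiffAt (hG.1 t).contDiffAt

theorem mul (hF : TaylorAlg F) (hG : TaylorAlg G) : TaylorAlg fun t z => F t z * G t z := by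
  refine ⟨fun t => (hF.1 t).mul (hG.1 t), fun k => ?_⟩
  convert IsAlg.sum (s := Finset.range (k + 1)) fun i _ =>
    ((IsAlg.const (k.choose i : ℂ)).mul (hF.2 i)).mul (hG.2 (k - i)) using 2 with t
  exact iteratedDeriv_fun_mul (hF.1 t).contDiffAt (hG.1 t).contDiffAt

theorem neg (hF : TaylorAlg F) : TaylorAlg fun t z => -F t z := by
  simpa using (const (IsAlg.const (-1))).mul hF

theorem sub (hF : TaylorAlg F) (hG : TaylorAlg G) : TaylorAlg fun t z => F t z - G t z := by
  simpa [sub_eq_add_neg] using hF.add hG.neg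

theorem pow (hF : TaylorAlg F) (n : ℕ) : TaylorAlg fun t z => F t z ^ n := by
  induction n with
  | zero => simpa using const (IsAlg.const 1)
  | succ n ih => simpa only [pow_succ] using ih.mul hF

/-- The Leibniz rule for F · F⁻¹ = 1 gives a recursion dividing only by F(0). Algebraicity of F(0)⁻¹
is assumed separately, because `IsAlg` allows only powers of x_in as denominators. -/
theorem inv (hF : TaylorAlg F) (h0 : ∀ t, F t 0 ≠ 0) (hi : IsAlg fun t => (F t 0)⁻¹) :
    TaylorAlg fun t z => (F t z)⁻¹ := by
  have han : ∀ t, AnalyticAt ℂ (fun z => (F t z)⁻¹) 0 := fun t => (hF.1 t).fun_inv (h0 t)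
  refine ⟨han, fun k => ?_⟩
  induction k using Nat.strong_induction_on with
  | _ k ih =>
    have hmul : ∀ t, iteratedDeriv k (fun _ : ℂ => (1 : ℂ)) 0 =
        ∑ i ∈ Finset.range k, (k.choose (i + 1) : ℂ) * iteratedDeriv (i + 1) (F t) 0 *
          iteratedDeriv (k - (i + 1)) (fun z => (F t z)⁻¹) 0 +
        F t 0 * iteratedDeriv k (fun z => (F t z)⁻¹) 0 := by
      intro t
      have e : (fun z => F t z * (F t z)⁻¹) =ᶠ[𝓝 0] fun _ => (1 : ℂ) := by
        filter_upwards [(hF.1 t).continuousAt.eventually_ne (h0 t)] with z hz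
        exact mul_inv_cancel₀ hz
      rw [← e.iteratedDeriv_eq k, iteratedDeriv_fun_mul (hF.1 t).contDiffAt (han t).contDiffAt,
        Finset.sum_range_succ']
      simp
    have hs : IsAlg fun t => ∑ i ∈ Finset.range k, (k.choose (i + 1) : ℂ) *
        iteratedDeriv (i + 1) (F t) 0 * iteratedDeriv (k - (i + 1)) (fun z => (F t z)⁻¹) 0 :=
      IsAlg.sum fun i hi => ((IsAlg.const _).mul (hF.2 _)).mul
        (ih _ (by have := Finset.mem_range.mp hi; omega))
    convert ((IsAlg.const (iteratedDeriv k (fun _ : ℂ => (1 : ℂ)) 0)).sub hs).mul hi using 2 with t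
    rw [hmul t, add_sub_cancel_left, mul_comm (F t 0), mul_inv_cancel_right₀ (h0 t)]

/-- In the Leibniz rule for F², the derivative of top order enters as 2 F(0) = 2 times itself, so it
is determined by F² and the lower orders. -/
theorem of_sq (hF : ∀ t, AnalyticAt ℂ (F t) 0) (h0 : ∀ t, F t 0 = 1)
    (hsq : TaylorAlg fun t z => F t z * F t z) : TaylorAlg F := by
  refine ⟨hF, fun k => ?_⟩
  induction k using Nat.strong_induction_on with
  | _ k ih =>
    rcases k with _ | k
    · simpa [h0] using IsAlg.const 1
    have hmul : ∀ t, iteratedDeriv (k + 1) (fun z => F t z * F t z) 0 =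
        ∑ i ∈ Finset.range k, ((k + 1).choose (i + 1) : ℂ) * iteratedDeriv (i + 1) (F t) 0 *
          iteratedDeriv (k + 1 - (i + 1)) (F t) 0 + 2 * iteratedDeriv (k + 1) (F t) 0 := by
      intro t
      rw [iteratedDeriv_fun_mul (hF t).contDiffAt (hF t).contDiffAt, Finset.sum_range_succ',
        Finset.sum_range_succ]
      simp [h0]; ring
    have hs : IsAlg fun t => ∑ i ∈ Finset.range k, ((k + 1).choose (i + 1) : ℂ) *
        iteratedDeriv (i + 1) (F t) 0 * iteratedDeriv (k + 1 - (i + 1)) (F t) 0 :=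
      IsAlg.sum fun i hi => by
        have := Finset.mem_range.mp hi
        exact ((IsAlg.const _).mul (ih _ (by omega))).mul (ih _ (by omega))
    convert (IsAlg.const (1 / 2)).mul ((hsq.2 (k + 1)).sub hs) using 2 with t
    rw [hmul t]; ring

theorem csqrt {g : Wave → ℂ} (hg : IsAlg g) : TaylorAlg fun t z => Complex.sqrt (1 - g t * z) := by
  refine of_sq (fun t => analyticAt_csqrt_one_sub (by fun_prop) (by simp)) (fun t => by simp) ?_
  convert (const (IsAlg.const 1)).sub ((const hg).mul id) using 3 with t z
  rw [← pow_two, csqrt_sq]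

theorem Rfun : TaylorAlg fun t => Rfun t.K :=
  (((csqrt IsAlg.eta11).mul (csqrt IsAlg.eta12)).mul (csqrt IsAlg.eta21)).mul (csqrt IsAlg.eta22)

theorem Yfun : TaylorAlg fun t => Yfun t.K := by
  convert (const (IsAlg.const (1 / 2))).mul (((((const (IsAlg.const_sub_K_sq 4)).mul id).sub
    (const (IsAlg.const 1))).sub (id.pow 2)).sub Rfun) using 3 with t z
  rw [HalfLine.Yfun]; ring

theorem Yfun_zpow (n : ℤ) : TaylorAlg fun t z => HalfLine.Yfun t.K z ^ n := by
  obtain ⟨k, rfl | rfl⟩ := n.eq_nat_or_neg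
  · simpa only [zpow_natCast] using Yfun.pow k
  · have h := Yfun.inv (fun t => by rw [Yfun_zero]; norm_num)
      (by simp only [Yfun_zero]; exact IsAlg.const _)
    simpa only [zpow_neg, zpow_natCast, inv_pow] using h.pow k

theorem bracketInf (ε : ℂ) (n : ℤ) : TaylorAlg fun t => bracketInf t.K t.xin t.yin ε n := by
  have hden : TaylorAlg fun t z => 2 * (1 - t.xin * z) * HalfLine.Rfun t.K z :=
    ((const (IsAlg.const 2)).mul ((const (IsAlg.const 1)).sub ((const IsAlg.xin).mul id))).mul Rfun
  have hinv := hden.inv (fun t => by simp [Rfun_zero])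
    (by simp only [Rfun_zero, mul_zero]; exact IsAlg.const _)
  exact ((Yfun_zpow n).mul ((id.mul (const (IsAlg.xin.mul (IsAlg.yin.sub IsAlg.yin_inv)))).sub
    (((const (IsAlg.f3In_xin.mul (IsAlg.const ε))).mul (csqrt IsAlg.eta21)).mul
      (csqrt IsAlg.eta22)))).neg.mul hinv

theorem bracketZero (ε : ℂ) (n : ℤ) : TaylorAlg fun t => bracketZero t.K t.xin t.yin ε n := by
  have hden : TaylorAlg fun t z => 2 * (z - t.xin) * HalfLine.Rfun t.K z :=
    ((const (IsAlg.const 2)).mul (id.sub (const IsAlg.xin))).mul Rfun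
  -- The denominator at 0 is -2 x_in; this is where powers of x_in have to be cleared.
  have hinv := hden.inv (fun t => by simp [Rfun_zero, t.inc.x_ne]) (by
    convert (IsAlg.const (-1 / 2)).mul IsAlg.xin_inv using 2 with t
    have := t.inc.x_ne
    rw [Rfun_zero]; field_simp; simp)
  have hsq : ∀ {f : ℂ → ℂ} {g : ℂ → ℂ}, (∀ K, g K = (f K)⁻¹) → (IsAlg fun t => g t.K) →
      TaylorAlg fun t z => Complex.sqrt (1 - z / f t.K) := fun e hg => by
    convert csqrt hg using 5 with t z
    rw [e, div_eq_inv_mul]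
  exact ((Yfun_zpow n).mul ((const (IsAlg.xin.mul (IsAlg.yin.sub IsAlg.yin_inv))).sub
    (((const ((IsAlg.f3In_xin.mul (IsAlg.const ε)).mul IsAlg.f3Zero_inv)).mul
      (hsq eta11_eq IsAlg.eta11)).mul (hsq eta12_eq IsAlg.eta12)))).mul hinv

theorem poleCoeff (hF : TaylorAlg F) (N : ℤ) : IsAlg fun t => poleCoeff (F t) N := by
  unfold HalfLine.poleCoeff
  split_ifs
  · simpa only [div_eq_mul_inv] using (hF.2 _).mul (IsAlg.const _)
  · exact IsAlg.const 0

end TaylorAlg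

theorem isAlg_resTerm (m n : ℤ) (i : Fin 8) : IsAlg fun t => resTerm t.K t.xin t.yin m n i := by
  simp only [resTerm_eq]
  split_ifs
  · exact (TaylorAlg.bracketZero _ _).poleCoeff _
  · exact ((TaylorAlg.bracketZero _ _).poleCoeff _).neg
  · exact (TaylorAlg.bracketInf _ _).poleCoeff _
  · exact ((TaylorAlg.bracketInf _ _).poleCoeff _).neg

theorem isAlg_fieldU (P : S2) : IsAlg fun t => fieldU t.K t.xin t.yin P := by
  match P with
  | S2.origin => exact IsAlg.const 0
  | S2.node m n k _ =>
    exact (((isAlg_resTerm m n _).add (isAlg_resTerm m n _)).add (isAlg_resTerm m n _)).add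
      (isAlg_resTerm m n _)

end

end HalfLine
-- Assembly of the theorem
theorem mainTheorem1 :
    ∃ u : ℂ → ℂ → ℂ → S2 → ℂ,
      (∀ K xin yin : ℂ, Incident K xin yin →
        -- the transformant has on `H₂` only two poles, simple and with the prescribed residues
        (∀ (D : CoordDisc K), ∀ z ∈ ball (0 : ℂ) 1,
          (D.Φ z ≠ p1 K xin yin → D.Φ z ≠ p4 K xin yin →
            ∃ a : ℂ, Tendsto (fun s => transformant K xin yin (D.Φ s)) (𝓝[≠] z) (𝓝 a)) ∧
          (D.Φ z = p1 K xin yin →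
            Tendsto (fun s => (s - z) * (transformant K xin yin (D.Φ s) * psi K D.Φ s)) (𝓝[≠] z)
              (𝓝 (-(2 * Real.pi * Complex.I)⁻¹))) ∧
          (D.Φ z = p4 K xin yin →
            Tendsto (fun s => (s - z) * (transformant K xin yin (D.Φ s) * psi K D.Φ s)) (𝓝[≠] z)
              (𝓝 (2 * Real.pi * Complex.I)⁻¹))) ∧
        -- the field is the Sommerfeld integral over the contours `Γ_j`
        (∀ j : Fin 8, ∃ c : Contour K, c.IsGamma xin yin j) ∧
        (∀ (j : Fin 8) (c : Contour K), c.IsGamma xin yin j → ∀ P : S2, P.DescribedBy j →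
          u K xin yin P = c.integral xin yin P.m P.n) ∧
        -- it solves the diffraction problem on the branched lattice
        StencilS2 K (u K xin yin) ∧
        (∀ (m : ℤ) (k : ZMod 2), 0 ≤ m → u K xin yin (S2.at m 0 k) = 0) ∧
        RadiationS2 xin yin (u K xin yin) ∧
        (∀ (P P' : S2) (r φ : ℝ), P.Polar r φ → P'.Polar r (4 * Real.pi - φ) →
          u K xin yin P' = -u K xin yin P) ∧
        -- it agrees with the Wiener–Hopf solution and its mirror image
        (∀ (P : S2) (r φ : ℝ), P.Polar r φ →
          (0 ≤ φ → φ ≤ 2 * Real.pi →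
            u K xin yin P = xin ^ P.m * yin ^ P.n + whScattered K xin P.m P.n) ∧
          (2 * Real.pi ≤ φ → φ ≤ 4 * Real.pi →
            u K xin yin P = -(xin ^ P.m * yin⁻¹ ^ P.n + whScattered K xin P.m P.n))) ∧
        -- evaluation by residues at the infinity points
        (∀ (i : Fin 8) (c : Contour K), c.Encircles xin yin {Jpt K i} → ∀ m n : ℤ,
          c.integral xin yin m n = resTerm K xin yin m n i) ∧
        (∀ (P : S2) (j : Fin 8), P.DescribedBy j →
          u K xin yin P = resTerm K xin yin P.m P.n (j + 1) + resTerm K xin yin P.m P.n (j + 2) +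
            resTerm K xin yin P.m P.n (j + 3) + resTerm K xin yin P.m P.n (j + 4)) ∧
        (∀ m n : ℤ, 0 < n → n < m →
          u K xin yin (S2.at m n 0) =
            poleCoeff (bracketInf K xin yin 1 n) (m + n) -
              poleCoeff (bracketInf K xin yin 1 (-n)) (m - n)) ∧
        (∀ m n : ℤ, 0 < n → m < n → -n < m →
          u K xin yin (S2.at m n 0) =
            poleCoeff (bracketInf K xin yin 1 n) (m + n) +
              poleCoeff (bracketZero K xin yin 1 n) (n - m))) ∧
      -- the field at every node is an algebraic function of `(K, x_in)`
      (∀ P : S2, ∃ Q : Polynomial (MvPolynomial (Fin 2) ℂ), ∀ K xin yin : ℂ,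
        Incident K xin yin →
          Q.map (MvPolynomial.eval ![K, xin]) ≠ 0 ∧
          (Q.map (MvPolynomial.eval ![K, xin])).eval (u K xin yin P) = 0) := by
  -- The residue sum is the witness, given for all waves at once; the integral representation then
  -- holds for every admissible contour.
  refine ⟨fieldU, fun K xin yin h => ⟨fun D z hz => ⟨fun h1 h4 => ?_, ?_, ?_⟩, exists_isGamma h,
    fun j c hc P hP => ?_, stencilS2_fieldU h, fun m k hm => fieldU_axis k hm, radiationS2_fieldU h,
    fun P P' r φ hP hP' => fieldU_antisymm h hP hP', fun P r φ hP => fieldU_eq_wienerHopf h hP,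
    fun i c hc m n => hc.integral_eq_single h m n, fun P j hP => fieldU_of_describedBy hP,
    fun m n hn hnm => fieldU_of_lt hn hnm, fun m n hn h1 h2 => fieldU_of_abs_lt hn h1 h2⟩,
    fun P => ?_⟩
  · exact exists_tendsto_transformant h hz h1 h4
  · exact tendsto_p1 h hz
  · exact tendsto_p4 h hz
  · rw [fieldU_of_describedBy hP, hc.integral_eq h]
  · obtain ⟨Q, hQ⟩ := (isAlg_fieldU P).exists_polynomial
    exact ⟨Q, fun K xin yin h => hQ ⟨K, xin, yin, h⟩⟩
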